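/- **Setting.** Let $L^2=L^2(\mathbb C,\mathbb C)$ and let $\mathcal S:L^2\to L^2$ be the Beurling transform, i.e. the Fourier multiplier with symbol $\bar\xi/\xi$. For real-valued $b\in L^1_{loc}(\mathbb C)$ put $\|b\|_{BMO}=\sup_R \frac1{|R|}\int_R|b-b_R|$, the supremum being over squares $R$ and $b_R$ being the mean of $b$ over $R$; let $\mathrm{CMO}(\mathbb C)$ be the closure of $C_c^\infty(\mathbb C,\mathbb R)$ in $BMO$. Fix $\chi\in C_c^\infty(\mathbb C,\mathbb R)$ with $\int\chi\ne0$, let $\chi_t(x)=t^{-2}\chi(x/t)$, and let $\mathcal H^1(\mathbb C)$ be the real Hardy space of those $f$ with $\|f\|_{\mathcal H^1}=\|\sup_{t>0}|f*\chi_t|\,\|_{L^1}<\infty$; $\langle b,f\rangle$ denotes the $BMO$–$\mathcal H^1$ duality pairing, that is, $\langle b,f\rangle=\lim_{k\to\infty}\int_{\mathbb C}\max(-k,\min(b,k))\,f$. For a complex Hilbert space $H$ and an operator $Q:H\to\mathcal H^1(\mathbb C)$ put, for $b\in\mathrm{CMO}(\mathbb C)$ and $f\in\mathcal H^1(\mathbb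 C)$, $$\|b\|_{X_Q}=\sup_{\|\omega\|_H=1}\langle b,Q\omega\rangle,\qquad \|f\|_{X_Q^*}=\sup\{\langle b,f\rangle: b\in \mathrm{CMO}(\mathbb C),\ \|b\|_{X_Q}=1\},$$ $$\mathscr A_Q=\{\omega\in H:\ \|\omega\|_H=1,\ \|Q\omega\|_{X_Q^*}=1\}.$$ Let $Q'_\omega$ be the Gâteaux derivative of $Q$ at $\omega$. Say that $Q$ satisfies assumption $(\ast)$ if, whenever $\omega,\gamma\in\mathscr A_Q$ and $Q\omega=Q\gamma$, there is $c\in\mathbb C$ with $|c|=1$ and $Q'_\omega(c\gamma)\neq0$. **Proposition.** Let $Q\omega=|\mathcal S\omega|^2-|\omega|^2$ for $\omega\in L^2$, and $\tilde Q(\omega,\gamma)=Q'_\omega\gamma$ for $(\omega,\gamma)\in L^2\times L^2$, where $\|(\omega,\gamma)\|^2=\|\omega\|^2+\|\gamma\|^2$. Then $Q$ and $\tilde Q$ take values in $\mathcal H^1(\mathbb C)$ and are Gâteaux differentiable as maps into $\mathcal H^1(\mathbb C)$ (for every choice of $\chi$), and: 1. $Q$ satisfies $(\ast)$. 2. $\tilde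 Q$ does not satisfy $(\ast)$. 3. More precisely, for every $(\omega,\gamma)\in\mathscr A_{\tilde Q}$ the pair $(\varphi,\psi)=(-\overline{\mathcal S\gamma},\overline{\mathcal S\omega})$ belongs to $\mathscr A_{\tilde Q}$ and satisfies $\tilde Q(\varphi,\psi)=\tilde Q(\omega,\gamma)$ and $\tilde Q'_{(\omega,\gamma)}\big(c\,(\varphi,\psi)\big)=0$ for all $c\in\mathbb C$ with $|c|=1$. -/

import Mathlib

open MeasureTheory Filter Topology
open scoped ENNReal NNReal FourierTransform

noncomputable section

namespace PlanarJacobian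

/-- The complex Hilbert space `L²(ℂ, ℂ)`. -/
abbrev L2 : Type := Lp ℂ 2 (volume : Measure ℂ)

/-- The real Banach space `L¹(ℂ, ℝ)`; it contains the Hardy space. -/
abbrev L1 : Type := Lp ℝ 1 (volume : Measure ℂ)

/-- The Hilbert space `L²(ℂ, ℂ) × L²(ℂ, ℂ)` with `‖(ω, γ)‖² = ‖ω‖² + ‖γ‖²`. -/
abbrev L2Pair : Type := WithLp 2 (L2 × L2)

/-! ### The Beurling transform -/

/-- The Fourier symbol `ξ̄ / ξ` of the Beurling transform. -/
def beurlingSymbol (ξ : ℂ) : ℂ := (starRingEnd ℂ) ξ / ξ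

theorem measurable_beurlingSymbol : Measurable beurlingSymbol := by
  unfold beurlingSymbol
  exact (Complex.continuous_conj.measurable).div measurable_id

theorem norm_beurlingSymbol_le (ξ : ℂ) : ‖beurlingSymbol ξ‖ ≤ 1 := by
  unfold beurlingSymbol
  rw [norm_div, RCLike.norm_conj]
  exact div_self_le_one _

theorem memLp_beurlingSymbol_mul (g : L2) :
    MemLp (fun ξ => beurlingSymbol ξ * g ξ) 2 (volume : Measure ℂ) := by
  refine (Lp.memLp g).of_le
    (measurable_beurlingSymbol.aestronglyMeasurable.mul (Lp.aestronglyMeasurable g))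
    (Eventually.of_forall fun ξ => ?_)
  rw [norm_mul]
  exact mul_le_of_le_one_left (norm_nonneg _) (norm_beurlingSymbol_le ξ)

/-- The Beurling transform `𝒮` on `L²(ℂ, ℂ)`: the Fourier multiplier with symbol `ξ̄ / ξ`, so that
`𝒮 (∂u/∂z̄) = ∂u/∂z`. -/
def beurling (ω : L2) : L2 :=
  𝓕⁻ ((memLp_beurlingSymbol_mul (𝓕 ω)).toLp (fun ξ => beurlingSymbol ξ * (𝓕 ω : L2) ξ))

/-! ### The planar Jacobian and its Gâteaux derivative -/

theorem integrable_jacobian (ω : L2) :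
    Integrable (fun z => ‖beurling ω z‖ ^ 2 - ‖ω z‖ ^ 2) (volume : Measure ℂ) :=
  ((memLp_two_iff_integrable_sq_norm (Lp.aestronglyMeasurable _)).1 (Lp.memLp (beurling ω))).sub
    ((memLp_two_iff_integrable_sq_norm (Lp.aestronglyMeasurable _)).1 (Lp.memLp ω))

/-- The planar Jacobian `Q ω = |𝒮 ω|² - |ω|²`. -/
def jacobian (ω : L2) : L1 :=
  (memLp_one_iff_integrable.2 (integrable_jacobian ω)).toLp
    (fun z => ‖beurling ω z‖ ^ 2 - ‖ω z‖ ^ 2)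

/-- The Gâteaux derivative of the planar Jacobian, `Q̃ (ω, γ) = Q'_ω γ`, as an operator on pairs. -/
def jacobianDeriv (p : L2Pair) : L1 := lineDeriv ℝ jacobian p.fst p.snd

/-- The map `(ω, γ) ↦ (-conj (𝒮 γ), conj (𝒮 ω))`. -/
def partner (p : L2Pair) : L2Pair :=
  WithLp.toLp 2 (-star (beurling p.snd), star (beurling p.fst))

/-! ### The real-variable Hardy space -/

/-- Real-valued compactly supported smooth functions on the plane. -/
def IsTest (φ : ℂ → ℝ) : Prop := ContDiff ℝ ((⊤ : ℕ∞) : WithTop ℕ∞) φ ∧ HasCompactSupport φ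

/-- The maximal function `sup_{t > 0} |f * χ_t|`, where `χ_t x = t⁻² χ (x / t)`. -/
def hardyMaximal (χ : ℂ → ℝ) (f : ℂ → ℝ) (x : ℂ) : ℝ≥0∞ :=
  ⨆ (t : ℝ) (_ : 0 < t), ‖∫ y, f y * ((t ^ 2)⁻¹ * χ ((x - y) / (t : ℂ)))‖ₑ

/-- The norm of the real-variable Hardy space, `∞` for functions outside the space. -/
def hardyNorm (χ : ℂ → ℝ) (f : L1) : ℝ≥0∞ := ∫⁻ x, hardyMaximal χ f x

/-- `f` belongs to the real-variable Hardy space. -/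
def MemHardy (χ : ℂ → ℝ) (f : L1) : Prop := hardyNorm χ f < ∞

/-! ### BMO, CMO and the pairing with the Hardy space -/

/-- The closed square with centre `c` and side length `2 r`, sides parallel to the axes. -/
def square (c : ℂ) (r : ℝ) : Set ℂ :=
  Set.Icc (c.re - r) (c.re + r) ×ℂ Set.Icc (c.im - r) (c.im + r)

/-- The BMO seminorm: the supremum of the mean oscillations over squares. -/
def bmoNorm (b : ℂ → ℝ) : ℝ≥0∞ :=
  ⨆ (c : ℂ) (r : ℝ) (_ : 0 < r), ⨍⁻ z in square c r, ‖b z - ⨍ w in square c r, b w‖ₑ ∂volume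

/-- `b` represents an element of CMO, the closure of `C_c^∞` in BMO. -/
def MemCMO (b : ℂ → ℝ) : Prop :=
  LocallyIntegrable b ∧ ∀ ε : ℝ≥0∞, 0 < ε → ∃ φ, IsTest φ ∧ bmoNorm (b - φ) < ε

/-- The duality pairing of BMO (hence of CMO) with the Hardy space,
`⟨b, f⟩ = lim_k ∫ b_k f`, where `b_k` is the truncation of `b` to values in `[-k, k]`.
(The integral `∫ b f` itself need not converge absolutely when `b` is unbounded; it is the pairing
when `b` is bounded.) -/
def pairing (b : ℂ → ℝ) (f : L1) : ℝ :=
  limUnder atTop fun k : ℕ => ∫ z, max (-(k : ℝ)) (min (b z) k) * f z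

/-! ### The norms, the extremal set and the symmetry assumption associated with an operator `Q` -/

section Operator

variable {H : Type*} [NormedAddCommGroup H] [NormedSpace ℂ H] [NormedSpace ℝ H]

/-- `‖b‖_{X_Q} = sup {⟨b, Q ω⟩ : ‖ω‖ = 1}`. -/
def normXQ (Q : H → L1) (b : ℂ → ℝ) : EReal :=
  ⨆ (ω : H) (_ : ‖ω‖ = 1), ((pairing b (Q ω) : ℝ) : EReal)

/-- The dual norm `‖f‖_{X_Q^*} = sup {⟨b, f⟩ : b ∈ X, ‖b‖_{X_Q} = 1}` with `X = CMO`. -/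
def normXQDual (Q : H → L1) (f : L1) : EReal :=
  ⨆ (b : ℂ → ℝ) (_ : MemCMO b ∧ normXQ Q b = 1), ((pairing b f : ℝ) : EReal)

/-- The set `𝒜` of unit vectors `ω` with `‖Q ω‖_{X_Q^*} = 1`. -/
def extremalSet (Q : H → L1) : Set H := {ω | ‖ω‖ = 1 ∧ normXQDual Q (Q ω) = 1}

/-- The symmetry assumption: if `ω, γ ∈ 𝒜` and `Q ω = Q γ`, then `Q'_ω (c γ) ≠ 0` for some complex
number `c` of modulus one. -/
def SymmetryAssumption (Q : H → L1) : Prop :=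
  ∀ ω ∈ extremalSet Q, ∀ γ ∈ extremalSet Q, Q ω = Q γ →
    ∃ c : ℂ, ‖c‖ = 1 ∧ lineDeriv ℝ Q ω (c • γ) ≠ 0

/-- `L` is the Gâteaux derivative at `ω` of `Q` as an operator into the Hardy space: `L` is real
linear, bounded into the Hardy space, and the difference quotients converge in the Hardy norm. -/
def HasGateauxDerivHardy (χ : ℂ → ℝ) (Q : H → L1) (ω : H) (L : H → L1) : Prop :=
  IsLinearMap ℝ L ∧
  (∃ C : ℝ≥0, ∀ h, hardyNorm χ (L h) ≤ C * ‖h‖ₑ) ∧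
  ∀ h, Tendsto (fun t : ℝ => hardyNorm χ (t⁻¹ • (Q (ω + t • h) - Q ω) - L h)) (𝓝[≠] 0) (𝓝 0)

end Operator

end PlanarJacobian

end

noncomputable section

namespace PlanarJacobian

open LineDeriv SchwartzMap
open scoped SchwartzMap ComplexConjugate

/-! ### The Beurling transform as a unitary operator -/

/-! `jacobian` is quadratic, with polar form `jacobianPolar ω γ` = 2 Re(𝒮ω · conj 𝒮γ) − 2 Re(ω ·
conj γ). Expansions along lines are therefore exact, and every derivative in the statement is a sum
of polar forms.

Assumption for Q: if the derivative at ω vanishes along γ and along iγ, then 𝒮ω · conj 𝒮γ = ω · conj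
γ almost everywhere. Taking moduli and using Qω = Qγ forces Qω = 0
(`jacobian_eq_zero_of_jacobianPolar_eq_zero`), which is impossible when the dual norm of Qω is 1.

Partner pair: 𝒮 is inverted by conjugating it with complex conjugation (`beurling_star_beurling`).
Hence the polar form of ω with any complex multiple of conj(𝒮ω) is zero, and the partner exchanges
the two terms of the polar form. This gives the third claim by pointwise algebra.

Failure for Q̃ also needs its extremal set to be nonempty, and this is where analysis enters. For
the explicit weight b = 2/(1+|z|²) the sharp bound |∫ b Qω| ≤ ‖ω‖² holds
(`abs_integral_bubble_mul_jacobian_le`), with equality at ω = ∂̄(z/(1+|z|²)). The bound combines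
Wirtinger's inequality on circles with a pointwise sum of squares (`weighted_gradient_inequality`).
By polarization b has norm one for Q̃, and a multiple of the equality case, taken in both slots,
lies in the extremal set.

Hardy space: for ω = ∂̄u the Jacobian is a null Lagrangian. One derivative is moved onto the dilated
test function, a constant is subtracted from u, and a Poincaré-type inequality bounds the smooth
maximal function by M(|Du|^{3/2})^{4/3}. The maximal theorem in L^{4/3} then returns the Dirichlet
energy of u. Density of such ω and lower semicontinuity of the Hardy norm give all of L², and
polarization gives Q̃. -/

theorem fourier_beurling (ω : L2) :
    (𝓕 (beurling ω) : L2) =ᵐ[volume] fun ξ => beurlingSymbol ξ * (𝓕 ω : L2) ξ := by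
  unfold beurling
  rw [FourierTransform.fourier_fourierInv_eq]
  exact MemLp.coeFn_toLp _

theorem fourier_injective : Function.Injective (fun ω : L2 => (𝓕 ω : L2)) :=
  (Lp.fourierTransformₗᵢ ℂ ℂ).injective

theorem beurling_add (ω η : L2) : beurling (ω + η) = beurling ω + beurling η := by
  apply fourier_injective
  simp only [FourierTransform.fourier_add]
  refine Lp.ext ?_
  have h : (𝓕 (ω + η) : L2) =ᵐ[volume] (𝓕 ω : L2) + (𝓕 η : L2) := by
    rw [FourierTransform.fourier_add]; exact Lp.coeFn_add _ _
  filter_upwards [fourier_beurling (ω + η), fourier_beurling ω, fourier_beurling η, h,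
    Lp.coeFn_add (𝓕 (beurling ω) : L2) (𝓕 (beurling η))] with ξ h1 h2 h3 h4 h5
  rw [h1, h5, h4]
  simp only [Pi.add_apply, h2, h3, mul_add]

theorem beurling_smul (c : ℂ) (ω : L2) : beurling (c • ω) = c • beurling ω := by
  apply fourier_injective
  simp only [FourierTransform.fourier_smul]
  refine Lp.ext ?_
  have h : (𝓕 (c • ω) : L2) =ᵐ[volume] c • (𝓕 ω : L2) := by
    rw [FourierTransform.fourier_smul]; exact Lp.coeFn_smul _ _
  filter_upwards [fourier_beurling (c • ω), fourier_beurling ω, h,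
    Lp.coeFn_smul c (𝓕 (beurling ω) : L2)] with ξ h1 h2 h4 h5
  rw [h1, h5, h4]
  simp only [Pi.smul_apply, h2, smul_eq_mul]
  ring

/-- At the origin, division by zero gives the symbol the value 0. That is a null set, so the
multiplier is still isometric. -/
theorem norm_beurlingSymbol {ξ : ℂ} (hξ : ξ ≠ 0) : ‖beurlingSymbol ξ‖ = 1 := by
  unfold beurlingSymbol
  rw [norm_div, RCLike.norm_conj, div_self (norm_ne_zero_iff.2 hξ)]

theorem ae_ne_zero : ∀ᵐ ξ : ℂ, ξ ≠ 0 := by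
  simp [ae_iff]

theorem norm_beurling (ω : L2) : ‖beurling ω‖ = ‖ω‖ := by
  rw [← Lp.norm_fourier_eq, ← Lp.norm_fourier_eq ω, Lp.norm_def, Lp.norm_def]
  congr 1
  refine eLpNorm_congr_norm_ae ?_
  filter_upwards [fourier_beurling ω, ae_ne_zero] with ξ h h0
  rw [h, norm_mul, norm_beurlingSymbol h0, one_mul]

/-- The Beurling transform as a linear isometry. -/
def beurlingIsometry : L2 →ₗᵢ[ℂ] L2 where
  toFun := beurling
  map_add' := beurling_add
  map_smul' := beurling_smul
  norm_map' := norm_beurling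

theorem continuous_beurling : Continuous beurling := beurlingIsometry.continuous

theorem inner_beurling (ω η : L2) : inner ℂ (beurling ω) (beurling η) = inner ℂ ω η :=
  beurlingIsometry.inner_map_map ω η

theorem beurling_neg (ω : L2) : beurling (-ω) = -beurling ω := beurlingIsometry.map_neg ω

theorem beurling_real_smul (t : ℝ) (ω : L2) : beurling (t • ω) = t • beurling ω := by
  have h (η : L2) : t • η = (t : ℂ) • η := by
    refine Lp.ext ?_
    filter_upwards [Lp.coeFn_smul t η, Lp.coeFn_smul (t : ℂ) η] with x h1 h2
    rw [h1, h2]; simp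
  rw [h, h, beurling_smul]

/-! ### Wirtinger derivatives of Schwartz functions -/

/-- The Wirtinger derivative `∂u/∂z̄` of a Schwartz function. -/
def dbar (u : 𝓢(ℂ, ℂ)) : 𝓢(ℂ, ℂ) := (1 / 2 : ℂ) • (∂_{(1 : ℂ)} u + Complex.I • ∂_{Complex.I} u)

/-- The Wirtinger derivative `∂u/∂z` of a Schwartz function. -/
def dz (u : 𝓢(ℂ, ℂ)) : 𝓢(ℂ, ℂ) := (1 / 2 : ℂ) • (∂_{(1 : ℂ)} u - Complex.I • ∂_{Complex.I} u)

theorem fourier_lineDeriv_apply (u : 𝓢(ℂ, ℂ)) (m ξ : ℂ) :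
    (𝓕 (∂_{m} u) : 𝓢(ℂ, ℂ)) ξ
      = (2 * Real.pi * Complex.I) * ((inner ℝ ξ m : ℝ) * (𝓕 u : 𝓢(ℂ, ℂ)) ξ) := by
  have : (inner ℝ · m).HasTemperateGrowth := ((innerSL ℝ).flip m).hasTemperateGrowth
  rw [SchwartzMap.fourier_lineDerivOp_eq]
  rw [smul_apply, smulLeftCLM_apply_apply this]
  simp [Complex.real_smul]

theorem fourier_dbar_apply (u : 𝓢(ℂ, ℂ)) (ξ : ℂ) :
    (𝓕 (dbar u) : 𝓢(ℂ, ℂ)) ξ = Real.pi * Complex.I * ξ * (𝓕 u : 𝓢(ℂ, ℂ)) ξ := by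
  simp only [dbar, FourierTransform.fourier_smul, FourierTransform.fourier_add]
  simp only [smul_apply, add_apply, smul_eq_mul, fourier_lineDeriv_apply,
    Complex.inner]
  have h := Complex.re_add_im ξ
  simp
  linear_combination (Real.pi * Complex.I * (𝓕 u : 𝓢(ℂ, ℂ)) ξ) * h

theorem fourier_dz_apply (u : 𝓢(ℂ, ℂ)) (ξ : ℂ) :
    (𝓕 (dz u) : 𝓢(ℂ, ℂ)) ξ = Real.pi * Complex.I * conj ξ * (𝓕 u : 𝓢(ℂ, ℂ)) ξ := by
  simp only [dz, sub_eq_add_neg, ← neg_smul, FourierTransform.fourier_smul,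
    FourierTransform.fourier_add]
  simp only [smul_apply, add_apply, smul_eq_mul, fourier_lineDeriv_apply,
    Complex.inner]
  have h : (ξ.re : ℂ) - ξ.im * Complex.I = conj ξ := by
    apply Complex.ext <;> simp
  simp
  linear_combination (Real.pi * Complex.I * (𝓕 u : 𝓢(ℂ, ℂ)) ξ) * h

/-- On the Fourier side ∂̄ and ∂ are multiplication by πiξ and πi·conj ξ; their quotient is the
symbol of 𝒮. -/
theorem beurling_dbar (u : 𝓢(ℂ, ℂ)) : beurling ((dbar u).toLp 2) = (dz u).toLp 2 := by
  apply fourier_injective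
  refine Lp.ext ?_
  simp only [SchwartzMap.toLp_fourier_eq]
  filter_upwards [fourier_beurling ((dbar u).toLp 2), ae_ne_zero, (𝓕 (dz u)).coeFn_toLp 2 volume,
    (𝓕 (dbar u)).coeFn_toLp 2 volume] with ξ h1 h0 h2 h3
  rw [h1, h2, SchwartzMap.toLp_fourier_eq, h3, fourier_dbar_apply, fourier_dz_apply,
    beurlingSymbol]
  field_simp

/-- A family of Schwartz functions whose Fourier transforms are all multiples of a fixed almost
everywhere nonzero function is dense in `L²`. -/
theorem dense_of_fourier_eq_mul (D : 𝓢(ℂ, ℂ) →ₗ[ℂ] 𝓢(ℂ, ℂ)) (m : ℂ → ℂ) (hm : Continuous m)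
    (hm0 : ∀ ξ, ξ ≠ 0 → m ξ ≠ 0)
    (h : ∀ u ξ, (𝓕 (D u) : 𝓢(ℂ, ℂ)) ξ = m ξ * (𝓕 u : 𝓢(ℂ, ℂ)) ξ) :
    DenseRange (fun u : 𝓢(ℂ, ℂ) => ((D u).toLp 2 : L2)) := by
  let T : 𝓢(ℂ, ℂ) →ₗ[ℂ] L2 := (SchwartzMap.toLpCLM ℂ ℂ 2 volume).toLinearMap ∘ₗ D
  have key : (LinearMap.range T)ᗮ = ⊥ := by
    rw [Submodule.eq_bot_iff]
    intro g hg
    rw [Submodule.mem_orthogonal] at hg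
    have hg' : ∀ u : 𝓢(ℂ, ℂ), ∫ ξ, conj (m ξ * (𝓕 u : 𝓢(ℂ, ℂ)) ξ) * (𝓕 g : L2) ξ = 0 := by
      intro u
      have h1 := hg (T u) ⟨u, rfl⟩
      rw [← Lp.inner_fourier_eq, L2.inner_def] at h1
      rw [← h1]
      refine integral_congr_ae ?_
      have : (𝓕 (T u) : L2) = (𝓕 (D u) : 𝓢(ℂ, ℂ)).toLp 2 := SchwartzMap.toLp_fourier_eq _
      rw [this]
      filter_upwards [(𝓕 (D u)).coeFn_toLp 2 volume] with ξ h2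
      rw [h2, h]
      simp [mul_comm]
    have hz : ∀ᵐ ξ : ℂ, conj (m ξ) * (𝓕 g : L2) ξ = 0 := by
      refine ae_eq_zero_of_integral_contDiff_smul_eq_zero ?_ ?_
      · have := (Lp.memLp (𝓕 g : L2)).locallyIntegrable (by norm_num)
        exact locallyIntegrableOn_univ.1 ((this.locallyIntegrableOn Set.univ).continuousOn_mul
          (Complex.continuous_conj.comp hm).continuousOn isOpen_univ.isLocallyClosed)
      · intro ψ hψ hψc
        let ψ' : ℂ → ℂ := fun x => (ψ x : ℂ)
        have hψ' : ContDiff ℝ ((⊤ : ℕ∞) : WithTop ℕ∞) ψ' := Complex.ofRealCLM.contDiff.comp hψ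
        have hψc' : HasCompactSupport ψ' := hψc.comp_left Complex.ofReal_zero
        -- Every test function on the frequency side is the Fourier transform of a Schwartz
        -- function, so orthogonality to the range becomes vanishing of conj(m)·ĝ as a distribution.
        have := hg' (𝓕⁻ (hψc'.toSchwartzMap hψ'))
        rw [FourierTransform.fourier_fourierInv_eq] at this
        rw [← this]
        refine integral_congr_ae (Eventually.of_forall fun ξ => ?_)
        simp [ψ']
        ring
    have : (𝓕 g : L2) = 0 := by
      refine Lp.ext ?_
      filter_upwards [hz, ae_ne_zero, Lp.coeFn_zero ℂ 2 (volume : Measure ℂ)] with ξ h1 h2 h3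
      rw [h3]
      simpa [hm0 ξ h2] using h1
    rw [← norm_eq_zero, ← Lp.norm_fourier_eq, this, norm_zero]
  have := (Submodule.topologicalClosure_eq_top_iff).2 key
  have h2 := (Submodule.dense_iff_topologicalClosure_eq_top).2 this
  exact h2

theorem denseRange_dbar : DenseRange (fun u : 𝓢(ℂ, ℂ) => ((dbar u).toLp 2 : L2)) := by
  refine dense_of_fourier_eq_mul
    { toFun := dbar, map_add' := ?_, map_smul' := ?_ } (fun ξ => Real.pi * Complex.I * ξ)
    (by fun_prop) (fun ξ h => by simp [h, Real.pi_ne_zero]) fourier_dbar_apply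
  · intro u v
    simp only [dbar, lineDerivOp_add]
    module
  · intro c u
    simp only [dbar, lineDerivOp_smul, RingHom.id_apply]
    module

theorem denseRange_dz : DenseRange (fun u : 𝓢(ℂ, ℂ) => ((dz u).toLp 2 : L2)) := by
  refine dense_of_fourier_eq_mul
    { toFun := dz, map_add' := ?_, map_smul' := ?_ } (fun ξ => Real.pi * Complex.I * conj ξ)
    (by fun_prop) (fun ξ h => by simp [h, Real.pi_ne_zero]) fourier_dz_apply
  · intro u v
    simp only [dz, lineDerivOp_add]
    module
  · intro c u
    simp only [dz, lineDerivOp_smul, RingHom.id_apply]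
    module

/-! ### Complex conjugation -/

/-- The complex conjugate of a Schwartz function. -/
def conjSchwartz (u : 𝓢(ℂ, ℂ)) : 𝓢(ℂ, ℂ) := u.postcompCLM Complex.conjCLE.toContinuousLinearMap

@[simp] theorem conjSchwartz_apply (u : 𝓢(ℂ, ℂ)) (x : ℂ) : conjSchwartz u x = conj (u x) := rfl

theorem lineDeriv_conjSchwartz (u : 𝓢(ℂ, ℂ)) (m : ℂ) :
    ∂_{m} (conjSchwartz u) = conjSchwartz (∂_{m} u) := by
  ext x
  rw [conjSchwartz_apply, SchwartzMap.lineDerivOp_apply_eq_fderiv,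
    SchwartzMap.lineDerivOp_apply_eq_fderiv]
  have : HasFDerivAt (conjSchwartz u)
      ((Complex.conjCLE.toContinuousLinearMap).comp (fderiv ℝ u x)) x :=
    (Complex.conjCLE.toContinuousLinearMap.hasFDerivAt).comp x (u.hasFDerivAt x)
  rw [this.fderiv]
  rfl

theorem dbar_conjSchwartz (u : 𝓢(ℂ, ℂ)) : dbar (conjSchwartz u) = conjSchwartz (dz u) := by
  ext x
  have h2 : conj (2 : ℂ) = 2 := Complex.conj_ofNat 2
  simp [dbar, dz, lineDeriv_conjSchwartz, h2]
  ring

theorem dz_conjSchwartz (u : 𝓢(ℂ, ℂ)) : dz (conjSchwartz u) = conjSchwartz (dbar u) := by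
  ext x
  have h2 : conj (2 : ℂ) = 2 := Complex.conj_ofNat 2
  simp [dbar, dz, lineDeriv_conjSchwartz, h2]
  ring

theorem star_toLp (u : 𝓢(ℂ, ℂ)) : star (u.toLp 2 : L2) = (conjSchwartz u).toLp 2 := by
  refine Lp.ext ?_
  filter_upwards [Lp.coeFn_star (u.toLp 2 : L2), u.coeFn_toLp 2 volume,
    (conjSchwartz u).coeFn_toLp 2 volume] with x h1 h2 h3
  rw [h1, h3, Pi.star_apply, h2]
  rfl

theorem norm_star_L2 (ω : L2) : ‖star ω‖ = ‖ω‖ := by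
  rw [Lp.norm_def, Lp.norm_def]
  congr 1
  refine eLpNorm_congr_norm_ae ?_
  filter_upwards [Lp.coeFn_star ω] with x h
  simp [h]

theorem star_sub_L2 (ω η : L2) : star (ω - η) = star ω - star η := by
  refine Lp.ext ?_
  filter_upwards [Lp.coeFn_star ω, Lp.coeFn_star η, Lp.coeFn_star (ω - η), Lp.coeFn_sub ω η,
    Lp.coeFn_sub (star ω) (star η)] with x h1 h2 h3 h4 h5
  rw [h3, h5, Pi.star_apply, h4, Pi.sub_apply, Pi.sub_apply, h1, h2, Pi.star_apply, Pi.star_apply,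
    star_sub]

theorem continuous_star_L2 : Continuous (star : L2 → L2) :=
  (Isometry.of_dist_eq fun x y => by
    rw [dist_eq_norm, dist_eq_norm, ← star_sub_L2, norm_star_L2]).continuous

/-- The Beurling transform is inverted by conjugating with complex conjugation. -/
theorem beurling_star_beurling (ω : L2) : beurling (star (beurling ω)) = star ω := by
  refine denseRange_dbar.induction_on (p := fun ω => beurling (star (beurling ω)) = star ω) ω ?_ ?_
  · exact isClosed_eq (continuous_beurling.comp (continuous_star_L2.comp continuous_beurling))
      continuous_star_L2
  · intro u
    -- For ω = ∂̄u: conj(∂u) = ∂̄(conj u), which 𝒮 sends to ∂(conj u) = conj(∂̄u).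
    rw [beurling_dbar, star_toLp, ← dbar_conjSchwartz, beurling_dbar, dz_conjSchwartz, star_toLp]

/-! ### The polar form of the planar Jacobian -/

theorem jacobian_ae (ω : L2) :
    jacobian ω =ᵐ[volume] fun z => ‖beurling ω z‖ ^ 2 - ‖ω z‖ ^ 2 :=
  MemLp.coeFn_toLp _

theorem integrable_re_mul_conj (ω η : L2) :
    Integrable (fun z => (ω z * conj (η z)).re) (volume : Measure ℂ) := by
  have h := (L2.integrable_inner (𝕜 := ℂ) η ω).re
  refine h.congr (Eventually.of_forall fun z => ?_)
  simp

theorem integrable_jacobianPolar (ω η : L2) :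
    Integrable (fun z => 2 * (beurling ω z * conj (beurling η z)).re - 2 * (ω z * conj (η z)).re)
      (volume : Measure ℂ) :=
  ((integrable_re_mul_conj _ _).const_mul 2).sub ((integrable_re_mul_conj _ _).const_mul 2)

/-- The polar form `2 Re (𝒮 ω conj (𝒮 η)) - 2 Re (ω conj η)` of the planar Jacobian. -/
def jacobianPolar (ω η : L2) : L1 :=
  (memLp_one_iff_integrable.2 (integrable_jacobianPolar ω η)).toLp _

theorem jacobianPolar_ae (ω η : L2) : jacobianPolar ω η =ᵐ[volume]
    fun z => 2 * (beurling ω z * conj (beurling η z)).re - 2 * (ω z * conj (η z)).re :=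
  MemLp.coeFn_toLp _

theorem norm_sq_add_real_smul (a b : ℂ) (t : ℝ) :
    ‖a + t • b‖ ^ 2 = ‖a‖ ^ 2 + t * (2 * (a * conj b).re) + t ^ 2 * ‖b‖ ^ 2 := by
  simp only [← Complex.normSq_eq_norm_sq, Complex.normSq_apply]
  simp
  ring

/-- There is no error term beyond t² Q(η), so both the L¹ line derivative and the Gâteaux derivative
in the Hardy norm can be read off. -/
theorem jacobian_add_smul (ω η : L2) (t : ℝ) :
    jacobian (ω + t • η) = jacobian ω + t • jacobianPolar ω η + t ^ 2 • jacobian η := by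
  refine Lp.ext ?_
  have hb : beurling (ω + t • η) =ᵐ[volume] fun z => beurling ω z + t • beurling η z := by
    rw [beurling_add, beurling_real_smul]
    filter_upwards [Lp.coeFn_add (beurling ω) (t • beurling η), Lp.coeFn_smul t (beurling η)]
      with z h1 h2
    rw [h1, Pi.add_apply, h2, Pi.smul_apply]
  filter_upwards [jacobian_ae (ω + t • η), hb, Lp.coeFn_add ω (t • η), Lp.coeFn_smul t η,
    Lp.coeFn_add (jacobian ω + t • jacobianPolar ω η) (t ^ 2 • jacobian η),
    Lp.coeFn_add (jacobian ω) (t • jacobianPolar ω η), Lp.coeFn_smul t (jacobianPolar ω η),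
    Lp.coeFn_smul (t ^ 2) (jacobian η), jacobian_ae ω, jacobian_ae η, jacobianPolar_ae ω η]
    with z h1 h2 h3 h4 h5 h6 h7 h8 h9 h10 h11
  rw [h1, h2, h3, Pi.add_apply, h4, Pi.smul_apply, h5, Pi.add_apply, h6, Pi.add_apply, h7,
    Pi.smul_apply, h8, Pi.smul_apply, h9, h10, h11, norm_sq_add_real_smul, norm_sq_add_real_smul]
  simp only [smul_eq_mul]
  ring

theorem jacobianPolar_comm (ω η : L2) : jacobianPolar ω η = jacobianPolar η ω := by
  refine Lp.ext ?_
  filter_upwards [jacobianPolar_ae ω η, jacobianPolar_ae η ω] with z h1 h2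
  rw [h1, h2]
  simp
  ring

theorem jacobianPolar_add_left (ω ω' η : L2) :
    jacobianPolar (ω + ω') η = jacobianPolar ω η + jacobianPolar ω' η := by
  refine Lp.ext ?_
  have hb : beurling (ω + ω') =ᵐ[volume] fun z => beurling ω z + beurling ω' z := by
    rw [beurling_add]
    exact Lp.coeFn_add _ _
  filter_upwards [jacobianPolar_ae (ω + ω') η, hb, Lp.coeFn_add ω ω', jacobianPolar_ae ω η,
    jacobianPolar_ae ω' η, Lp.coeFn_add (jacobianPolar ω η) (jacobianPolar ω' η)]
    with z h1 h2 h3 h4 h5 h6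
  rw [h1, h2, h3, h6, Pi.add_apply, Pi.add_apply, h4, h5]
  simp
  ring

theorem jacobianPolar_smul_left (t : ℝ) (ω η : L2) :
    jacobianPolar (t • ω) η = t • jacobianPolar ω η := by
  refine Lp.ext ?_
  have hb : beurling (t • ω) =ᵐ[volume] fun z => t • beurling ω z := by
    rw [beurling_real_smul]
    exact Lp.coeFn_smul _ _
  filter_upwards [jacobianPolar_ae (t • ω) η, hb, Lp.coeFn_smul t ω, jacobianPolar_ae ω η,
    Lp.coeFn_smul t (jacobianPolar ω η)] with z h1 h2 h3 h4 h6
  rw [h1, h2, h3, h6, Pi.smul_apply, Pi.smul_apply, h4]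
  simp
  ring

theorem jacobianPolar_add_right (ω η η' : L2) :
    jacobianPolar ω (η + η') = jacobianPolar ω η + jacobianPolar ω η' := by
  rw [jacobianPolar_comm, jacobianPolar_add_left, jacobianPolar_comm η, jacobianPolar_comm η']

theorem jacobianPolar_smul_right (t : ℝ) (ω η : L2) :
    jacobianPolar ω (t • η) = t • jacobianPolar ω η := by
  rw [jacobianPolar_comm, jacobianPolar_smul_left, jacobianPolar_comm]

theorem jacobianPolar_self (ω : L2) : jacobianPolar ω ω = (2 : ℝ) • jacobian ω := by
  refine Lp.ext ?_
  filter_upwards [jacobianPolar_ae ω ω, jacobian_ae ω, Lp.coeFn_smul (2 : ℝ) (jacobian ω)]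
    with z h1 h2 h3
  rw [h1, h3, Pi.smul_apply, h2]
  simp [Complex.mul_conj, Complex.normSq_eq_norm_sq]
  norm_cast
  ring

theorem jacobianPolar_eq_sub (ω η : L2) :
    jacobianPolar ω η = (2⁻¹ : ℝ) • (jacobian (ω + η) + (-1 : ℝ) • jacobian (ω + (-1 : ℝ) • η)) := by
  have h := jacobian_add_smul ω η 1
  rw [one_smul] at h
  rw [h, jacobian_add_smul]
  module

/-! ### Differentiability -/

theorem hasDerivAt_quadratic {E : Type*} [NormedAddCommGroup E] [NormedSpace ℝ E] (a b c : E) :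
    HasDerivAt (fun t : ℝ => a + t • b + t ^ 2 • c) b 0 := by
  have h1 : HasDerivAt (fun t : ℝ => t • b) b 0 := by
    simpa using (hasDerivAt_id (0 : ℝ)).smul_const b
  have h2 : HasDerivAt (fun t : ℝ => t ^ 2 • c) (0 : E) 0 := by
    simpa using (hasDerivAt_pow 2 (0 : ℝ)).smul_const c
  have h := (h1.const_add a).add h2
  rw [add_zero] at h
  exact h

theorem lineDeriv_jacobian (ω η : L2) : lineDeriv ℝ jacobian ω η = jacobianPolar ω η := by
  unfold lineDeriv
  simp_rw [jacobian_add_smul]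
  exact (hasDerivAt_quadratic _ _ _).deriv

theorem jacobianDeriv_eq (p : L2Pair) : jacobianDeriv p = jacobianPolar p.fst p.snd :=
  lineDeriv_jacobian _ _

theorem jacobianDeriv_add_smul (p q : L2Pair) (t : ℝ) :
    jacobianDeriv (p + t • q) = jacobianDeriv p
      + t • (jacobianPolar p.fst q.snd + jacobianPolar q.fst p.snd) + t ^ 2 • jacobianDeriv q := by
  simp only [jacobianDeriv_eq, WithLp.add_fst, WithLp.add_snd, WithLp.smul_fst, WithLp.smul_snd,
    jacobianPolar_add_left, jacobianPolar_add_right, jacobianPolar_smul_left,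
    jacobianPolar_smul_right]
  module

theorem lineDeriv_jacobianDeriv (p q : L2Pair) : lineDeriv ℝ jacobianDeriv p q
    = jacobianPolar p.fst q.snd + jacobianPolar q.fst p.snd := by
  unfold lineDeriv
  simp_rw [jacobianDeriv_add_smul]
  exact (hasDerivAt_quadratic _ _ _).deriv

/-! ### Bounds -/

theorem integral_norm_sq (ω : L2) : ∫ z, ‖ω z‖ ^ 2 = ‖ω‖ ^ 2 := by
  have h := L2.inner_def (𝕜 := ℂ) ω ω
  rw [inner_self_eq_norm_sq_to_K] at h
  have h2 : ∫ z, inner ℂ (ω z) (ω z) = ((∫ z, ‖ω z‖ ^ 2 : ℝ) : ℂ) := by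
    rw [← integral_complex_ofReal]
    refine integral_congr_ae (Eventually.of_forall fun z => ?_)
    simp only [inner_self_eq_norm_sq_to_K]
    simp
  rw [h2] at h
  exact (Complex.ofReal_injective (by simpa using h)).symm

theorem integrable_norm_sq (ω : L2) : Integrable (fun z => ‖ω z‖ ^ 2) (volume : Measure ℂ) :=
  (memLp_two_iff_integrable_sq_norm (Lp.aestronglyMeasurable _)).1 (Lp.memLp ω)

theorem integral_jacobian (ω : L2) : ∫ z, jacobian ω z = 0 := by
  rw [integral_congr_ae (jacobian_ae ω), integral_sub (integrable_norm_sq _) (integrable_norm_sq _),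
    integral_norm_sq, integral_norm_sq, norm_beurling, sub_self]

theorem enorm_jacobian_le (ω : L2) : ‖jacobian ω‖ₑ ≤ (2 : ℝ≥0) * ‖ω‖ₑ ^ 2 := by
  have h : ‖jacobian ω‖ ≤ 2 * ‖ω‖ ^ 2 := by
    rw [L1.norm_eq_integral_norm]
    calc ∫ z, ‖jacobian ω z‖ ≤ ∫ z, (‖beurling ω z‖ ^ 2 + ‖ω z‖ ^ 2) := by
          refine integral_mono_ae (L1.integrable_coeFn _).norm
            ((integrable_norm_sq _).add (integrable_norm_sq _)) ?_
          filter_upwards [jacobian_ae ω] with z hz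
          rw [hz, Real.norm_eq_abs, abs_le]
          constructor <;> nlinarith [sq_nonneg ‖beurling ω z‖, sq_nonneg ‖ω z‖]
      _ = 2 * ‖ω‖ ^ 2 := by
          rw [integral_add (integrable_norm_sq _) (integrable_norm_sq _), integral_norm_sq,
            integral_norm_sq, norm_beurling]
          ring
  calc ‖jacobian ω‖ₑ = ENNReal.ofReal ‖jacobian ω‖ := (ofReal_norm _).symm
    _ ≤ ENNReal.ofReal (2 * ‖ω‖ ^ 2) := ENNReal.ofReal_le_ofReal h
    _ = (2 : ℝ≥0) * ‖ω‖ₑ ^ 2 := by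
      rw [ENNReal.ofReal_mul (by norm_num), ENNReal.ofReal_pow (norm_nonneg _), ofReal_norm]
      simp

/-- A quadratic bound for the Jacobian in a seminorm implies a bilinear bound for its polar form. -/
theorem jacobianPolar_bound (N : L1 → ℝ≥0∞) (hadd : ∀ f g, N (f + g) ≤ N f + N g)
    (hsmul : ∀ (c : ℝ) f, N (c • f) ≤ ‖c‖ₑ * N f) (C : ℝ≥0)
    (hN : ∀ ω, N (jacobian ω) ≤ C * ‖ω‖ₑ ^ 2) (ω η : L2) :
    N (jacobianPolar ω η) ≤ (4 * C : ℝ≥0) * ‖ω‖ₑ * ‖η‖ₑ := by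
  have h0 : N 0 = 0 := by simpa using hsmul 0 0
  by_cases hω : ω = 0
  · have : jacobianPolar ω η = 0 := by
      simpa [hω] using jacobianPolar_smul_left 0 ω η
    simp [this, h0]
  by_cases hη : η = 0
  · have : jacobianPolar ω η = 0 := by
      simpa [hη] using jacobianPolar_smul_right 0 ω η
    simp [this, h0]
  -- Polarization is not homogeneous in each slot separately, so it is applied to unit vectors: α ±
  -- β have norm at most 2, hence the factor 2² = 4.
  have hunit : ∀ α β : L2, ‖α‖ = 1 → ‖β‖ = 1 → N (jacobianPolar α β) ≤ (4 * C : ℝ≥0) := by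
    intro α β hα hβ
    have hle : ∀ γ : L2, ‖γ‖ ≤ 2 → N (jacobian γ) ≤ (4 * C : ℝ≥0) := by
      intro γ hγ
      have h1 : ‖γ‖ₑ ≤ (2 : ℝ≥0) := by
        rw [← ofReal_norm]
        exact (ENNReal.ofReal_le_ofReal hγ).trans (by simp)
      calc N (jacobian γ) ≤ C * ‖γ‖ₑ ^ 2 := hN γ
        _ ≤ C * (2 : ℝ≥0) ^ 2 := by gcongr
        _ = (4 * C : ℝ≥0) := by norm_cast; norm_num; ring_nf
    have e : ‖(2⁻¹ : ℝ)‖ₑ = 2⁻¹ := by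
      rw [Real.enorm_eq_ofReal (by norm_num), ENNReal.ofReal_inv_of_pos (by norm_num)]
      simp
    rw [jacobianPolar_eq_sub]
    calc _ ≤ 2⁻¹ * (N (jacobian (α + β)) + 1 * N (jacobian (α + (-1 : ℝ) • β))) := by
          refine (hsmul _ _).trans ?_
          rw [e]
          gcongr
          refine (hadd _ _).trans ?_
          gcongr
          refine (hsmul _ _).trans ?_
          simp
      _ ≤ 2⁻¹ * ((4 * C : ℝ≥0) + 1 * (4 * C : ℝ≥0)) := by
          gcongr
          · exact hle _ ((norm_add_le _ _).trans (by rw [hα, hβ]; norm_num))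
          · exact hle _ ((norm_add_le _ _).trans (by rw [norm_smul, hα, hβ]; norm_num))
      _ = (4 * C : ℝ≥0) := by
          rw [one_mul, ← two_mul, ← mul_assoc, ENNReal.inv_mul_cancel (by simp) (by simp), one_mul]
  have key : jacobianPolar ω η
      = (‖ω‖ * ‖η‖) • jacobianPolar ((‖ω‖⁻¹ : ℝ) • ω) ((‖η‖⁻¹ : ℝ) • η) := by
    have h1 : ‖ω‖ ≠ 0 := norm_ne_zero_iff.2 hω
    have h2 : ‖η‖ ≠ 0 := norm_ne_zero_iff.2 hη
    rw [jacobianPolar_smul_left, jacobianPolar_smul_right, smul_smul, smul_smul]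
    rw [show ‖ω‖ * ‖η‖ * ‖ω‖⁻¹ * ‖η‖⁻¹ = 1 by field_simp, one_smul]
  rw [key]
  refine (hsmul _ _).trans ?_
  rw [enorm_mul, enorm_norm, enorm_norm, mul_comm, mul_assoc]
  gcongr
  exact hunit _ _ (by rw [norm_smul]; simp [hω]) (by rw [norm_smul]; simp [hη])

theorem norm_jacobianPolar_le (ω η : L2) : ‖jacobianPolar ω η‖ ≤ 8 * ‖ω‖ * ‖η‖ := by
  have h := jacobianPolar_bound (fun f => ‖f‖ₑ) (fun f g => enorm_add_le f g)
    (fun c f => (enorm_smul c f).le) 2 enorm_jacobian_le ω η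
  have h2 := ENNReal.toReal_mono (by finiteness) h
  simp only [toReal_enorm, ENNReal.toReal_mul] at h2
  norm_num at h2
  exact h2

theorem continuous_jacobian : Continuous jacobian := by
  rw [continuous_iff_continuousAt]
  intro ω
  have h : ∀ η : L2, jacobian η - jacobian ω = jacobianPolar ω (η - ω) + jacobian (η - ω) := by
    intro η
    have := jacobian_add_smul ω (η - ω) 1
    simp only [one_smul, one_pow, add_sub_cancel] at this
    rw [this]
    abel
  have hb : ∀ η : L2, ‖jacobian η - jacobian ω‖ ≤ 8 * ‖ω‖ * ‖η - ω‖ + 4 * ‖η - ω‖ ^ 2 := by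
    intro η
    rw [h]
    refine (norm_add_le _ _).trans (add_le_add (norm_jacobianPolar_le _ _) ?_)
    have h1 := norm_jacobianPolar_le (η - ω) (η - ω)
    rw [jacobianPolar_self, norm_smul (2 : ℝ)] at h1
    norm_num at h1
    nlinarith
  rw [ContinuousAt, tendsto_iff_norm_sub_tendsto_zero]
  refine squeeze_zero (fun _ => norm_nonneg _) hb ?_
  have : Continuous fun η : L2 => 8 * ‖ω‖ * ‖η - ω‖ + 4 * ‖η - ω‖ ^ 2 := by fun_prop
  simpa using this.tendsto ω

theorem continuous_integral_mul {ψ : ℂ → ℝ} (hψ : AEStronglyMeasurable ψ volume) {M : ℝ}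
    (hM : ∀ x, |ψ x| ≤ M) : Continuous fun f : L1 => ∫ x, ψ x * f x := by
  have hint : ∀ f : L1, Integrable (fun x => ψ x * f x) volume := fun f =>
    (L1.integrable_coeFn f).bdd_mul hψ (Eventually.of_forall hM)
  refine (LipschitzWith.of_dist_le_mul (K := M.toNNReal) fun f g => ?_).continuous
  have hM0 : 0 ≤ M := (abs_nonneg _).trans (hM 0)
  rw [Real.dist_eq, dist_eq_norm, Real.coe_toNNReal _ hM0, ← integral_sub (hint f) (hint g),
    L1.norm_eq_integral_norm, ← integral_const_mul]
  rw [← Real.norm_eq_abs]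
  refine norm_integral_le_of_norm_le ((L1.integrable_coeFn (f - g)).norm.const_mul M) ?_
  filter_upwards [Lp.coeFn_sub f g] with x hx
  rw [hx, Pi.sub_apply, ← mul_sub, norm_mul]
  gcongr
  exact hM x

/-! ### The Hardy–Littlewood maximal function on the plane -/

/-- The Hardy–Littlewood maximal function, normalized by the square of the radius. -/
def maximalFn (F : ℂ → ℝ≥0∞) (x : ℂ) : ℝ≥0∞ :=
  ⨆ (r : ℝ) (_ : 0 < r), (∫⁻ y in Metric.ball x r, F y) / ENNReal.ofReal (r ^ 2)

theorem setLIntegral_ball_le_maximalFn (F : ℂ → ℝ≥0∞) (x : ℂ) {r : ℝ} (hr : 0 < r) :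
    ∫⁻ y in Metric.ball x r, F y ≤ maximalFn F x * ENNReal.ofReal (r ^ 2) := by
  have h : (∫⁻ y in Metric.ball x r, F y) / ENNReal.ofReal (r ^ 2) ≤ maximalFn F x :=
    le_iSup₂_of_le r hr le_rfl
  rwa [ENNReal.div_le_iff (by simp; positivity) (by simp)] at h

/-- An open ball is the increasing union of slightly smaller concentric ones, each contained in the
balls of radius `r` with nearby centre. No measurability of `F` is needed, so the maximal function
of any `F` is measurable. -/
theorem lowerSemicontinuous_setLIntegral_ball {F : ℂ → ℝ≥0∞} (r : ℝ) :
    LowerSemicontinuous fun x => ∫⁻ y in Metric.ball x r, F y := by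
  intro x a ha
  have hU : Metric.ball x r = ⋃ n : ℕ, Metric.ball x (r - 1 / ((n : ℝ) + 1)) := by
    ext y
    simp only [Metric.mem_ball, Set.mem_iUnion]
    constructor
    · intro h
      obtain ⟨n, hn⟩ := exists_nat_one_div_lt (sub_pos.2 h)
      exact ⟨n, by linarith⟩
    · rintro ⟨n, hn⟩
      have : 0 < 1 / ((n : ℝ) + 1) := by positivity
      linarith
  have hmono : Monotone fun n : ℕ => Metric.ball x (r - 1 / ((n : ℝ) + 1)) := by
    intro m n hmn
    apply Metric.ball_subset_ball
    have := one_div_le_one_div_of_le (by positivity : (0 : ℝ) < m + 1)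
      (by gcongr : (m : ℝ) + 1 ≤ n + 1)
    linarith
  simp only at ha
  rw [hU, setLIntegral_iUnion_of_directed F (directed_of_isDirected_le hmono), gt_iff_lt,
    lt_iSup_iff] at ha
  obtain ⟨n, hn⟩ := ha
  filter_upwards [Metric.ball_mem_nhds x (by positivity : (0 : ℝ) < 1 / ((n : ℝ) + 1))] with z hz
  refine hn.trans_le (lintegral_mono_set ?_)
  apply Metric.ball_subset_ball'
  rw [Metric.mem_ball, dist_comm] at hz
  linarith

theorem measurable_maximalFn (F : ℂ → ℝ≥0∞) : Measurable (maximalFn F) := by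
  have : LowerSemicontinuous (maximalFn F) := by
    refine lowerSemicontinuous_iSup fun r => lowerSemicontinuous_iSup fun hr => ?_
    intro x a ha
    have hne : ENNReal.ofReal (r ^ 2) ≠ 0 := by simp; positivity
    simp only [ENNReal.lt_div_iff_mul_lt (Or.inl hne) (Or.inl ENNReal.ofReal_ne_top)] at ha ⊢
    exact lowerSemicontinuous_setLIntegral_ball r x _ ha
  exact this.measurable

/-- The factor π comes from normalizing by r² instead of the area. Its use is to keep the maximal
function finite, so that `toReal` loses nothing. -/
theorem maximalFn_le_of_le {F : ℂ → ℝ≥0∞} {K : ℝ≥0∞} (h : ∀ x, F x ≤ K) (x : ℂ) :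
    maximalFn F x ≤ K * NNReal.pi := by
  refine iSup₂_le fun r hr => ?_
  rw [ENNReal.div_le_iff (by simp; positivity) (by simp)]
  calc ∫⁻ y in Metric.ball x r, F y ≤ ∫⁻ y in Metric.ball x r, K := lintegral_mono fun y => h y
    _ = K * NNReal.pi * ENNReal.ofReal (r ^ 2) := by
      rw [setLIntegral_const, Complex.volume_ball, ENNReal.ofReal_pow hr.le]
      ring

/-- The weak-type `(1, 1)` inequality. -/
theorem volume_maximalFn_gt_le (F : ℂ → ℝ≥0∞) (hF : ∫⁻ y, F y ≠ ∞) {a : ℝ} (ha : 0 < a) :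
    volume {x | ENNReal.ofReal a < maximalFn F x}
      ≤ ENNReal.ofReal (16 * Real.pi / a) * ∫⁻ y, F y := by
  set E := {x | ENNReal.ofReal a < maximalFn F x}
  have hE : ∀ x ∈ E, ∃ r, 0 < r ∧ ENNReal.ofReal (a * r ^ 2) < ∫⁻ y in Metric.ball x r, F y := by
    intro x hx
    obtain ⟨r, hr⟩ := lt_iSup_iff.1 (show ENNReal.ofReal a < maximalFn F x from hx)
    obtain ⟨hr0, h⟩ := lt_iSup_iff.1 hr
    refine ⟨r, hr0, ?_⟩
    have hne : ENNReal.ofReal (r ^ 2) ≠ 0 := by simp; positivity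
    rw [ENNReal.lt_div_iff_mul_lt (Or.inl hne) (Or.inl ENNReal.ofReal_ne_top)] at h
    rwa [ENNReal.ofReal_mul ha.le]
  choose! r hr0 hr using hE
  set I := (∫⁻ y, F y).toReal
  -- The Vitali covering lemma requires bounded radii; integrability of `F` supplies the bound.
  have hR : ∀ x ∈ E, r x ≤ √(I / a) := by
    intro x hx
    apply Real.le_sqrt_of_sq_le
    rw [le_div_iff₀ ha, mul_comm]
    refine (ENNReal.ofReal_le_iff_le_toReal hF).1 ((hr x hx).le.trans (setLIntegral_le_lintegral _ _))
  obtain ⟨u, huE, hdisj, hcov⟩ := Vitali.exists_disjoint_subfamily_covering_enlargement_ball E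
    (fun x => x) r _ hR 4 (by norm_num)
  have hucount : u.Countable := hdisj.countable_of_isOpen (fun _ _ => Metric.isOpen_ball)
    fun x hx => Metric.nonempty_ball.2 (hr0 x (huE hx))
  have hsub : E ⊆ ⋃ x ∈ u, Metric.ball x (4 * r x) := by
    intro x hx
    obtain ⟨y, hy, h⟩ := hcov x hx
    exact Set.mem_iUnion₂.2 ⟨y, hy, h (Metric.mem_ball_self (hr0 x hx))⟩
  calc volume E ≤ volume (⋃ x ∈ u, Metric.ball x (4 * r x)) := measure_mono hsub
    _ ≤ ∑' x : u, volume (Metric.ball (x : ℂ) (4 * r x)) := measure_biUnion_le _ hucount _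
    _ ≤ ∑' x : u, ENNReal.ofReal (16 * Real.pi / a) * ∫⁻ y in Metric.ball (x : ℂ) (r x), F y := by
        refine ENNReal.tsum_le_tsum fun x => ?_
        have hx := hr x (huE x.2)
        have hx0 := hr0 x (huE x.2)
        -- The enlarged disc has area 16π r² = (16π/a)·(a r²), which explains the constant.
        calc volume (Metric.ball (x : ℂ) (4 * r x))
            = ENNReal.ofReal (16 * Real.pi / a) * ENNReal.ofReal (a * r x ^ 2) := by
              rw [Complex.volume_ball, ← ENNReal.ofReal_mul (by positivity),
                ← ENNReal.ofReal_pow (by positivity), ← ENNReal.ofReal_coe_nnreal,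
                ← ENNReal.ofReal_mul (by positivity)]
              congr 1
              rw [NNReal.coe_real_pi]
              field_simp
              ring
          _ ≤ _ := by gcongr
    _ = ENNReal.ofReal (16 * Real.pi / a) * ∫⁻ y in ⋃ x ∈ u, Metric.ball x (r x), F y := by
        rw [ENNReal.tsum_mul_left, lintegral_biUnion hucount (fun _ _ => measurableSet_ball) hdisj]
    _ ≤ _ := by gcongr; exact Measure.restrict_le_self

/-- The distributional inequality behind the strong-type estimates. -/
theorem volume_maximalFn_gt_le_setLIntegral {F : ℂ → ℝ≥0∞} (hm : Measurable F)
    (hF : ∫⁻ y, F y ≠ ∞) {a : ℝ} (ha : 0 < a) :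
    volume {x | ENNReal.ofReal a < maximalFn F x} ≤ ENNReal.ofReal (32 * Real.pi / a)
      * ∫⁻ y in {y | ENNReal.ofReal (a / (2 * Real.pi)) < F y}, F y := by
  -- With this threshold the part of `F` below `s` adds at most π s = a/2 to the maximal function,
  -- so only the truncation `G` can lift it above a/2.
  set s := ENNReal.ofReal (a / (2 * Real.pi))
  set T := {y | s < F y}
  have hT : MeasurableSet T := measurableSet_lt measurable_const hm
  set G := T.indicator F
  have hG : ∫⁻ y, G y = ∫⁻ y in T, F y := lintegral_indicator hT F
  have hle : ∀ x, maximalFn F x ≤ maximalFn G x + ENNReal.ofReal (a / 2) := by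
    intro x
    refine iSup₂_le fun r hr => ?_
    have hne : ENNReal.ofReal (r ^ 2) ≠ 0 := by simp; positivity
    rw [ENNReal.div_le_iff hne (by simp), add_mul]
    calc ∫⁻ y in Metric.ball x r, F y ≤ ∫⁻ y in Metric.ball x r, (G y + s) := by
          refine lintegral_mono fun y => ?_
          by_cases hy : y ∈ T
          · simp [G, hy]
          · simpa [G, hy] using not_lt.1 hy
      _ = (∫⁻ y in Metric.ball x r, G y) + s * volume (Metric.ball x r) := by
          rw [lintegral_add_right _ measurable_const, setLIntegral_const]
      _ ≤ maximalFn G x * ENNReal.ofReal (r ^ 2)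
          + ENNReal.ofReal (a / 2) * ENNReal.ofReal (r ^ 2) := by
          refine add_le_add (setLIntegral_ball_le_maximalFn G x hr) ?_
          · rw [Complex.volume_ball, ← ENNReal.ofReal_pow hr.le, ← ENNReal.ofReal_coe_nnreal,
              ← ENNReal.ofReal_mul (by positivity), ← ENNReal.ofReal_mul (by positivity),
              ← ENNReal.ofReal_mul (by positivity)]
            apply le_of_eq
            congr 1
            rw [NNReal.coe_real_pi]
            field_simp
  calc volume {x | ENNReal.ofReal a < maximalFn F x}
      ≤ volume {x | ENNReal.ofReal (a / 2) < maximalFn G x} := by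
        refine measure_mono fun x hx => ?_
        by_contra hcon
        have h1 : maximalFn G x ≤ ENNReal.ofReal (a / 2) := not_lt.1 hcon
        have h2 := (hle x).trans (add_le_add_left h1 _)
        rw [← ENNReal.ofReal_add (by positivity) (by positivity), add_halves] at h2
        exact not_lt.2 h2 hx
    _ ≤ ENNReal.ofReal (16 * Real.pi / (a / 2)) * ∫⁻ y, G y := by
        refine volume_maximalFn_gt_le G ?_ (by positivity)
        rw [hG]
        exact ne_top_of_le_ne_top hF (setLIntegral_le_lintegral _ _)
    _ = _ := by
        rw [hG]
        congr 2
        field_simp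
        norm_num

/-- The strong-type inequality for the maximal function, for bounded integrable functions. -/
theorem lintegral_maximalFn_rpow_le {f : ℂ → ℝ} (hm : Measurable f) (h0 : ∀ x, 0 ≤ f x) {K : ℝ}
    (hK : ∀ x, f x ≤ K) (hF : ∫⁻ y, ENNReal.ofReal (f y) ≠ ∞) {p : ℝ} (hp : 1 < p) :
    ∫⁻ x, ENNReal.ofReal ((maximalFn (fun y => ENNReal.ofReal (f y)) x).toReal ^ p)
      ≤ ENNReal.ofReal (32 * Real.pi * (p / (p - 1)) * (2 * Real.pi) ^ (p - 1))
        * ∫⁻ x, ENNReal.ofReal (f x ^ p) := by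
  set F : ℂ → ℝ≥0∞ := fun y => ENNReal.ofReal (f y)
  have hFm : Measurable F := hm.ennreal_ofReal
  have hfin : ∀ x, maximalFn F x ≠ ∞ := fun x => ne_top_of_le_ne_top
    (ENNReal.mul_ne_top ENNReal.ofReal_ne_top ENNReal.coe_ne_top)
    (maximalFn_le_of_le (fun y => ENNReal.ofReal_le_ofReal (hK y)) x)
  -- The layer-cake formula is used twice: with exponent p for the volume, and, after the
  -- distributional inequality has produced ν of the superlevel sets of 2πf, backwards with exponent
  -- p − 1 for ν.
  set ν := (volume : Measure ℂ).withDensity F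
  have hset : ∀ t : ℝ, MeasurableSet {y | t < 2 * Real.pi * f y} := fun t =>
    measurableSet_lt measurable_const (hm.const_mul _)
  rw [lintegral_rpow_eq_lintegral_meas_lt_mul volume (Eventually.of_forall fun x => ENNReal.toReal_nonneg)
    (measurable_maximalFn F).ennreal_toReal.aemeasurable (by linarith)]
  calc ENNReal.ofReal p * ∫⁻ t in Set.Ioi (0 : ℝ),
        volume {x | t < (maximalFn F x).toReal} * ENNReal.ofReal (t ^ (p - 1))
      ≤ ENNReal.ofReal p * ∫⁻ t in Set.Ioi (0 : ℝ), ENNReal.ofReal (32 * Real.pi)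
        * (ν {y | t < 2 * Real.pi * f y} * ENNReal.ofReal (t ^ (p - 1 - 1))) := by
        refine mul_le_mul_right (setLIntegral_mono' measurableSet_Ioi fun t ht => ?_) _
        have ht : 0 < t := ht
        have e1 : {x | t < (maximalFn F x).toReal} = {x | ENNReal.ofReal t < maximalFn F x} := by
          ext x
          exact (ENNReal.ofReal_lt_iff_lt_toReal ht.le (hfin x)).symm
        have e2 : {y | ENNReal.ofReal (t / (2 * Real.pi)) < F y} = {y | t < 2 * Real.pi * f y} := by
          ext y
          simp only [Set.mem_ofPred_eq, F]
          rw [ENNReal.ofReal_lt_ofReal_iff_of_nonneg (by positivity), div_lt_iff₀ (by positivity),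
            mul_comm]
        have h := volume_maximalFn_gt_le_setLIntegral hFm hF ht
        rw [e2, ← withDensity_apply F (hset t)] at h
        rw [e1]
        calc _ ≤ ENNReal.ofReal (32 * Real.pi / t) * ν {y | t < 2 * Real.pi * f y}
              * ENNReal.ofReal (t ^ (p - 1)) := by gcongr
          _ = _ := by
              rw [mul_right_comm, mul_left_comm, mul_comm (ν _),
                ← ENNReal.ofReal_mul (p := 32 * Real.pi / t) (by positivity),
                ← ENNReal.ofReal_mul (p := 32 * Real.pi) (by positivity),
                Real.rpow_sub_one ht.ne' (p - 1)]
              congr 2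
              ring
    _ = ENNReal.ofReal (p / (p - 1)) * ENNReal.ofReal (32 * Real.pi)
        * ∫⁻ y, ENNReal.ofReal ((2 * Real.pi * f y) ^ (p - 1)) ∂ν := by
        rw [lintegral_rpow_eq_lintegral_meas_lt_mul ν (p := p - 1)
          (Eventually.of_forall fun x => by have := h0 x; simp only [Pi.zero_apply]; positivity)
          (hm.const_mul _).aemeasurable (by linarith), lintegral_const_mul' _ _ ENNReal.ofReal_ne_top,
          ENNReal.ofReal_div_of_pos (by linarith)]
        have hp1 : ENNReal.ofReal (p - 1) ≠ 0 := by simpa using hp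
        have : ENNReal.ofReal p / ENNReal.ofReal (p - 1) * ENNReal.ofReal (p - 1)
            = ENNReal.ofReal p := ENNReal.div_mul_cancel hp1 (by simp)
        conv_lhs => rw [← this]
        ring
    _ = _ := by
        rw [lintegral_withDensity_eq_lintegral_mul _ hFm (by fun_prop)]
        have : ∀ y, (F * fun y => ENNReal.ofReal ((2 * Real.pi * f y) ^ (p - 1))) y
            = ENNReal.ofReal ((2 * Real.pi) ^ (p - 1)) * ENNReal.ofReal (f y ^ p) := by
          intro y
          have h0y := h0 y
          simp only [Pi.mul_apply, F]
          rw [← ENNReal.ofReal_mul h0y, ← ENNReal.ofReal_mul (by positivity),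
            Real.mul_rpow (by positivity) h0y]
          congr 1
          rcases h0y.eq_or_lt with h | h
          · rw [← h, Real.zero_rpow (by linarith), Real.zero_rpow (by linarith)]
            ring
          · rw [Real.rpow_sub_one h.ne']
            field_simp
        simp_rw [this]
        rw [lintegral_const_mul' _ _ (by simp), ← mul_assoc,
          ← ENNReal.ofReal_mul (div_nonneg (by linarith) (by linarith)), ← ENNReal.ofReal_mul]
        · congr 2
          ring
        · exact mul_nonneg (div_nonneg (by linarith) (by linarith)) (by positivity)

/-! ### A Poincaré-type inequality on discs -/

theorem lintegral_comp_affine {H : ℂ → ℝ≥0∞} (hH : Measurable H) {k : ℝ} (hk : 0 < k) (c : ℂ) :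
    ∫⁻ w, H (k • w + c) = ENNReal.ofReal (k ^ 2)⁻¹ * ∫⁻ z, H z := by
  have h1 : ∫⁻ w, H (k • w + c) = ∫⁻ v, H (v + c) ∂(Measure.map (k • ·) (volume : Measure ℂ)) := by
    rw [lintegral_map (by fun_prop) (by fun_prop)]
  rw [h1, Measure.map_addHaar_smul _ hk.ne', lintegral_smul_measure, Complex.finrank_real_complex,
    abs_of_nonneg (by positivity), lintegral_add_right_eq_self, smul_eq_mul]

/-- Convexity keeps the moving point in the disc, and the substitution costs k⁻² because the real
dimension is two. -/
theorem setLIntegral_comp_segment_le {G : ℂ → ℝ≥0∞} (hG : Measurable G) {x y : ℂ} {r s k : ℝ}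
    (hy : y ∈ Metric.ball x r) (hs : 0 ≤ s) (hk : 0 < k) (hsk : k + s = 1) :
    ∫⁻ w in Metric.ball x r, G (k • w + s • y)
      ≤ ENNReal.ofReal (k ^ 2)⁻¹ * ∫⁻ z in Metric.ball x r, G z := by
  rw [← lintegral_indicator measurableSet_ball, ← lintegral_indicator measurableSet_ball,
    ← lintegral_comp_affine (hG.indicator measurableSet_ball) hk (s • y)]
  refine lintegral_mono fun w => ?_
  by_cases hw : w ∈ Metric.ball x r
  · have : k • w + s • y ∈ Metric.ball x r := convex_ball x r hw hy hk.le hs hsk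
    rw [Set.indicator_of_mem hw, Set.indicator_of_mem this]
  · simp [hw]

/-- With α = √g, β = √h and m³ = l, this is XYZ ≤ X³ + Y³ + Z³ for X = αβ/m², Y = mα, Z = mβ. The
free parameter `l` is used to balance the terms after integration. -/
theorem mul_le_of_rpow {g h l : ℝ} (hg : 0 ≤ g) (hh : 0 ≤ h) (hl : 0 < l) :
    g * h ≤ (l ^ 2)⁻¹ * (g ^ (3 / 2 : ℝ) * h ^ (3 / 2 : ℝ)) + l * g ^ (3 / 2 : ℝ)
      + l * h ^ (3 / 2 : ℝ) := by
  have e : ∀ {t : ℝ}, 0 ≤ t → t ^ (3 / 2 : ℝ) = √t ^ 3 := fun {t} ht => by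
    rw [Real.sqrt_eq_rpow, ← Real.rpow_natCast, ← Real.rpow_mul ht]
    norm_num
  have e1 : ∀ {t : ℝ}, 0 ≤ t → t = √t ^ 2 := fun ht => (Real.sq_sqrt ht).symm
  rw [e hg, e hh]
  conv_lhs => rw [e1 hg, e1 hh]
  set α := √g
  set β := √h
  have hα : 0 ≤ α := Real.sqrt_nonneg _
  have hβ : 0 ≤ β := Real.sqrt_nonneg _
  set m := l ^ (1 / 3 : ℝ)
  have hm : 0 < m := by positivity
  have hlm : l = m ^ 3 := by
    rw [← Real.rpow_natCast, ← Real.rpow_mul hl.le]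
    norm_num
  have key : ∀ X Y Z : ℝ, 0 ≤ X → 0 ≤ Y → 0 ≤ Z → X * Y * Z ≤ X ^ 3 + Y ^ 3 + Z ^ 3 := by
    intro X Y Z hX hY hZ
    nlinarith [mul_nonneg (add_nonneg (add_nonneg hX hY) hZ)
      (add_nonneg (add_nonneg (sq_nonneg (X - Y)) (sq_nonneg (Y - Z))) (sq_nonneg (Z - X))),
      mul_nonneg (mul_nonneg hX hY) hZ]
  have h := key (α * β / m ^ 2) (m * α) (m * β) (by positivity) (by positivity) (by positivity)
  have e2 : α * β / m ^ 2 * (m * α) * (m * β) = α ^ 2 * β ^ 2 := by field_simp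
  rw [e2] at h
  refine h.trans (le_of_eq ?_)
  rw [hlm]
  field_simp

/-- The integral over a disc of a product of values of a function at two points moving along a
segment is controlled by the mean of the `3/2`-th power. -/
theorem lintegral_mul_segment_le {g : ℂ → ℝ} (hgc : Continuous g) (hg : ∀ z, 0 ≤ g z) {x : ℂ}
    {r a s : ℝ} (hr : 0 < r) (ha : 0 < a) (hs : s ∈ Set.Ioo (0 : ℝ) 1)
    (hG : ∫⁻ z in Metric.ball x r, ENNReal.ofReal (g z ^ (3 / 2 : ℝ)) ≤ ENNReal.ofReal (a * r ^ 2)) :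
    ∫⁻ y in Metric.ball x r, ∫⁻ w in Metric.ball x r,
        ENNReal.ofReal (g y * g ((1 - s) • w + s • y))
      ≤ ENNReal.ofReal ((1 + 5 * Real.pi) * r ^ 4 * a ^ (4 / 3 : ℝ) * (1 - s) ^ (-(2 / 3) : ℝ)) := by
  obtain ⟨hs0, hs1⟩ := hs
  have hk : 0 < 1 - s := by linarith
  set B := Metric.ball x r
  set G : ℂ → ℝ≥0∞ := fun z => ENNReal.ofReal (g z ^ (3 / 2 : ℝ))
  have hGc : Continuous fun z => g z ^ (3 / 2 : ℝ) :=
    hgc.rpow_const fun _ => Or.inr (by norm_num)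
  have hGm : Measurable G := hGc.measurable.ennreal_ofReal
  have hvol : volume B = ENNReal.ofReal (Real.pi * r ^ 2) := by
    rw [Complex.volume_ball, ← ENNReal.ofReal_pow hr.le, ← ENNReal.ofReal_coe_nnreal,
      ← ENNReal.ofReal_mul (by positivity), NNReal.coe_real_pi, mul_comm]
  -- Chosen so that l³ = a(1−s)⁻². The first term then becomes l·a·r⁴, the others give πl·a·r⁴ and
  -- 4πl·a·r⁴, and the remaining singularity (1−s)^{−2/3} is integrable.
  set l : ℝ := a ^ (1 / 3 : ℝ) * (1 - s) ^ (-(2 / 3) : ℝ)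
  have hl : 0 < l := by positivity
  have hGz : Measurable fun q : ℂ × ℂ => G ((1 - s) • q.2 + s • q.1) :=
    hGm.comp (by fun_prop : Measurable fun q : ℂ × ℂ => (1 - s) • q.2 + s • q.1)
  have h1 : ∀ y ∈ B, ∫⁻ w in B, G ((1 - s) • w + s • y)
      ≤ ENNReal.ofReal (((1 - s) ^ 2)⁻¹ * (a * r ^ 2)) := by
    intro y hy
    rw [ENNReal.ofReal_mul (by positivity)]
    exact (setLIntegral_comp_segment_le hGm hy hs0.le hk (by ring)).trans (by gcongr)
  have h2 : ∀ w ∈ B, ∫⁻ y in B, G ((1 - s) • w + s • y)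
      ≤ ENNReal.ofReal ((s ^ 2)⁻¹ * (a * r ^ 2)) := by
    intro w hw
    rw [ENNReal.ofReal_mul (by positivity)]
    simp_rw [add_comm ((1 - s) • w)]
    exact (setLIntegral_comp_segment_le hGm hw hk.le hs0 (by ring)).trans (by gcongr)
  -- The factor `G y` forces integration in `w` first, which is the source of the singularity
  -- (1−s)⁻².
  have I1 : ∫⁻ y in B, G y * ∫⁻ w in B, G ((1 - s) • w + s • y)
      ≤ ENNReal.ofReal (((1 - s) ^ 2)⁻¹ * (a * r ^ 2) * (a * r ^ 2)) := by
    calc _ ≤ ∫⁻ y in B, G y * ENNReal.ofReal (((1 - s) ^ 2)⁻¹ * (a * r ^ 2)) :=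
          setLIntegral_mono' measurableSet_ball fun y hy => by gcongr; exact h1 y hy
      _ ≤ _ := by
          rw [lintegral_mul_const _ hGm, mul_comm,
            ENNReal.ofReal_mul (p := ((1 - s) ^ 2)⁻¹ * (a * r ^ 2)) (by positivity)]
          exact mul_le_mul_right hG _
  -- Here either variable may be integrated first. One of s and 1−s is at least 1/2, so the Jacobian
  -- factor is at most 4 uniformly in s.
  have I3 : ∫⁻ y in B, ∫⁻ w in B, G ((1 - s) • w + s • y)
      ≤ ENNReal.ofReal (4 * (a * r ^ 2) * (Real.pi * r ^ 2)) := by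
    have hconst : ∀ q : ℝ, 1 / 2 ≤ q → (q ^ 2)⁻¹ * (a * r ^ 2) ≤ 4 * (a * r ^ 2) := by
      intro q hq
      have : (q ^ 2)⁻¹ ≤ 4 := by
        rw [inv_le_comm₀ (by positivity) (by norm_num)]
        nlinarith
      gcongr
    rw [ENNReal.ofReal_mul (by positivity), ← hvol]
    rcases le_total s (1 / 2) with h | h
    · calc _ ≤ ∫⁻ y in B, ENNReal.ofReal (4 * (a * r ^ 2)) :=
            setLIntegral_mono' measurableSet_ball fun y hy =>
              (h1 y hy).trans (ENNReal.ofReal_le_ofReal (hconst _ (by linarith)))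
        _ = _ := setLIntegral_const _ _
    · rw [lintegral_lintegral_swap hGz.aemeasurable]
      calc _ ≤ ∫⁻ y in B, ENNReal.ofReal (4 * (a * r ^ 2)) :=
            setLIntegral_mono' measurableSet_ball fun y hy =>
              (h2 y hy).trans (ENNReal.ofReal_le_ofReal (hconst _ (by linarith)))
        _ = _ := setLIntegral_const _ _
  have hpt : ∀ y w, ENNReal.ofReal (g y * g ((1 - s) • w + s • y))
      ≤ ENNReal.ofReal (l ^ 2)⁻¹ * (G y * G ((1 - s) • w + s • y)) + ENNReal.ofReal l * G y
        + ENNReal.ofReal l * G ((1 - s) • w + s • y) := by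
    intro y w
    have p1 := hg y
    have p2 := hg ((1 - s) • w + s • y)
    refine (ENNReal.ofReal_le_ofReal (mul_le_of_rpow p1 p2 hl)).trans (le_of_eq ?_)
    rw [ENNReal.ofReal_add (by positivity) (by positivity),
      ENNReal.ofReal_add (by positivity) (by positivity), ENNReal.ofReal_mul (by positivity),
      ENNReal.ofReal_mul (by positivity), ENNReal.ofReal_mul hl.le, ENNReal.ofReal_mul hl.le]
  have hGy : ∀ y, Measurable fun w => G ((1 - s) • w + s • y) := fun y =>
    hGm.comp (by fun_prop)
  have hGI : Measurable fun y => ∫⁻ w in B, G ((1 - s) • w + s • y) := hGz.lintegral_prod_right'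
  calc ∫⁻ y in B, ∫⁻ w in B, ENNReal.ofReal (g y * g ((1 - s) • w + s • y))
      ≤ ∫⁻ y in B, ∫⁻ w in B, (ENNReal.ofReal (l ^ 2)⁻¹ * (G y * G ((1 - s) • w + s • y))
        + ENNReal.ofReal l * G y + ENNReal.ofReal l * G ((1 - s) • w + s • y)) :=
        lintegral_mono fun y => lintegral_mono fun w => hpt y w
    _ = ∫⁻ y in B, (ENNReal.ofReal (l ^ 2)⁻¹ * (G y * ∫⁻ w in B, G ((1 - s) • w + s • y))
        + ENNReal.ofReal l * volume B * G y
        + ENNReal.ofReal l * ∫⁻ w in B, G ((1 - s) • w + s • y)) := by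
        refine lintegral_congr fun y => ?_
        rw [lintegral_add_right _ ((hGy y).const_mul _), lintegral_add_right _ measurable_const,
          lintegral_const_mul _ ((hGy y).const_mul _), lintegral_const_mul _ (hGy y),
          lintegral_const_mul _ (hGy y), setLIntegral_const]
        ring
    _ = ENNReal.ofReal (l ^ 2)⁻¹ * (∫⁻ y in B, G y * ∫⁻ w in B, G ((1 - s) • w + s • y))
        + ENNReal.ofReal l * volume B * (∫⁻ y in B, G y)
        + ENNReal.ofReal l * ∫⁻ y in B, ∫⁻ w in B, G ((1 - s) • w + s • y) := by
        rw [lintegral_add_right _ (hGI.const_mul _), lintegral_add_right _ (hGm.const_mul _),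
          lintegral_const_mul' _ _ ENNReal.ofReal_ne_top, lintegral_const_mul _ hGm,
          lintegral_const_mul _ hGI]
    _ ≤ ENNReal.ofReal (l ^ 2)⁻¹ * ENNReal.ofReal (((1 - s) ^ 2)⁻¹ * (a * r ^ 2) * (a * r ^ 2))
        + ENNReal.ofReal l * ENNReal.ofReal (Real.pi * r ^ 2) * ENNReal.ofReal (a * r ^ 2)
        + ENNReal.ofReal l * ENNReal.ofReal (4 * (a * r ^ 2) * (Real.pi * r ^ 2)) := by
        rw [hvol]
        gcongr
    _ = ENNReal.ofReal ((l ^ 2)⁻¹ * (((1 - s) ^ 2)⁻¹ * (a * r ^ 2) * (a * r ^ 2))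
        + l * (Real.pi * r ^ 2) * (a * r ^ 2) + l * (4 * (a * r ^ 2) * (Real.pi * r ^ 2))) := by
        rw [ENNReal.ofReal_add (by positivity) (by positivity),
          ENNReal.ofReal_add (by positivity) (by positivity),
          ENNReal.ofReal_mul (p := (l ^ 2)⁻¹) (by positivity),
          ENNReal.ofReal_mul (p := l * (Real.pi * r ^ 2)) (by positivity),
          ENNReal.ofReal_mul (p := l) (by positivity), ENNReal.ofReal_mul (p := l) (by positivity)]
    _ = _ := by
        congr 1
        have ea : a ^ (4 / 3 : ℝ) = a ^ (1 / 3 : ℝ) * a := by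
          rw [← Real.rpow_add_one ha.ne']
          norm_num
        have el : (l ^ 2)⁻¹ * (((1 - s) ^ 2)⁻¹ * (a * r ^ 2) * (a * r ^ 2)) = l * a * r ^ 4 := by
          have e3 : l ^ 3 = a * ((1 - s) ^ 2)⁻¹ := by
            simp only [l, mul_pow]
            rw [← Real.rpow_natCast, ← Real.rpow_natCast, ← Real.rpow_mul ha.le,
              ← Real.rpow_mul hk.le, ← Real.rpow_natCast (1 - s) 2, ← Real.rpow_neg hk.le]
            norm_num
          have e4 : (l ^ 2)⁻¹ * (l ^ 3) = l := by field_simp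
          calc _ = (l ^ 2)⁻¹ * (a * ((1 - s) ^ 2)⁻¹) * a * r ^ 4 := by ring
            _ = _ := by rw [← e3, e4]
        rw [el, ea]
        simp only [l]
        ring

theorem lintegral_one_sub_rpow :
    ∫⁻ s in Set.Ioo (0 : ℝ) 1, ENNReal.ofReal ((1 - s) ^ (-(2 / 3) : ℝ)) = 3 := by
  have hi : IntervalIntegrable (fun s : ℝ => s ^ (-(2 / 3) : ℝ)) volume 0 1 :=
    intervalIntegral.intervalIntegrable_rpow' (by norm_num)
  have hi' : IntervalIntegrable (fun s : ℝ => (1 - s) ^ (-(2 / 3) : ℝ)) volume 0 1 := by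
    simpa using (hi.comp_sub_left 1).symm
  rw [← ofReal_integral_eq_lintegral_ofReal]
  · rw [← integral_Ioc_eq_integral_Ioo, ← intervalIntegral.integral_of_le zero_le_one,
      intervalIntegral.integral_comp_sub_left (fun s : ℝ => s ^ (-(2 / 3) : ℝ)) 1, sub_self,
      sub_zero, integral_rpow (Or.inl (by norm_num))]
    norm_num
  · exact ((intervalIntegrable_iff_integrableOn_Ioo_of_le zero_le_one).1 hi')
  · filter_upwards [self_mem_ae_restrict measurableSet_Ioo] with s hs
    have : 0 ≤ 1 - s := by linarith [hs.2]
    simp only [Pi.zero_apply]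
    positivity

theorem enorm_sub_le_lintegral_fderiv {u : ℂ → ℂ} (hu : ContDiff ℝ 1 u) (y w : ℂ) :
    ‖u y - u w‖ₑ ≤ ‖y - w‖ₑ * ∫⁻ s in Set.Ioo (0 : ℝ) 1, ‖fderiv ℝ u ((1 - s) • w + s • y)‖ₑ := by
  have hd : ∀ s : ℝ, HasDerivAt (fun s : ℝ => u ((1 - s) • w + s • y))
      (fderiv ℝ u ((1 - s) • w + s • y) (y - w)) s := by
    intro s
    have h1 : HasDerivAt (fun s : ℝ => (1 - s) • w + s • y) (y - w) s := by
      have e : (fun s : ℝ => (1 - s) • w + s • y) = fun s : ℝ => w + s • (y - w) := by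
        ext s
        module
      rw [e]
      simpa using ((hasDerivAt_id s).smul_const (y - w)).const_add w
    exact ((hu.differentiable (by norm_num)) _).hasFDerivAt.comp_hasDerivAt s h1
  have hc : Continuous fun s : ℝ => fderiv ℝ u ((1 - s) • w + s • y) (y - w) :=
    ((hu.continuous_fderiv (by norm_num)).comp (by fun_prop)).clm_apply continuous_const
  have h := intervalIntegral.integral_eq_sub_of_hasDerivAt (fun s _ => hd s)
    (hc.intervalIntegrable 0 1)
  have e : u y - u w = ∫ s in Set.Ioo (0 : ℝ) 1, fderiv ℝ u ((1 - s) • w + s • y) (y - w) := by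
    rw [← integral_Ioc_eq_integral_Ioo, ← intervalIntegral.integral_of_le zero_le_one, h]
    simp
  rw [e, ← lintegral_const_mul' _ _ (by simp)]
  refine (enorm_integral_le_lintegral_enorm _).trans (lintegral_mono fun s => ?_)
  rw [mul_comm]
  exact ContinuousLinearMap.le_opENorm _ _

theorem lintegral_rotate {α β γ : Type*} [MeasurableSpace α] [MeasurableSpace β]
    [MeasurableSpace γ] (μ : Measure α) (ν : Measure β) (κ : Measure γ) [SFinite μ] [SFinite ν]
    [SFinite κ] {f : (α × β) × γ → ℝ≥0∞} (hf : Measurable f) :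
    ∫⁻ y, ∫⁻ w, ∫⁻ s, f ((y, w), s) ∂κ ∂ν ∂μ = ∫⁻ s, ∫⁻ y, ∫⁻ w, f ((y, w), s) ∂ν ∂μ ∂κ := by
  have h1 : ∀ y, ∫⁻ w, ∫⁻ s, f ((y, w), s) ∂κ ∂ν = ∫⁻ s, ∫⁻ w, f ((y, w), s) ∂ν ∂κ := fun y =>
    lintegral_lintegral_swap (f := fun w s => f ((y, w), s))
      (hf.comp (by fun_prop : Measurable fun q : β × γ => ((y, q.1), q.2))).aemeasurable
  simp_rw [h1]
  have h2 : Measurable fun q : (α × γ) × β => f ((q.1.1, q.2), q.1.2) := hf.comp (by fun_prop)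
  exact lintegral_lintegral_swap (f := fun y s => ∫⁻ w, f ((y, w), s) ∂ν)
    (h2.lintegral_prod_right' (ν := ν)).aemeasurable

/-- A Poincaré-type inequality: some value of `u` on a disc is close to `u` in the mean, with weight
the gradient of `u`. -/
theorem exists_lintegral_sub_mul_fderiv_le {u : ℂ → ℂ} (hu : ContDiff ℝ 1 u) {x : ℂ} {r a : ℝ}
    (hr : 0 < r) (ha : 0 < a)
    (hG : ∫⁻ z in Metric.ball x r, ENNReal.ofReal (‖fderiv ℝ u z‖ ^ (3 / 2 : ℝ))
      ≤ ENNReal.ofReal (a * r ^ 2)) :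
    ∃ c, ∫⁻ y in Metric.ball x r, ‖u y - c‖ₑ * ‖fderiv ℝ u y‖ₑ
      ≤ ENNReal.ofReal (32 * r ^ 3 * a ^ (4 / 3 : ℝ)) := by
  set B := Metric.ball x r
  have hgc : Continuous fun z => ‖fderiv ℝ u z‖ := (hu.continuous_fderiv (by norm_num)).norm
  have hvol : volume B = ENNReal.ofReal (Real.pi * r ^ 2) := by
    rw [Complex.volume_ball, ← ENNReal.ofReal_pow hr.le, ← ENNReal.ofReal_coe_nnreal,
      ← ENNReal.ofReal_mul (by positivity), NNReal.coe_real_pi, mul_comm]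
  have hmeas : Measurable fun q : ℂ × ℂ => ‖u q.1 - u q.2‖ₑ * ‖fderiv ℝ u q.1‖ₑ := by
    have h1 : Continuous fun q : ℂ × ℂ => u q.1 - u q.2 :=
      (hu.continuous.comp continuous_fst).sub (hu.continuous.comp continuous_snd)
    have h2 : Continuous fun q : ℂ × ℂ => fderiv ℝ u q.1 :=
      (hu.continuous_fderiv (by norm_num)).comp continuous_fst
    exact h1.enorm.measurable.mul h2.enorm.measurable
  have hmeas3 : Measurable fun q : (ℂ × ℂ) × ℝ =>
      ENNReal.ofReal (‖fderiv ℝ u q.1.1‖ * ‖fderiv ℝ u ((1 - q.2) • q.1.2 + q.2 • q.1.1)‖) := by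
    have h1 : Continuous fun q : (ℂ × ℂ) × ℝ => ‖fderiv ℝ u q.1.1‖ :=
      hgc.comp (by fun_prop)
    have h2 : Continuous fun q : (ℂ × ℂ) × ℝ => ‖fderiv ℝ u ((1 - q.2) • q.1.2 + q.2 • q.1.1)‖ :=
      hgc.comp (by fun_prop)
    exact (h1.mul h2).measurable.ennreal_ofReal
  have hdouble : ∫⁻ y in B, ∫⁻ w in B, ‖u y - u w‖ₑ * ‖fderiv ℝ u y‖ₑ
      ≤ ENNReal.ofReal (32 * r ^ 3 * a ^ (4 / 3 : ℝ)) * volume B := by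
    calc _ ≤ ∫⁻ y in B, ∫⁻ w in B, ENNReal.ofReal (2 * r) * ∫⁻ s in Set.Ioo (0 : ℝ) 1,
          ENNReal.ofReal (‖fderiv ℝ u y‖ * ‖fderiv ℝ u ((1 - s) • w + s • y)‖) := by
          refine setLIntegral_mono' measurableSet_ball fun y hy =>
            setLIntegral_mono' measurableSet_ball fun w hw => ?_
          have hyw : ‖y - w‖ₑ ≤ ENNReal.ofReal (2 * r) := by
            rw [← ofReal_norm]
            refine ENNReal.ofReal_le_ofReal ?_
            rw [← dist_eq_norm]
            have := dist_triangle_right y w x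
            rw [Metric.mem_ball] at hy hw
            linarith
          calc _ ≤ ‖y - w‖ₑ * (∫⁻ s in Set.Ioo (0 : ℝ) 1, ‖fderiv ℝ u ((1 - s) • w + s • y)‖ₑ)
                * ‖fderiv ℝ u y‖ₑ := by gcongr; exact enorm_sub_le_lintegral_fderiv hu y w
            _ ≤ ENNReal.ofReal (2 * r) * (∫⁻ s in Set.Ioo (0 : ℝ) 1,
                ‖fderiv ℝ u ((1 - s) • w + s • y)‖ₑ) * ‖fderiv ℝ u y‖ₑ := by gcongr
            _ = _ := by
                rw [mul_assoc, mul_comm (lintegral _ _), ← lintegral_const_mul' _ _ (by simp)]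
                simp_rw [ENNReal.ofReal_mul (norm_nonneg _), ofReal_norm]
      _ = ENNReal.ofReal (2 * r) * ∫⁻ s in Set.Ioo (0 : ℝ) 1, ∫⁻ y in B, ∫⁻ w in B,
          ENNReal.ofReal (‖fderiv ℝ u y‖ * ‖fderiv ℝ u ((1 - s) • w + s • y)‖) := by
          simp_rw [lintegral_const_mul' (ENNReal.ofReal (2 * r)) _ ENNReal.ofReal_ne_top]
          exact congrArg _ (lintegral_rotate _ _ _ hmeas3)
      _ ≤ ENNReal.ofReal (2 * r) * ∫⁻ s in Set.Ioo (0 : ℝ) 1, ENNReal.ofReal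
          ((1 + 5 * Real.pi) * r ^ 4 * a ^ (4 / 3 : ℝ)) * ENNReal.ofReal
            ((1 - s) ^ (-(2 / 3) : ℝ)) := by
          refine mul_le_mul_right ?_ _
          refine setLIntegral_mono' measurableSet_Ioo fun s hs => ?_
          rw [← ENNReal.ofReal_mul (by positivity)]
          exact lintegral_mul_segment_le hgc (fun _ => norm_nonneg _) hr ha hs hG
      _ ≤ _ := by
          rw [lintegral_const_mul' _ _ ENNReal.ofReal_ne_top, lintegral_one_sub_rpow, hvol,
            show (3 : ℝ≥0∞) = ENNReal.ofReal 3 by simp, ← ENNReal.ofReal_mul (by positivity),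
            ← ENNReal.ofReal_mul (by positivity), ← ENNReal.ofReal_mul (by positivity)]
          apply ENNReal.ofReal_le_ofReal
          -- The accumulated factor is 2·3·(1+5π), from the diameter, the s-integral and the segment
          -- estimate; it is at most 32π because π > 3.
          have hp : 0 ≤ (32 * Real.pi - 6 * (1 + 5 * Real.pi)) * (r ^ 5 * a ^ (4 / 3 : ℝ)) :=
            mul_nonneg (by linarith [Real.pi_gt_three]) (by positivity)
          nlinarith [hp]
  rw [lintegral_lintegral_swap hmeas.aemeasurable] at hdouble
  have hv0 : volume B ≠ 0 := by rw [hvol]; simp; positivity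
  have hvt : volume B ≠ ∞ := by rw [hvol]; simp
  -- Some `w` does no worse than the average over the disc, and u(w) serves as the constant.
  obtain ⟨w, -, hw⟩ := exists_le_setLAverage (μ := volume) (s := B)
    (f := fun w => ∫⁻ y in B, ‖u y - u w‖ₑ * ‖fderiv ℝ u y‖ₑ) hv0 hvt
    (hmeas.lintegral_prod_left' (μ := volume.restrict B)).aemeasurable
  refine ⟨u w, hw.trans ?_⟩
  rw [setLAverage_eq]
  exact ENNReal.div_le_of_le_mul hdouble

/-! ### The div-curl structure of the Jacobian -/

theorem lineDeriv_comm (u : 𝓢(ℂ, ℂ)) (m n : ℂ) : ∂_{m} (∂_{n} u) = ∂_{n} (∂_{m} u) := by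
  ext x
  have h (m n : ℂ) : ∂_{m} (∂_{n} u) x = fderiv ℝ (fderiv ℝ u) x m n := by
    rw [SchwartzMap.lineDerivOp_apply_eq_fderiv]
    have e : ((∂_{n} u : 𝓢(ℂ, ℂ)) : ℂ → ℂ) = fun y => fderiv ℝ u y n := by
      ext y
      exact SchwartzMap.lineDerivOp_apply_eq_fderiv n u y
    have hd : DifferentiableAt ℝ (fderiv ℝ u) x :=
      ((u.smooth 2).fderiv_right (m := 1) (by norm_num)).differentiable (by norm_num) x
    rw [e, fderiv_clm_apply hd (by fun_prop)]
    simp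
  rw [h, h]
  exact ((u.smooth 2).contDiffAt.isSymmSndFDerivAt (by simp)) m n

theorem exists_norm_schwartz_le (u : 𝓢(ℂ, ℂ)) : ∃ M, ∀ x, ‖u x‖ ≤ M :=
  ⟨_, fun x => u.norm_le_seminorm ℝ x⟩

theorem exists_norm_fderiv_le (u : 𝓢(ℂ, ℂ)) : ∃ M, ∀ x, ‖fderiv ℝ u x‖ ≤ M :=
  ⟨_, fun x => (SchwartzMap.fderivCLM ℝ ℂ ℂ u).norm_le_seminorm ℝ x⟩

/-- Integration by parts against a Schwartz function. -/
theorem integral_mul_lineDeriv {f : ℂ → ℂ} (hf : Differentiable ℝ f) {M M' : ℝ}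
    (hM : ∀ x, ‖f x‖ ≤ M) (hM' : ∀ x, ‖fderiv ℝ f x‖ ≤ M') (g : 𝓢(ℂ, ℂ)) (v : ℂ) :
    ∫ x, f x * ∂_{v} g x = - ∫ x, fderiv ℝ f x v * g x := by
  simp_rw [SchwartzMap.lineDerivOp_apply_eq_fderiv]
  refine integral_mul_fderiv_eq_neg_fderiv_mul_of_integrable ?_ ?_ ?_ (fun x _ => hf x)
    (fun x _ => g.differentiableAt)
  · refine g.integrable.bdd_mul (c := M' * ‖v‖)
      (measurable_fderiv_apply_const ℝ f v).aestronglyMeasurable (Eventually.of_forall fun x => ?_)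
    exact (ContinuousLinearMap.le_opNorm _ _).trans (by gcongr; exact hM' x)
  · simp_rw [← SchwartzMap.lineDerivOp_apply_eq_fderiv]
    exact (∂_{v} g).integrable.bdd_mul hf.continuous.aestronglyMeasurable
      (Eventually.of_forall hM)
  · exact g.integrable.bdd_mul hf.continuous.aestronglyMeasurable (Eventually.of_forall hM)

/-- The integral of a null Lagrangian vanishes. -/
theorem integral_fderiv_mul_lineDeriv_comm {f : ℂ → ℂ} (hf : Differentiable ℝ f) {M M' : ℝ}
    (hM : ∀ x, ‖f x‖ ≤ M) (hM' : ∀ x, ‖fderiv ℝ f x‖ ≤ M') (g : 𝓢(ℂ, ℂ)) (v w : ℂ) :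
    ∫ x, fderiv ℝ f x v * ∂_{w} g x = ∫ x, fderiv ℝ f x w * ∂_{v} g x := by
  have h1 := integral_mul_lineDeriv hf hM hM' (∂_{w} g) v
  have h2 := integral_mul_lineDeriv hf hM hM' (∂_{v} g) w
  rw [lineDeriv_comm] at h1
  rw [h1] at h2
  exact neg_injective h2

/-- The right-hand side is the Jacobian determinant of u, whose null-Lagrangian structure permits
integration by parts. -/
theorem norm_dz_sq_sub_norm_dbar_sq (u : 𝓢(ℂ, ℂ)) (x : ℂ) : ‖dz u x‖ ^ 2 - ‖dbar u x‖ ^ 2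
    = (conj (∂_{(1 : ℂ)} u x) * ∂_{Complex.I} u x).im := by
  simp only [← Complex.normSq_eq_norm_sq, Complex.normSq_apply]
  simp [dz, dbar]
  ring

theorem norm_dz_sq_add_norm_dbar_sq (u : 𝓢(ℂ, ℂ)) (x : ℂ) : 2 * (‖dz u x‖ ^ 2 + ‖dbar u x‖ ^ 2)
    = ‖∂_{(1 : ℂ)} u x‖ ^ 2 + ‖∂_{Complex.I} u x‖ ^ 2 := by
  simp only [← Complex.normSq_eq_norm_sq, Complex.normSq_apply]
  simp [dz, dbar]
  ring

theorem jacobian_dbar_ae (u : 𝓢(ℂ, ℂ)) : jacobian ((dbar u).toLp 2) =ᵐ[volume]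
    fun x => (conj (∂_{(1 : ℂ)} u x) * ∂_{Complex.I} u x).im := by
  filter_upwards [jacobian_ae ((dbar u).toLp 2), (dbar u).coeFn_toLp 2 volume,
    (dz u).coeFn_toLp 2 volume] with x h1 h2 h3
  rw [h1, beurling_dbar, h2, h3, norm_dz_sq_sub_norm_dbar_sq]

/-- Integration by parts for the Jacobian against a bounded function with bounded gradient. -/
theorem two_I_mul_integral_mul_jacobian (u : 𝓢(ℂ, ℂ)) {φ : ℂ → ℝ} (hφ : Differentiable ℝ φ)
    {M M' : ℝ} (hM : ∀ x, |φ x| ≤ M) (hM' : ∀ x, ‖fderiv ℝ φ x‖ ≤ M') (c : ℂ) :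
    2 * Complex.I * ((∫ x, jacobian ((dbar u).toLp 2) x * φ x : ℝ) : ℂ)
      = ∫ x, conj (u x - c) * (fderiv ℝ φ x Complex.I * ∂_{(1 : ℂ)} u x
          - fderiv ℝ φ x 1 * ∂_{Complex.I} u x) := by
  obtain ⟨A, hA⟩ := exists_norm_schwartz_le u
  obtain ⟨A', hA'⟩ := exists_norm_fderiv_le u
  -- The null-Lagrangian identity is applied to φ·conj(u − c) and u. Derivatives falling on conj u
  -- give 2iφ times the Jacobian, those falling on φ give the right-hand side, and `c` is free since
  -- only derivatives of u appear in the Jacobian.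
  set f : ℂ → ℂ := fun x => (φ x : ℂ) * conj (u x - c)
  have hfd : ∀ x, HasFDerivAt f ((φ x : ℂ) • (Complex.conjCLE.toContinuousLinearMap.comp
      (fderiv ℝ u x)) + (Complex.ofRealCLM.comp (fderiv ℝ φ x)).smulRight (conj (u x - c))) x := by
    intro x
    have h1 : HasFDerivAt (fun x => (φ x : ℂ)) (Complex.ofRealCLM.comp (fderiv ℝ φ x)) x :=
      Complex.ofRealCLM.hasFDerivAt.comp x (hφ x).hasFDerivAt
    have h2 : HasFDerivAt (fun x => conj (u x - c))
        (Complex.conjCLE.toContinuousLinearMap.comp (fderiv ℝ u x)) x :=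
      Complex.conjCLE.toContinuousLinearMap.hasFDerivAt.comp x ((u.hasFDerivAt x).sub_const c)
    exact h1.mul' h2
  have hfv : ∀ x v, fderiv ℝ f x v
      = φ x * conj (∂_{v} u x) + fderiv ℝ φ x v * conj (u x - c) := by
    intro x v
    rw [(hfd x).fderiv, SchwartzMap.lineDerivOp_apply_eq_fderiv]
    simp
  have hM0 : 0 ≤ M := (abs_nonneg _).trans (hM 0)
  have hM0' : 0 ≤ M' := (norm_nonneg _).trans (hM' 0)
  have hA0 : 0 ≤ A := (norm_nonneg _).trans (hA 0)
  have hb1 : ∀ x, ‖conj (u x - c)‖ ≤ A + ‖c‖ := fun x => by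
    rw [RCLike.norm_conj]
    exact (norm_sub_le _ _).trans (by gcongr; exact hA x)
  have hb : ∀ x, ‖f x‖ ≤ M * (A + ‖c‖) := fun x => by
    rw [norm_mul, Complex.norm_real]
    exact mul_le_mul (hM x) (hb1 x) (norm_nonneg _) hM0
  have hb' : ∀ x, ‖fderiv ℝ f x‖ ≤ M * A' + M' * (A + ‖c‖) := by
    intro x
    refine ContinuousLinearMap.opNorm_le_bound _ ?_ fun v => ?_
    · have : 0 ≤ A' := (norm_nonneg _).trans (hA' 0)
      positivity
    rw [hfv, SchwartzMap.lineDerivOp_apply_eq_fderiv, add_mul]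
    refine (norm_add_le _ _).trans (add_le_add ?_ ?_)
    · rw [norm_mul, Complex.norm_real, RCLike.norm_conj, mul_assoc]
      exact mul_le_mul (hM x) ((ContinuousLinearMap.le_opNorm _ _).trans
        (by gcongr; exact hA' x)) (norm_nonneg _) hM0
    · rw [norm_mul, Complex.norm_real, mul_right_comm]
      exact mul_le_mul ((ContinuousLinearMap.le_opNorm _ _).trans
        (by gcongr; exact hM' x)) (hb1 x) (norm_nonneg _) (by positivity)
  have hcomm := integral_fderiv_mul_lineDeriv_comm (fun x => (hfd x).differentiableAt) hb hb' u 1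
    Complex.I
  have hint : ∀ v w : ℂ, Integrable (fun x => fderiv ℝ f x v * ∂_{w} u x) volume := by
    intro v w
    refine (∂_{w} u).integrable.bdd_mul (c := (M * A' + M' * (A + ‖c‖)) * ‖v‖)
      (measurable_fderiv_apply_const ℝ f v).aestronglyMeasurable (Eventually.of_forall fun x => ?_)
    exact (ContinuousLinearMap.le_opNorm _ _).trans (by gcongr; exact hb' x)
  have hintφ : ∀ v w : ℂ,
      Integrable (fun x => conj (u x - c) * (fderiv ℝ φ x v * ∂_{w} u x)) volume := by
    intro v w
    have h1 : Integrable (fun x => (fderiv ℝ φ x v : ℂ) * ∂_{w} u x) volume := by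
      refine (∂_{w} u).integrable.bdd_mul (c := M' * ‖v‖) (Complex.measurable_ofReal.comp
        (measurable_fderiv_apply_const ℝ φ v)).aestronglyMeasurable
        (Eventually.of_forall fun x => ?_)
      rw [Complex.norm_real]
      exact (ContinuousLinearMap.le_opNorm _ _).trans (by gcongr; exact hM' x)
    refine h1.bdd_mul (c := A + ‖c‖) ?_ (Eventually.of_forall hb1)
    exact (Complex.continuous_conj.comp (u.continuous.sub continuous_const)).aestronglyMeasurable
  have hJ : 2 * Complex.I * ((∫ x, jacobian ((dbar u).toLp 2) x * φ x : ℝ) : ℂ)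
      = ∫ x, φ x * (conj (∂_{(1 : ℂ)} u x) * ∂_{Complex.I} u x
        - conj (∂_{Complex.I} u x) * ∂_{(1 : ℂ)} u x) := by
    rw [← integral_complex_ofReal, ← integral_const_mul]
    refine integral_congr_ae ?_
    filter_upwards [jacobian_dbar_ae u] with x hx
    rw [hx]
    apply Complex.ext
    · simp
      exact Or.inr (by ring)
    · simp
      ring
  rw [hJ, ← sub_eq_zero, ← integral_sub]
  · rw [← sub_eq_zero, ← integral_sub (hint _ _) (hint _ _)] at hcomm
    rw [← hcomm]
    refine integral_congr_ae (Eventually.of_forall fun x => ?_)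
    simp only [hfv]
    ring
  · refine (((hint 1 Complex.I).sub (hint Complex.I 1)).add ((hintφ Complex.I 1).sub
      (hintφ 1 Complex.I))).congr (Eventually.of_forall fun x => ?_)
    simp only [hfv, Pi.add_apply, Pi.sub_apply]
    ring
  · refine ((hintφ Complex.I 1).sub (hintφ 1 Complex.I)).congr (Eventually.of_forall fun x => ?_)
    simp only [Pi.sub_apply]
    ring

/-! ### The Hardy space estimate for Jacobians of Schwartz functions -/

/-- The operator norm is at most the Hilbert–Schmidt norm, by Cauchy–Schwarz in the two coordinates.
-/
theorem norm_fderiv_sq_le (u : 𝓢(ℂ, ℂ)) (x : ℂ) :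
    ‖fderiv ℝ u x‖ ^ 2 ≤ 2 * (‖dz u x‖ ^ 2 + ‖dbar u x‖ ^ 2) := by
  rw [norm_dz_sq_add_norm_dbar_sq]
  set a := ‖∂_{(1 : ℂ)} u x‖
  set b := ‖∂_{Complex.I} u x‖
  have h : ‖fderiv ℝ u x‖ ≤ √(a ^ 2 + b ^ 2) := by
    refine ContinuousLinearMap.opNorm_le_bound _ (Real.sqrt_nonneg _) fun v => ?_
    have e : fderiv ℝ u x v = v.re • ∂_{(1 : ℂ)} u x + v.im • ∂_{Complex.I} u x := by
      rw [SchwartzMap.lineDerivOp_apply_eq_fderiv, SchwartzMap.lineDerivOp_apply_eq_fderiv,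
        ← map_smul, ← map_smul, ← map_add]
      congr 1
      apply Complex.ext <;> simp
    have h1 : ‖fderiv ℝ u x v‖ ≤ |v.re| * a + |v.im| * b := by
      rw [e]
      refine (norm_add_le _ _).trans (le_of_eq ?_)
      rw [norm_smul, norm_smul, Real.norm_eq_abs, Real.norm_eq_abs]
    refine h1.trans ?_
    rw [← Real.sqrt_sq (norm_nonneg v), ← Real.sqrt_mul (by positivity)]
    apply Real.le_sqrt_of_sq_le
    rw [← Complex.normSq_eq_norm_sq v, Complex.normSq_apply, ← abs_mul_abs_self v.re,
      ← abs_mul_abs_self v.im]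
    nlinarith [sq_nonneg (|v.re| * b - |v.im| * a)]
  calc ‖fderiv ℝ u x‖ ^ 2 ≤ √(a ^ 2 + b ^ 2) ^ 2 := by gcongr
    _ = _ := Real.sq_sqrt (by positivity)

theorem lintegral_norm_fderiv_sq_le (u : 𝓢(ℂ, ℂ)) :
    ∫⁻ x, ENNReal.ofReal (‖fderiv ℝ u x‖ ^ 2) ≤ 4 * ‖((dbar u).toLp 2 : L2)‖ₑ ^ 2 := by
  set ω : L2 := (dbar u).toLp 2
  calc ∫⁻ x, ENNReal.ofReal (‖fderiv ℝ u x‖ ^ 2)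
      ≤ ∫⁻ x, ENNReal.ofReal (2 * (‖beurling ω x‖ ^ 2 + ‖ω x‖ ^ 2)) := by
        refine lintegral_mono_ae ?_
        filter_upwards [(dbar u).coeFn_toLp 2 volume, (dz u).coeFn_toLp 2 volume] with x h1 h2
        apply ENNReal.ofReal_le_ofReal
        rw [beurling_dbar, h1, h2]
        exact norm_fderiv_sq_le u x
    _ = ENNReal.ofReal (4 * ‖ω‖ ^ 2) := by
        have hi : Integrable (fun x => 2 * (‖beurling ω x‖ ^ 2 + ‖ω x‖ ^ 2)) volume :=
          ((integrable_norm_sq (beurling ω)).add (integrable_norm_sq ω)).const_mul 2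
        rw [← ofReal_integral_eq_lintegral_ofReal hi
          (Eventually.of_forall fun x => by positivity), integral_const_mul,
          integral_add (integrable_norm_sq _) (integrable_norm_sq _), integral_norm_sq,
          integral_norm_sq, norm_beurling]
        congr 1
        ring
    _ = _ := by
        rw [ENNReal.ofReal_mul (by norm_num), ENNReal.ofReal_pow (norm_nonneg _), ofReal_norm]
        simp

theorem IsTest.exists_support_bound {χ : ℂ → ℝ} (hχ : IsTest χ) :
    ∃ R L : ℝ, 0 < R ∧ 0 < L ∧ (∀ x, |χ x| ≤ L) ∧ (∀ x, ‖fderiv ℝ χ x‖ ≤ L) ∧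
      ∀ x, R ≤ ‖x‖ → fderiv ℝ χ x = 0 := by
  obtain ⟨h1, h2⟩ := hχ
  obtain ⟨A, hA⟩ := h2.exists_bound_of_continuous h1.continuous
  obtain ⟨A', hA'⟩ := (h2.fderiv ℝ).exists_bound_of_continuous (h1.continuous_fderiv (by simp))
  obtain ⟨R, hR, hs⟩ := (h2.fderiv ℝ).isCompact.isBounded.subset_ball_lt 0 0
  refine ⟨R, max (max A A') 1, hR, by positivity, fun x => (hA x).trans (by simp),
    fun x => (hA' x).trans (by simp), fun x hx => ?_⟩
  by_contra hne
  have := hs (subset_tsupport _ (Function.mem_support.2 hne))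
  rw [mem_ball_zero_iff] at this
  linarith

theorem enorm_two_I_mul_ofReal (r : ℝ) : ‖2 * Complex.I * (r : ℂ)‖ₑ = 2 * ‖r‖ₑ := by
  rw [← ofReal_norm, ← ofReal_norm, norm_mul, ENNReal.ofReal_mul (norm_nonneg _), Complex.norm_real]
  simp

theorem differentiable_dilate {χ : ℂ → ℝ} (hχ : Differentiable ℝ χ) (x : ℂ) {t : ℝ} (ht : 0 < t) :
    (Differentiable ℝ fun y => (t ^ 2)⁻¹ * χ ((x - y) / (t : ℂ))) ∧
      ∀ y, ‖fderiv ℝ (fun y => (t ^ 2)⁻¹ * χ ((x - y) / (t : ℂ))) y‖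
        ≤ (t ^ 3)⁻¹ * ‖fderiv ℝ χ ((x - y) / (t : ℂ))‖ := by
  set φ : ℂ → ℝ := fun y => (t ^ 2)⁻¹ * χ ((x - y) / (t : ℂ))
  have hφd : ∀ y, HasFDerivAt φ ((t ^ 2)⁻¹ • (fderiv ℝ χ ((x - y) / (t : ℂ))).comp
      ((-t⁻¹ : ℝ) • ContinuousLinearMap.id ℝ ℂ)) y := by
    intro y
    have h1 : HasFDerivAt (fun y : ℂ => (x - y) / (t : ℂ))
        ((-t⁻¹ : ℝ) • ContinuousLinearMap.id ℝ ℂ) y := by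
      have e : (fun y : ℂ => (x - y) / (t : ℂ)) = fun y => (-t⁻¹ : ℝ) • y + x / t := by
        ext y
        simp
        ring
      rw [e]
      exact (((-t⁻¹ : ℝ) • ContinuousLinearMap.id ℝ ℂ).hasFDerivAt (x := y)).add_const _
    have h2 : HasFDerivAt χ (fderiv ℝ χ ((x - y) / (t : ℂ))) ((x - y) / (t : ℂ)) :=
      (hχ _).hasFDerivAt
    exact (h2.comp y h1).const_mul _
  refine ⟨fun y => (hφd y).differentiableAt, fun y => ?_⟩
  rw [(hφd y).fderiv]
  refine ContinuousLinearMap.opNorm_le_bound _ (by positivity) fun v => ?_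
  have h := ContinuousLinearMap.le_opNorm (fderiv ℝ χ ((x - y) / (t : ℂ))) ((-t⁻¹ : ℝ) • v)
  rw [norm_smul, norm_neg, norm_inv, Real.norm_of_nonneg ht.le] at h
  calc _ = (t ^ 2)⁻¹ * ‖fderiv ℝ χ ((x - y) / (t : ℂ)) ((-t⁻¹ : ℝ) • v)‖ := by
        rw [smul_apply, norm_smul, Real.norm_of_nonneg (by positivity)]
        rfl
    _ ≤ (t ^ 2)⁻¹ * (‖fderiv ℝ χ ((x - y) / (t : ℂ))‖ * (t⁻¹ * ‖v‖)) := by gcongr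
    _ = _ := by
        field_simp

set_option maxHeartbeats 400000 in
/-- The pointwise estimate of the smooth maximal function of a Jacobian. -/
theorem hardyMaximal_jacobian_dbar_le {χ : ℂ → ℝ} (hχ : IsTest χ) :
    ∃ K : ℝ, 0 ≤ K ∧ ∀ (u : 𝓢(ℂ, ℂ)) (x : ℂ) (a : ℝ), 0 < a →
      maximalFn (fun z => ENNReal.ofReal (‖fderiv ℝ u z‖ ^ (3 / 2 : ℝ))) x ≤ ENNReal.ofReal a →
      hardyMaximal χ (jacobian ((dbar u).toLp 2)) x ≤ ENNReal.ofReal (K * a ^ (4 / 3 : ℝ)) := by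
  obtain ⟨R, L, hR, hL, hχL, hχL', hχR⟩ := hχ.exists_support_bound
  -- The gradient of the dilated test function is at most t⁻³L and lives on a disc of radius Rt,
  -- where the Poincaré bound is 32(Rt)³a^{4/3}. The powers of t cancel, and a factor 2 cancels
  -- against |2i|.
  refine ⟨32 * L * R ^ 3, by positivity, fun u x a ha hmax => ?_⟩
  refine iSup₂_le fun t ht => ?_
  set φ : ℂ → ℝ := fun y => (t ^ 2)⁻¹ * χ ((x - y) / (t : ℂ))
  obtain ⟨hφd, hnorm⟩ := differentiable_dilate (hχ.1.differentiable (by simp)) x ht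
  have hφ1 : ∀ y, |φ y| ≤ (t ^ 2)⁻¹ * L := fun y => by
    rw [abs_mul, abs_of_pos (by positivity)]
    gcongr
    exact hχL _
  have hφ2 : ∀ y, ‖fderiv ℝ φ y‖ ≤ (t ^ 3)⁻¹ * L := fun y =>
    (hnorm y).trans (by gcongr; exact hχL' _)
  have hφ3 : ∀ y, y ∉ Metric.ball x (R * t) → fderiv ℝ φ y = 0 := by
    intro y hy
    have h := hnorm y
    rw [hχR, norm_zero, mul_zero] at h
    · exact norm_le_zero_iff.1 h
    · rw [Metric.mem_ball, not_lt, dist_comm, dist_eq_norm] at hy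
      rw [norm_div, Complex.norm_real, Real.norm_of_nonneg ht.le, le_div_iff₀ ht]
      exact hy
  have hRt : 0 < R * t := by positivity
  obtain ⟨c, hc⟩ := exists_lintegral_sub_mul_fderiv_le (u.smooth 1) (x := x) hRt ha (by
    refine (setLIntegral_ball_le_maximalFn _ x hRt).trans ?_
    rw [ENNReal.ofReal_mul ha.le]
    gcongr)
  have hmain := two_I_mul_integral_mul_jacobian u hφd hφ1 hφ2 c
  have hpt : ∀ y, ‖conj (u y - c) * (fderiv ℝ φ y Complex.I * ∂_{(1 : ℂ)} u y
          - fderiv ℝ φ y 1 * ∂_{Complex.I} u y)‖ₑ ≤ (Metric.ball x (R * t)).indicator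
        (fun y => ENNReal.ofReal (2 * ((t ^ 3)⁻¹ * L)) * (‖u y - c‖ₑ * ‖fderiv ℝ u y‖ₑ)) y := by
    intro y
    by_cases hy : y ∈ Metric.ball x (R * t)
    · rw [Set.indicator_of_mem hy, ← ofReal_norm, ← ofReal_norm, ← ofReal_norm,
        ← ENNReal.ofReal_mul (norm_nonneg _), ← ENNReal.ofReal_mul (by positivity)]
      apply ENNReal.ofReal_le_ofReal
      have hm : ∀ v w : ℂ, ‖v‖ = 1 → ‖w‖ = 1 →
          ‖(fderiv ℝ φ y v : ℂ) * ∂_{w} u y‖ ≤ (t ^ 3)⁻¹ * L * ‖fderiv ℝ u y‖ := by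
        intro v w hv hw
        rw [norm_mul, Complex.norm_real, SchwartzMap.lineDerivOp_apply_eq_fderiv]
        refine mul_le_mul ?_ ?_ (norm_nonneg _) (by positivity)
        · exact (ContinuousLinearMap.le_opNorm _ _).trans (by rw [hv, mul_one]; exact hφ2 y)
        · exact (ContinuousLinearMap.le_opNorm _ _).trans (by rw [hw, mul_one])
      rw [norm_mul, RCLike.norm_conj]
      calc _ ≤ ‖u y - c‖ * ((t ^ 3)⁻¹ * L * ‖fderiv ℝ u y‖ + (t ^ 3)⁻¹ * L * ‖fderiv ℝ u y‖) := by
            gcongr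
            exact (norm_sub_le _ _).trans (add_le_add (hm _ _ (by simp) (by simp))
              (hm _ _ (by simp) (by simp)))
        _ = _ := by ring
    · simp [hφ3 y hy]
  have hI : ∫⁻ y, (Metric.ball x (R * t)).indicator
      (fun y => ENNReal.ofReal (2 * ((t ^ 3)⁻¹ * L)) * (‖u y - c‖ₑ * ‖fderiv ℝ u y‖ₑ)) y
      ≤ ENNReal.ofReal (2 * ((t ^ 3)⁻¹ * L))
        * ENNReal.ofReal (32 * (R * t) ^ 3 * a ^ (4 / 3 : ℝ)) := by
    rw [lintegral_indicator measurableSet_ball, lintegral_const_mul' _ _ ENNReal.ofReal_ne_top]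
    exact mul_le_mul_right hc _
  have h2 := (enorm_integral_le_lintegral_enorm _).trans ((lintegral_mono hpt).trans hI)
  rw [← hmain, enorm_two_I_mul_ofReal, ← ENNReal.ofReal_mul (by positivity),
    show 2 * ((t ^ 3)⁻¹ * L) * (32 * (R * t) ^ 3 * a ^ (4 / 3 : ℝ))
      = 2 * (32 * L * R ^ 3 * a ^ (4 / 3 : ℝ)) by field_simp,
    ENNReal.ofReal_mul (by norm_num), ENNReal.ofReal_ofNat] at h2
  exact (ENNReal.mul_le_mul_iff_right (by simp) (by simp)).1 h2

set_option maxHeartbeats 400000 in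
/-- The Hardy space estimate for Jacobians of Schwartz functions. -/
theorem hardyNorm_jacobian_dbar_le {χ : ℂ → ℝ} (hχ : IsTest χ) : ∃ C : ℝ≥0, ∀ u : 𝓢(ℂ, ℂ),
    hardyNorm χ (jacobian ((dbar u).toLp 2)) ≤ C * ‖((dbar u).toLp 2 : L2)‖ₑ ^ 2 := by
  obtain ⟨K, hK, hmax⟩ := hardyMaximal_jacobian_dbar_le hχ
  -- The constant of the maximal inequality at p = 4/3. As (3/2)·(4/3) = 2, that inequality for
  -- |Du|^{3/2} yields exactly ∫|Du|².
  set A : ℝ := 32 * Real.pi * ((4 / 3 : ℝ) / (4 / 3 - 1)) * (2 * Real.pi) ^ (4 / 3 - 1 : ℝ)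
  refine ⟨(K * A * 4).toNNReal, fun u => ?_⟩
  set f : ℂ → ℝ := fun z => ‖fderiv ℝ u z‖ ^ (3 / 2 : ℝ)
  obtain ⟨B, hB⟩ := exists_norm_fderiv_le u
  have hfc : Continuous f := (((u.smooth 1).continuous_fderiv (by norm_num)).norm).rpow_const
    fun _ => Or.inr (by norm_num)
  have hf0 : ∀ z, 0 ≤ f z := fun z => by positivity
  have hfB : ∀ z, f z ≤ B ^ (3 / 2 : ℝ) := fun z =>
    Real.rpow_le_rpow (norm_nonneg _) (hB z) (by norm_num)
  have hfint : ∫⁻ z, ENNReal.ofReal (f z) ≠ ∞ := by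
    have h := (SchwartzMap.fderivCLM ℝ ℂ ℂ u).memLp (3 / 2 : ℝ≥0∞) volume
    have h0 : (3 / 2 : ℝ≥0∞) ≠ 0 := by simp
    have h1 : (3 / 2 : ℝ≥0∞) ≠ ∞ := by finiteness
    have h2 := lintegral_rpow_enorm_lt_top_of_eLpNorm_lt_top h0 h1 h.2
    refine ne_of_lt (lt_of_le_of_lt (le_of_eq (lintegral_congr fun z => ?_)) h2)
    simp only [f, SchwartzMap.fderivCLM_apply]
    rw [← ENNReal.ofReal_rpow_of_nonneg (norm_nonneg _) (by norm_num), ofReal_norm]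
    congr 1
    simp
  set m : ℂ → ℝ := fun x => (maximalFn (fun z => ENNReal.ofReal (f z)) x).toReal
  have hfin : ∀ x, maximalFn (fun z => ENNReal.ofReal (f z)) x ≠ ∞ := fun x =>
    ne_top_of_le_ne_top (ENNReal.mul_ne_top ENNReal.ofReal_ne_top ENNReal.coe_ne_top)
    (maximalFn_le_of_le (fun y => ENNReal.ofReal_le_ofReal (hfB y)) x)
  have hpt : ∀ x, hardyMaximal χ (jacobian ((dbar u).toLp 2)) x
      ≤ ENNReal.ofReal K * ENNReal.ofReal (m x ^ (4 / 3 : ℝ)) := by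
    intro x
    rw [← ENNReal.ofReal_mul hK]
    have hcont : Continuous fun a : ℝ => ENNReal.ofReal (K * a ^ (4 / 3 : ℝ)) :=
      ENNReal.continuous_ofReal.comp
        (continuous_const.mul (continuous_id.rpow_const fun _ => Or.inr (by norm_num)))
    -- The pointwise estimate needs a positive `a`, while `m x` may vanish; hence the limit from the
    -- right.
    refine ge_of_tendsto (x := 𝓝[>] (m x))
      ((hcont.tendsto (m x)).mono_left nhdsWithin_le_nhds) ?_
    filter_upwards [self_mem_nhdsWithin] with a ha
    have ha' : m x < a := ha
    refine hmax u x a (lt_of_le_of_lt ENNReal.toReal_nonneg ha') ?_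
    rw [← ENNReal.ofReal_toReal (hfin x)]
    exact ENNReal.ofReal_le_ofReal ha'.le
  have hN : hardyNorm χ (jacobian ((dbar u).toLp 2))
      ≤ ∫⁻ x, ENNReal.ofReal K * ENNReal.ofReal (m x ^ (4 / 3 : ℝ)) := lintegral_mono hpt
  refine hN.trans ?_
  have hD := lintegral_norm_fderiv_sq_le u
  generalize ‖((dbar u).toLp 2 : L2)‖ₑ = W at hD ⊢
  calc ∫⁻ x, ENNReal.ofReal K * ENNReal.ofReal (m x ^ (4 / 3 : ℝ))
      = ENNReal.ofReal K * ∫⁻ x, ENNReal.ofReal (m x ^ (4 / 3 : ℝ)) :=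
        lintegral_const_mul' _ _ ENNReal.ofReal_ne_top
    _ ≤ ENNReal.ofReal K * (ENNReal.ofReal A * ∫⁻ x, ENNReal.ofReal (f x ^ (4 / 3 : ℝ))) :=
        mul_le_mul_right (lintegral_maximalFn_rpow_le hfc.measurable hf0 hfB hfint (by norm_num)) _
    _ = ENNReal.ofReal K * (ENNReal.ofReal A * ∫⁻ x, ENNReal.ofReal (‖fderiv ℝ u x‖ ^ 2)) := by
        congr 3 with x
        simp only [f]
        rw [← Real.rpow_mul (norm_nonneg _)]
        norm_num
    _ ≤ ENNReal.ofReal K * (ENNReal.ofReal A * (4 * W ^ 2)) :=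
        mul_le_mul_right (mul_le_mul_right hD _) _
    _ = _ := by
        have hA : 0 ≤ A := by
          have : (0 : ℝ) ≤ 4 / 3 / (4 / 3 - 1) := by norm_num
          positivity
        rw [← mul_assoc, ← mul_assoc, ← ENNReal.ofReal_mul hK,
          show (4 : ℝ≥0∞) = ENNReal.ofReal 4 by simp, ← ENNReal.ofReal_mul (by positivity)]
        simp only [ENNReal.ofReal]

/-! ### The Hardy norm as a lower semicontinuous seminorm -/

section HardyNorm

variable {χ : ℂ → ℝ}

theorem IsTest.continuous (hχ : IsTest χ) : Continuous χ := hχ.1.continuous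

theorem IsTest.exists_abs_le (hχ : IsTest χ) : ∃ L, ∀ x, |χ x| ≤ L :=
  hχ.2.exists_bound_of_continuous hχ.continuous

theorem IsTest.integrable_mul_dilate (hχ : IsTest χ) (f : L1) (x : ℂ) (t : ℝ) :
    Integrable (fun y => f y * ((t ^ 2)⁻¹ * χ ((x - y) / (t : ℂ)))) volume := by
  obtain ⟨L, hL⟩ := hχ.exists_abs_le
  refine (L1.integrable_coeFn f).mul_bdd (c := |(t ^ 2)⁻¹| * L) ?_
    (Eventually.of_forall fun y => ?_)
  · exact (continuous_const.mul (hχ.continuous.comp (by fun_prop))).aestronglyMeasurable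
  · rw [Real.norm_eq_abs, abs_mul]
    gcongr
    exact hL _

theorem IsTest.continuous_convolution (hχ : IsTest χ) (f : L1) (t : ℝ) :
    Continuous fun x => ∫ y, f y * ((t ^ 2)⁻¹ * χ ((x - y) / (t : ℂ))) := by
  obtain ⟨L, hL⟩ := hχ.exists_abs_le
  refine continuous_of_dominated (bound := fun y => ‖f y‖ * (|(t ^ 2)⁻¹| * L))
    (fun x => (hχ.integrable_mul_dilate f x t).aestronglyMeasurable)
    (fun x => Eventually.of_forall fun y => ?_) ((L1.integrable_coeFn f).norm.mul_const _)
    (Eventually.of_forall fun y => ?_)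
  · rw [norm_mul, norm_mul, Real.norm_eq_abs (t ^ 2)⁻¹]
    gcongr
    exact hL _
  · exact continuous_const.mul (continuous_const.mul (hχ.continuous.comp (by fun_prop)))

theorem IsTest.measurable_hardyMaximal (hχ : IsTest χ) (f : L1) :
    Measurable (hardyMaximal χ f) := by
  have : LowerSemicontinuous (hardyMaximal χ f) :=
    lowerSemicontinuous_iSup fun t => lowerSemicontinuous_iSup fun _ =>
      (hχ.continuous_convolution f t).enorm.lowerSemicontinuous
  exact this.measurable

theorem enorm_integral_le_hardyMaximal (f : ℂ → ℝ) (x : ℂ) {t : ℝ} (ht : 0 < t) :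
    ‖∫ y, f y * ((t ^ 2)⁻¹ * χ ((x - y) / (t : ℂ)))‖ₑ ≤ hardyMaximal χ f x :=
  le_iSup₂_of_le (f := fun (t : ℝ) (_ : 0 < t) =>
    ‖∫ y, f y * ((t ^ 2)⁻¹ * χ ((x - y) / (t : ℂ)))‖ₑ) t ht le_rfl

theorem IsTest.hardyNorm_add_le (hχ : IsTest χ) (f g : L1) :
    hardyNorm χ (f + g) ≤ hardyNorm χ f + hardyNorm χ g := by
  unfold hardyNorm
  rw [← lintegral_add_left (hχ.measurable_hardyMaximal f)]
  refine lintegral_mono fun x => iSup₂_le fun t ht => ?_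
  have e : ∫ y, (f + g : L1) y * ((t ^ 2)⁻¹ * χ ((x - y) / (t : ℂ)))
      = (∫ y, f y * ((t ^ 2)⁻¹ * χ ((x - y) / (t : ℂ))))
        + ∫ y, g y * ((t ^ 2)⁻¹ * χ ((x - y) / (t : ℂ))) := by
    rw [← integral_add (hχ.integrable_mul_dilate f x t) (hχ.integrable_mul_dilate g x t)]
    refine integral_congr_ae ?_
    filter_upwards [Lp.coeFn_add f g] with y hy
    rw [hy, Pi.add_apply, add_mul]
  rw [e]
  exact (enorm_add_le _ _).trans (add_le_add
    (enorm_integral_le_hardyMaximal f x ht) (enorm_integral_le_hardyMaximal g x ht))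

theorem hardyNorm_smul_le (c : ℝ) (f : L1) : hardyNorm χ (c • f) ≤ ‖c‖ₑ * hardyNorm χ f := by
  unfold hardyNorm
  rw [← lintegral_const_mul' _ _ (by simp)]
  refine lintegral_mono fun x => iSup₂_le fun t ht => ?_
  have e : ∫ y, (c • f : L1) y * ((t ^ 2)⁻¹ * χ ((x - y) / (t : ℂ)))
      = c * ∫ y, f y * ((t ^ 2)⁻¹ * χ ((x - y) / (t : ℂ))) := by
    rw [← integral_const_mul]
    refine integral_congr_ae ?_
    filter_upwards [Lp.coeFn_smul c f] with y hy
    rw [hy, Pi.smul_apply, smul_eq_mul, mul_assoc]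
  rw [e, enorm_mul]
  exact mul_le_mul_right (enorm_integral_le_hardyMaximal f x ht) _

/-- For fixed x and t the convolution is continuous in L¹; a supremum of such functionals is lower
semicontinuous, and Fatou's lemma handles the integral. -/
theorem IsTest.hardyNorm_le_liminf (hχ : IsTest χ) {f : ℕ → L1} {g : L1}
    (hf : Tendsto f atTop (𝓝 g)) : hardyNorm χ g ≤ liminf (fun n => hardyNorm χ (f n)) atTop := by
  refine le_trans (lintegral_mono fun x => ?_)
    (lintegral_liminf_le fun n => hχ.measurable_hardyMaximal (f n))
  refine iSup₂_le fun t ht => ?_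
  obtain ⟨L, hL⟩ := hχ.exists_abs_le
  have hc : Continuous fun f : L1 => ∫ y, ((t ^ 2)⁻¹ * χ ((x - y) / (t : ℂ))) * f y :=
    continuous_integral_mul (M := |(t ^ 2)⁻¹| * L)
      (continuous_const.mul (hχ.continuous.comp (by fun_prop))).aestronglyMeasurable fun y => by
        rw [abs_mul]
        gcongr
        exact hL _
  have h1 := ((hc.tendsto g).comp hf).enorm
  rw [show ‖∫ y, g y * ((t ^ 2)⁻¹ * χ ((x - y) / (t : ℂ)))‖ₑ
    = ‖∫ y, ((t ^ 2)⁻¹ * χ ((x - y) / (t : ℂ))) * g y‖ₑ by simp_rw [mul_comm], ← h1.liminf_eq]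
  refine liminf_le_liminf (Eventually.of_forall fun n => ?_)
  refine le_iSup₂_of_le t ht ?_
  simp only [Function.comp_apply]
  simp_rw [mul_comm]
  exact le_rfl

/-- The planar Jacobian maps `L²` into the Hardy space. -/
theorem IsTest.hardyNorm_jacobian_le (hχ : IsTest χ) :
    ∃ C : ℝ≥0, ∀ ω : L2, hardyNorm χ (jacobian ω) ≤ C * ‖ω‖ₑ ^ 2 := by
  obtain ⟨C, hC⟩ := hardyNorm_jacobian_dbar_le hχ
  refine ⟨C, fun ω => ?_⟩
  obtain ⟨v, hv, hlim⟩ := mem_closure_iff_seq_limit.1 (denseRange_dbar ω)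
  choose u hu using hv
  refine (hχ.hardyNorm_le_liminf ((continuous_jacobian.tendsto ω).comp hlim)).trans ?_
  have h1 : Tendsto (fun n => (C : ℝ≥0∞) * ‖v n‖ₑ ^ 2) atTop (𝓝 (C * ‖ω‖ₑ ^ 2)) :=
    ENNReal.Tendsto.const_mul (ENNReal.Tendsto.pow hlim.enorm) (Or.inr ENNReal.coe_ne_top)
  rw [← h1.liminf_eq]
  refine liminf_le_liminf (Eventually.of_forall fun n => ?_)
  simp only [Function.comp_apply, ← hu]
  exact hC (u n)

theorem IsTest.hardyNorm_jacobianPolar_le (hχ : IsTest χ) :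
    ∃ C : ℝ≥0, ∀ ω η : L2, hardyNorm χ (jacobianPolar ω η) ≤ C * ‖ω‖ₑ * ‖η‖ₑ := by
  obtain ⟨C, hC⟩ := hχ.hardyNorm_jacobian_le
  exact ⟨4 * C, jacobianPolar_bound _ hχ.hardyNorm_add_le hardyNorm_smul_le C hC⟩

/-- A map with a quadratic expansion along lines is Gâteaux differentiable into the Hardy space. -/
theorem hasGateauxDerivHardy_of_quadratic {H : Type*} [NormedAddCommGroup H] [NormedSpace ℂ H]
    [NormedSpace ℝ H] {Q : H → L1} {ω : H} {B : H → L1} (hlin : IsLinearMap ℝ B)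
    (hB : ∃ C : ℝ≥0, ∀ h, hardyNorm χ (B h) ≤ C * ‖h‖ₑ)
    (hQ : ∀ h (t : ℝ), Q (ω + t • h) = Q ω + t • B h + t ^ 2 • Q h)
    (hfin : ∀ h, hardyNorm χ (Q h) < ∞) : HasGateauxDerivHardy χ Q ω B := by
  refine ⟨hlin, hB, fun h => ?_⟩
  have hlim : Tendsto (fun t : ℝ => ‖t‖ₑ * hardyNorm χ (Q h)) (𝓝[≠] 0) (𝓝 0) := by
    have h1 : Tendsto (fun t : ℝ => ‖t‖ₑ) (𝓝[≠] 0) (𝓝 0) := by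
      have := (continuous_enorm (E := ℝ)).tendsto 0
      rw [enorm_zero] at this
      exact this.mono_left nhdsWithin_le_nhds
    simpa using ENNReal.Tendsto.mul_const h1 (Or.inr (hfin h).ne)
  refine tendsto_of_tendsto_of_tendsto_of_le_of_le' tendsto_const_nhds hlim
    (Eventually.of_forall fun _ => zero_le) ?_
  filter_upwards [self_mem_nhdsWithin] with t ht
  have ht0 : t ≠ 0 := ht
  have e : t⁻¹ • (Q (ω + t • h) - Q ω) - B h = t • Q h := by
    rw [hQ, add_assoc, add_sub_cancel_left, smul_add, smul_smul, smul_smul, inv_mul_cancel₀ ht0,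
      one_smul, pow_two, inv_mul_cancel_left₀ ht0, add_sub_cancel_left]
  rw [e]
  exact hardyNorm_smul_le t _

theorem IsTest.memHardy_jacobian (hχ : IsTest χ) (ω : L2) : MemHardy χ (jacobian ω) := by
  obtain ⟨C, hC⟩ := hχ.hardyNorm_jacobian_le
  exact (hC ω).trans_lt (by finiteness)

theorem IsTest.memHardy_jacobianDeriv (hχ : IsTest χ) (p : L2Pair) :
    MemHardy χ (jacobianDeriv p) := by
  obtain ⟨C, hC⟩ := hχ.hardyNorm_jacobianPolar_le
  rw [jacobianDeriv_eq]
  exact (hC _ _).trans_lt (by finiteness)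

theorem IsTest.hasGateauxDerivHardy_jacobian (hχ : IsTest χ) (ω : L2) :
    HasGateauxDerivHardy χ jacobian ω (lineDeriv ℝ jacobian ω) := by
  rw [show lineDeriv ℝ jacobian ω = jacobianPolar ω from funext fun η => lineDeriv_jacobian ω η]
  obtain ⟨C, hC⟩ := hχ.hardyNorm_jacobianPolar_le
  refine hasGateauxDerivHardy_of_quadratic
    ⟨fun _ _ => jacobianPolar_add_right _ _ _, fun _ _ => jacobianPolar_smul_right _ _ _⟩
    ⟨C * ‖ω‖₊, fun h => ?_⟩ (fun h t => jacobian_add_smul ω h t) hχ.memHardy_jacobian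
  rw [ENNReal.coe_mul, ← enorm_eq_nnnorm]
  exact hC ω h

theorem enorm_fst_le (p : L2Pair) : ‖p.fst‖ₑ ≤ ‖p‖ₑ := by
  have h := WithLp.prod_norm_sq_eq_of_L2 p
  rw [enorm_le_iff_norm_le]
  nlinarith [norm_nonneg p, norm_nonneg p.fst, sq_nonneg ‖p.snd‖]

theorem enorm_snd_le (p : L2Pair) : ‖p.snd‖ₑ ≤ ‖p‖ₑ := by
  have h := WithLp.prod_norm_sq_eq_of_L2 p
  rw [enorm_le_iff_norm_le]
  nlinarith [norm_nonneg p, norm_nonneg p.snd, sq_nonneg ‖p.fst‖]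

theorem IsTest.hasGateauxDerivHardy_jacobianDeriv (hχ : IsTest χ) (p : L2Pair) :
    HasGateauxDerivHardy χ jacobianDeriv p (lineDeriv ℝ jacobianDeriv p) := by
  rw [show lineDeriv ℝ jacobianDeriv p
    = fun q => jacobianPolar p.fst q.snd + jacobianPolar q.fst p.snd from
      funext fun η => lineDeriv_jacobianDeriv p η]
  obtain ⟨C, hC⟩ := hχ.hardyNorm_jacobianPolar_le
  refine hasGateauxDerivHardy_of_quadratic ⟨fun q q' => ?_, fun t q => ?_⟩
    ⟨2 * C * ‖p‖₊, fun q => ?_⟩ (fun q t => jacobianDeriv_add_smul p q t) hχ.memHardy_jacobianDeriv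
  · simp only [WithLp.add_fst, WithLp.add_snd, jacobianPolar_add_right, jacobianPolar_add_left]
    abel
  · simp only [WithLp.smul_fst, WithLp.smul_snd, jacobianPolar_smul_right, jacobianPolar_smul_left,
      smul_add]
  · calc _ ≤ C * ‖p.fst‖ₑ * ‖q.snd‖ₑ + C * ‖q.fst‖ₑ * ‖p.snd‖ₑ :=
          (hχ.hardyNorm_add_le _ _).trans (add_le_add (hC _ _) (hC _ _))
      _ ≤ C * ‖p‖ₑ * ‖q‖ₑ + C * ‖q‖ₑ * ‖p‖ₑ := by
          gcongr
          · exact enorm_fst_le p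
          · exact enorm_snd_le q
          · exact enorm_fst_le q
          · exact enorm_snd_le p
      _ = _ := by
          push_cast
          rw [enorm_eq_nnnorm p]
          ring

end HardyNorm

/-! ### Wirtinger's inequality along circles -/

/-- Parseval: the n-th coefficient of v is that of v' divided by in, and the zeroth vanishes by
hypothesis. -/
theorem integral_norm_sq_le_of_mean_zero {v v' : ℝ → ℂ} (hv : ∀ x, HasDerivAt v (v' x) x)
    (hv' : Continuous v') (hper : v (2 * Real.pi) = v 0)
    (hmean : ∫ x in (0 : ℝ)..(2 * Real.pi), v x = 0) :
    ∫ x in (0 : ℝ)..(2 * Real.pi), ‖v x‖ ^ 2 ≤ ∫ x in (0 : ℝ)..(2 * Real.pi), ‖v' x‖ ^ 2 := by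
  have hab : (0 : ℝ) < 2 * Real.pi := by positivity
  have hvc : Continuous v := continuous_iff_continuousAt.2 fun x => (hv x).continuousAt
  have hmem : ∀ {g : ℝ → ℂ}, Continuous g → MemLp g 2 (volume.restrict (Set.Ioc 0 (2 * Real.pi))) :=
    fun {g} hg => by
      obtain ⟨C, hC⟩ := isCompact_Icc.exists_bound_of_continuousOn (s := Set.Icc 0 (2 * Real.pi))
        hg.continuousOn
      exact MemLp.of_bound hg.aestronglyMeasurable C ((ae_restrict_mem measurableSet_Ioc).mono
        fun x hx => hC x (Set.Ioc_subset_Icc_self hx))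
  have h1 := hasSum_sq_fourierCoeffOn hab (hmem hvc)
  have h2 := hasSum_sq_fourierCoeffOn hab (hmem hv')
  have hle := hasSum_le (fun n => ?_) h1 h2
  · rw [smul_eq_mul, smul_eq_mul] at hle
    exact le_of_mul_le_mul_left hle (by rw [sub_zero]; positivity)
  · by_cases hn : n = 0
    · have : fourierCoeffOn hab v n = 0 := by
        rw [fourierCoeffOn_eq_integral, hn]
        simp [hmean]
      rw [this]
      simp
    · have h := fourierCoeffOn_of_hasDerivAt hab hn (fun x _ => hv x) (hv'.intervalIntegrable _ _)
      rw [hper, sub_self, mul_zero, zero_sub] at h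
      rw [h, norm_mul]
      have hn1 : (1 : ℝ) ≤ |(n : ℝ)| := by
        rw [← Int.cast_abs]
        exact_mod_cast Int.one_le_abs hn
      have e : ‖(1 : ℂ) / (-2 * Real.pi * Complex.I * n)‖ * ‖-((((2 * Real.pi : ℝ) : ℂ) - (0 : ℝ))
          * fourierCoeffOn hab v' n)‖ = |(n : ℝ)|⁻¹ * ‖fourierCoeffOn hab v' n‖ := by
        rw [norm_neg, norm_mul, ← mul_assoc]
        congr 1
        have hpi : |Real.pi| ≠ 0 := by simp [Real.pi_ne_zero]
        simp
        field_simp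
      rw [e]
      have h3 : |(n : ℝ)|⁻¹ ≤ 1 := inv_le_one_of_one_le₀ hn1
      have h4 := norm_nonneg (fourierCoeffOn hab v' n)
      have : |(n : ℝ)|⁻¹ * ‖fourierCoeffOn hab v' n‖ ≤ ‖fourierCoeffOn hab v' n‖ :=
        mul_le_of_le_one_left h4 h3
      gcongr

/-- Subtracting the mean of f does not change the left side, because f' integrates to zero over a
period. Then 2|vw| ≤ |v|² + |w|² and Wirtinger's inequality apply. -/
theorem abs_integral_im_conj_mul_deriv_le {f f' : ℝ → ℂ} (hf : ∀ x, HasDerivAt f (f' x) x)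
    (hf' : Continuous f') (hper : f (2 * Real.pi) = f 0) :
    |∫ x in (0 : ℝ)..(2 * Real.pi), (conj (f x) * f' x).im|
      ≤ ∫ x in (0 : ℝ)..(2 * Real.pi), ‖f' x‖ ^ 2 := by
  have hfc : Continuous f := continuous_iff_continuousAt.2 fun x => (hf x).continuousAt
  set c : ℂ := ((2 * Real.pi : ℝ) : ℂ)⁻¹ * ∫ x in (0 : ℝ)..(2 * Real.pi), f x
  have hmean : ∫ x in (0 : ℝ)..(2 * Real.pi), (f x - c) = 0 := by
    rw [intervalIntegral.integral_sub (hfc.intervalIntegrable _ _) (by simp),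
      intervalIntegral.integral_const, sub_zero]
    have : ((2 * Real.pi : ℝ) : ℂ) ≠ 0 := by
      exact_mod_cast (by positivity : (0 : ℝ) < 2 * Real.pi).ne'
    rw [Complex.real_smul, mul_inv_cancel_left₀ this, sub_self]
  have hW := integral_norm_sq_le_of_mean_zero (fun x => (hf x).sub_const c) hf' (by rw [hper]) hmean
  have hzero : ∫ x in (0 : ℝ)..(2 * Real.pi), f' x = 0 := by
    rw [intervalIntegral.integral_eq_sub_of_hasDerivAt (fun x _ => hf x)
      (hf'.intervalIntegrable _ _), hper, sub_self]
  have hc : ∫ x in (0 : ℝ)..(2 * Real.pi), (conj c * f' x).im = 0 := by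
    have h := Complex.imCLM.intervalIntegral_comp_comm (a := 0) (b := 2 * Real.pi)
      (μ := volume) (f := fun x => conj c * f' x)
      ((continuous_const.mul hf').intervalIntegrable _ _)
    simp only [Complex.imCLM_apply] at h
    rw [h, intervalIntegral.integral_const_mul, hzero]
    simp
  have c1 : Continuous fun x => (conj (f x) * f' x).im :=
    Complex.continuous_im.comp ((Complex.continuous_conj.comp hfc).mul hf')
  have c2 : Continuous fun x => (conj c * f' x).im :=
    Complex.continuous_im.comp (continuous_const.mul hf')
  have e : ∫ x in (0 : ℝ)..(2 * Real.pi), (conj (f x) * f' x).im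
      = ∫ x in (0 : ℝ)..(2 * Real.pi), (conj (f x - c) * f' x).im := by
    have h := intervalIntegral.integral_sub (a := 0) (b := 2 * Real.pi) (μ := volume)
      (c1.intervalIntegrable _ _) (c2.intervalIntegrable _ _)
    rw [hc, sub_zero] at h
    rw [← h]
    congr 1 with x
    rw [← Complex.sub_im, map_sub, sub_mul]
  rw [e]
  have c3 : Continuous fun x => ‖f x - c‖ ^ 2 := by fun_prop
  have c4 : Continuous fun x => ‖f' x‖ ^ 2 := by fun_prop
  calc |∫ x in (0 : ℝ)..(2 * Real.pi), (conj (f x - c) * f' x).im|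
      ≤ ∫ x in (0 : ℝ)..(2 * Real.pi), (2⁻¹ * ‖f x - c‖ ^ 2 + 2⁻¹ * ‖f' x‖ ^ 2) := by
        rw [← Real.norm_eq_abs]
        refine intervalIntegral.norm_integral_le_of_norm_le (by positivity)
          (Eventually.of_forall fun x _ => ?_)
          (((c3.const_mul _).add (c4.const_mul _)).intervalIntegrable _ _)
        rw [Real.norm_eq_abs]
        refine (Complex.abs_im_le_norm _).trans ?_
        rw [norm_mul, RCLike.norm_conj]
        nlinarith [sq_nonneg (‖f x - c‖ - ‖f' x‖)]
    _ = 2⁻¹ * (∫ x in (0 : ℝ)..(2 * Real.pi), ‖f x - c‖ ^ 2)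
        + 2⁻¹ * ∫ x in (0 : ℝ)..(2 * Real.pi), ‖f' x‖ ^ 2 := by
        rw [intervalIntegral.integral_add ((c3.const_mul _).intervalIntegrable _ _)
          ((c4.const_mul _).intervalIntegrable _ _), intervalIntegral.integral_const_mul,
          intervalIntegral.integral_const_mul]
    _ ≤ _ := by linarith

/-! ### Averaging over rotations -/

theorem integrable_inv_one_add_norm_sq_sq :
    Integrable (fun z : ℂ => ((1 + ‖z‖ ^ 2) ^ 2)⁻¹) volume := by
  have h := integrable_rpow_neg_one_add_norm_sq (E := ℂ) (μ := volume) (r := 4)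
    (by rw [Complex.finrank_real_complex]; norm_num)
  refine h.congr (Eventually.of_forall fun z => ?_)
  have : (0 : ℝ) ≤ 1 + ‖z‖ ^ 2 := by positivity
  simp only
  rw [show (-4 / 2 : ℝ) = -(2 : ℕ) by norm_num, Real.rpow_neg this, Real.rpow_natCast]

theorem integral_comp_exp_mul (F : ℂ → ℝ) (t : ℝ) :
    ∫ z, F (Complex.exp (t * Complex.I) * z) = ∫ z, F z := by
  have h := (rotation (Circle.exp t)).measurePreserving.integral_comp
    (rotation (Circle.exp t)).toHomeomorph.measurableEmbedding F
  simpa using h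

theorem integrable_comp_exp_mul {F : ℂ → ℝ} (hF : Continuous F) {K : ℝ}
    (hK : ∀ z, |F z| ≤ K * ((1 + ‖z‖ ^ 2) ^ 2)⁻¹) :
    Integrable (fun q : ℝ × ℂ => F (Complex.exp (q.1 * Complex.I) * q.2))
      ((volume.restrict (Set.Ioc 0 (2 * Real.pi))).prod volume) := by
  have h1 : Integrable (fun q : ℝ × ℂ => K * ((1 + ‖q.2‖ ^ 2) ^ 2)⁻¹)
      ((volume.restrict (Set.Ioc 0 (2 * Real.pi))).prod volume) :=
    (integrable_inv_one_add_norm_sq_sq.const_mul K).comp_snd _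
  refine h1.mono' (hF.comp (by fun_prop)).aestronglyMeasurable (Eventually.of_forall fun q => ?_)
  have h := hK (Complex.exp (q.1 * Complex.I) * q.2)
  rwa [norm_mul, Complex.norm_exp_ofReal_mul_I, one_mul] at h

/-- Rotation invariance lets inequalities on circles be integrated over the plane without polar
coordinates; the decay bound justifies Fubini. -/
theorem integral_rotation_average {F : ℂ → ℝ} (hF : Continuous F) {K : ℝ}
    (hK : ∀ z, |F z| ≤ K * ((1 + ‖z‖ ^ 2) ^ 2)⁻¹) :
    Integrable (fun z => ∫ t in (0 : ℝ)..(2 * Real.pi), F (Complex.exp (t * Complex.I) * z)) volume ∧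
    ∫ z, ∫ t in (0 : ℝ)..(2 * Real.pi), F (Complex.exp (t * Complex.I) * z)
      = 2 * Real.pi * ∫ z, F z := by
  have hi := integrable_comp_exp_mul hF hK
  simp only [intervalIntegral.integral_of_le (by positivity : (0 : ℝ) ≤ 2 * Real.pi)]
  refine ⟨hi.integral_prod_right, ?_⟩
  rw [← integral_integral_swap (f := fun (t : ℝ) z => F (Complex.exp (t * Complex.I) * z)) hi]
  simp_rw [integral_comp_exp_mul]
  simp [Real.pi_pos.le]

/-- The angular derivative of a Schwartz function. -/
def angular (u : 𝓢(ℂ, ℂ)) (z : ℂ) : ℂ := fderiv ℝ u z (Complex.I * z)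

theorem continuous_angular (u : 𝓢(ℂ, ℂ)) : Continuous (angular u) :=
  ((u.smooth 1).continuous_fderiv (by norm_num)).clm_apply (by fun_prop)

theorem exists_norm_angular_le (u : 𝓢(ℂ, ℂ)) : ∃ M, ∀ z, ‖angular u z‖ ≤ M := by
  refine ⟨_, fun z => le_trans ?_
    ((SchwartzMap.fderivCLM ℝ ℂ ℂ u).norm_pow_mul_le_seminorm ℝ 1 z)⟩
  refine (ContinuousLinearMap.le_opNorm _ _).trans (le_of_eq ?_)
  rw [norm_mul, Complex.norm_I, SchwartzMap.fderivCLM_apply]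
  ring

theorem angular_eq (u : 𝓢(ℂ, ℂ)) (z : ℂ) :
    angular u z = z.re * ∂_{Complex.I} u z - z.im * ∂_{(1 : ℂ)} u z := by
  have e : Complex.I * z = z.re • Complex.I + (-z.im) • (1 : ℂ) := by
    apply Complex.ext <;> simp
  rw [angular, e, map_add, map_smul, map_smul, SchwartzMap.lineDerivOp_apply_eq_fderiv,
    SchwartzMap.lineDerivOp_apply_eq_fderiv]
  simp
  ring

/-- The area density of the stereographic projection. -/
def sphereDensity (z : ℂ) : ℝ := 4 * ((1 + ‖z‖ ^ 2) ^ 2)⁻¹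

theorem continuous_sphereDensity : Continuous sphereDensity :=
  continuous_const.mul (Continuous.inv₀ (by fun_prop) fun z => by positivity)

theorem angular_bounds (u : 𝓢(ℂ, ℂ)) : ∃ K : ℝ,
    (∀ z, |sphereDensity z * (conj (u z) * angular u z).im| ≤ K * ((1 + ‖z‖ ^ 2) ^ 2)⁻¹) ∧
    ∀ z, |sphereDensity z * ‖angular u z‖ ^ 2| ≤ K * ((1 + ‖z‖ ^ 2) ^ 2)⁻¹ := by
  obtain ⟨A, hA⟩ := exists_norm_schwartz_le u
  obtain ⟨B, hB⟩ := exists_norm_angular_le u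
  have hA0 : 0 ≤ A := (norm_nonneg _).trans (hA 0)
  have hB0 : 0 ≤ B := (norm_nonneg _).trans (hB 0)
  refine ⟨4 * (A * B + B ^ 2), fun z => ?_, fun z => ?_⟩
  · have h1 : |(conj (u z) * angular u z).im| ≤ A * B := by
      refine (Complex.abs_im_le_norm _).trans ?_
      rw [norm_mul, RCLike.norm_conj]
      exact mul_le_mul (hA z) (hB z) (norm_nonneg _) hA0
    rw [abs_mul, sphereDensity, abs_of_pos (by positivity), mul_right_comm]
    gcongr
    nlinarith [sq_nonneg B]
  · have h1 : ‖angular u z‖ ^ 2 ≤ B ^ 2 := by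
      gcongr
      exact hB z
    rw [abs_of_nonneg (by unfold sphereDensity; positivity), sphereDensity, mul_right_comm]
    gcongr
    nlinarith [mul_nonneg hA0 hB0]

theorem continuous_angular_forms (u : 𝓢(ℂ, ℂ)) :
    (Continuous fun z => sphereDensity z * (conj (u z) * angular u z).im) ∧
    Continuous fun z => sphereDensity z * ‖angular u z‖ ^ 2 :=
  ⟨continuous_sphereDensity.mul (Complex.continuous_im.comp
    ((Complex.continuous_conj.comp u.continuous).mul (continuous_angular u))),
    continuous_sphereDensity.mul ((continuous_angular u).norm.pow 2)⟩

theorem integrable_angular_forms (u : 𝓢(ℂ, ℂ)) :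
    Integrable (fun z => sphereDensity z * (conj (u z) * angular u z).im) volume ∧
    Integrable (fun z => sphereDensity z * ‖angular u z‖ ^ 2) volume := by
  obtain ⟨K, h1, h2⟩ := angular_bounds u
  obtain ⟨c1, c2⟩ := continuous_angular_forms u
  exact ⟨(integrable_inv_one_add_norm_sq_sq.const_mul K).mono' c1.aestronglyMeasurable
    (Eventually.of_forall h1), (integrable_inv_one_add_norm_sq_sq.const_mul K).mono'
    c2.aestronglyMeasurable (Eventually.of_forall h2)⟩

/-- The weight is radial, so after averaging over rotations the circle inequality applies to t ↦
u(e^{it}z), whose derivative is `angular u` at that point. -/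
theorem abs_integral_angular_le (u : 𝓢(ℂ, ℂ)) :
    |∫ z, sphereDensity z * (conj (u z) * angular u z).im|
      ≤ ∫ z, sphereDensity z * ‖angular u z‖ ^ 2 := by
  obtain ⟨K, h1, h2⟩ := angular_bounds u
  obtain ⟨c1, c2⟩ := continuous_angular_forms u
  obtain ⟨i1, e1⟩ := integral_rotation_average c1 h1
  obtain ⟨i2, e2⟩ := integral_rotation_average c2 h2
  have hpi : 0 < 2 * Real.pi := by positivity
  refine le_of_mul_le_mul_left ?_ hpi
  rw [← abs_of_pos hpi, ← abs_mul, abs_of_pos hpi, ← e1, ← e2, ← Real.norm_eq_abs]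
  refine norm_integral_le_of_norm_le i2 (Eventually.of_forall fun z => ?_)
  have hw : ∀ t : ℝ, sphereDensity (Complex.exp (t * Complex.I) * z) = sphereDensity z := fun t => by
    simp only [sphereDensity, norm_mul, Complex.norm_exp_ofReal_mul_I, one_mul]
  simp_rw [hw]
  rw [intervalIntegral.integral_const_mul, intervalIntegral.integral_const_mul, norm_mul,
    Real.norm_of_nonneg (by unfold sphereDensity; positivity : 0 ≤ sphereDensity z),
    Real.norm_eq_abs]
  refine mul_le_mul_of_nonneg_left ?_ (by unfold sphereDensity; positivity)
  refine abs_integral_im_conj_mul_deriv_le (f := fun t : ℝ => u (Complex.exp (t * Complex.I) * z))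
    (fun t => ?_) ((continuous_angular u).comp (by fun_prop)) ?_
  · have h : HasDerivAt (fun t : ℝ => Complex.exp (t * Complex.I) * z)
        (Complex.I * (Complex.exp (t * Complex.I) * z)) t := by
      have h1 : HasDerivAt (fun t : ℝ => (t : ℂ) * Complex.I) Complex.I t := by
        simpa using (Complex.ofRealCLM.hasDerivAt (x := t)).mul_const Complex.I
      exact (h1.cexp.mul_const z).congr_deriv (by ring)
    exact (u.hasFDerivAt _).comp_hasDerivAt t h
  · simp [Complex.exp_two_pi_mul_I]

/-! ### The sharp weighted inequality for the Jacobian -/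

/-- The radial weight `2 / (1 + |z|²)`. -/
def bubble (z : ℂ) : ℝ := 2 * (1 + ‖z‖ ^ 2)⁻¹

theorem bubble_nonneg (z : ℂ) : 0 ≤ bubble z := by unfold bubble; positivity

theorem bubble_le_two (z : ℂ) : bubble z ≤ 2 := by
  have h : (1 + ‖z‖ ^ 2)⁻¹ ≤ 1 := inv_le_one_of_one_le₀ (by nlinarith [sq_nonneg ‖z‖])
  unfold bubble
  linarith

theorem abs_bubble_le (z : ℂ) : |bubble z| ≤ 2 := by
  rw [abs_of_nonneg (bubble_nonneg z)]
  exact bubble_le_two z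

theorem contDiff_bubble : ContDiff ℝ ((⊤ : ℕ∞) : WithTop ℕ∞) bubble := by
  unfold bubble
  exact contDiff_const.mul ((contDiff_const.add (contDiff_norm_sq ℝ)).inv fun z => by positivity)

theorem continuous_bubble : Continuous bubble := contDiff_bubble.continuous

theorem hasFDerivAt_bubble (z : ℂ) :
    HasFDerivAt bubble (-(sphereDensity z) • innerSL ℝ z) z := by
  have h1 : HasFDerivAt (fun z : ℂ => 1 + ‖z‖ ^ 2) (2 • innerSL ℝ z) z :=
    (hasStrictFDerivAt_norm_sq z).hasFDerivAt.const_add 1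
  have h2 := ((hasDerivAt_inv (by positivity : 1 + ‖z‖ ^ 2 ≠ 0)).comp_hasFDerivAt z h1).const_mul 2
  refine h2.congr_fderiv ?_
  ext
  all_goals
    simp [sphereDensity]
    ring

theorem fderiv_bubble_apply (z v : ℂ) :
    fderiv ℝ bubble z v = -(sphereDensity z * (z.re * v.re + z.im * v.im)) := by
  rw [(hasFDerivAt_bubble z).fderiv, smul_apply, innerSL_apply_apply, Complex.inner]
  simp
  ring_nf
  simp

theorem sphereDensity_mul_norm_le (z : ℂ) : sphereDensity z * ‖z‖ ≤ 4 := by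
  unfold sphereDensity
  rw [mul_assoc, ← div_eq_inv_mul]
  have : ‖z‖ / (1 + ‖z‖ ^ 2) ^ 2 ≤ 1 := by
    rw [div_le_one (by positivity)]
    nlinarith [sq_nonneg (‖z‖ - 1), sq_nonneg ‖z‖, sq_nonneg (‖z‖ ^ 2)]
  linarith

theorem norm_fderiv_bubble_le (z : ℂ) : ‖fderiv ℝ bubble z‖ ≤ 4 := by
  rw [(hasFDerivAt_bubble z).fderiv, norm_smul, innerSL_apply_norm, norm_neg,
    Real.norm_of_nonneg (by unfold sphereDensity; positivity)]
  exact sphereDensity_mul_norm_le z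

/-- The gradient of `bubble` is −`sphereDensity`(z)·z. Being radial, it turns the combination of
partial derivatives in the integration by parts into the angular derivative. -/
theorem two_mul_integral_bubble_mul_jacobian (u : 𝓢(ℂ, ℂ)) :
    2 * ∫ z, bubble z * jacobian ((dbar u).toLp 2) z
      = ∫ z, sphereDensity z * (conj (u z) * angular u z).im := by
  have h := two_I_mul_integral_mul_jacobian u (fun z => (hasFDerivAt_bubble z).differentiableAt)
    abs_bubble_le norm_fderiv_bubble_le 0
  have e : ∀ z, conj (u z - 0) * (fderiv ℝ bubble z Complex.I * ∂_{(1 : ℂ)} u z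
      - fderiv ℝ bubble z 1 * ∂_{Complex.I} u z)
      = sphereDensity z * (conj (u z) * angular u z) := by
    intro z
    rw [fderiv_bubble_apply, fderiv_bubble_apply, angular_eq]
    simp
    ring
  simp_rw [e] at h
  obtain ⟨A, hA⟩ := exists_norm_schwartz_le u
  obtain ⟨B, hB⟩ := exists_norm_angular_le u
  have hA0 : 0 ≤ A := (norm_nonneg _).trans (hA 0)
  have hi : Integrable (fun z => (sphereDensity z : ℂ) * (conj (u z) * angular u z)) volume := by
    refine (integrable_inv_one_add_norm_sq_sq.const_mul (4 * (A * B))).mono'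
      ((Complex.continuous_ofReal.comp continuous_sphereDensity).mul
        ((Complex.continuous_conj.comp u.continuous).mul
          (continuous_angular u))).aestronglyMeasurable (Eventually.of_forall fun z => ?_)
    rw [norm_mul, norm_mul, Complex.norm_real, RCLike.norm_conj, sphereDensity,
      Real.norm_of_nonneg (by positivity), mul_right_comm]
    gcongr
    · exact hA z
    · exact hB z
  have h2 := congrArg Complex.im h
  have h3 := integral_im hi
  simp only [RCLike.im_to_complex] at h3
  rw [← h3] at h2
  simp only [Complex.im_ofReal_mul] at h2
  rw [← h2]
  simp [mul_comm]

/-- Here a = ∂₁u and b = ∂₂u. After multiplication by x² + y² the defect is a sum of two squares in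
the radial derivative xa + yb and the angular derivative xb − ya; the origin is treated separately.
-/
theorem weighted_gradient_inequality (x y a₁ a₂ b₁ b₂ σ : ℝ) (hσ : σ ^ 2 = 1) :
    4 * ((x * b₁ - y * a₁) ^ 2 + (x * b₂ - y * a₂) ^ 2)
      + 2 * σ * ((x ^ 2 + y ^ 2) ^ 2 - 1) * (a₁ * b₂ - a₂ * b₁)
      ≤ (1 + (x ^ 2 + y ^ 2)) ^ 2 * (a₁ ^ 2 + a₂ ^ 2 + b₁ ^ 2 + b₂ ^ 2) := by
  by_cases h0 : x ^ 2 + y ^ 2 = 0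
  · have hx : x = 0 := by nlinarith [sq_nonneg x, sq_nonneg y]
    have hy : y = 0 := by nlinarith [sq_nonneg x, sq_nonneg y]
    subst hx hy
    nlinarith [sq_nonneg (a₁ + σ * b₂), sq_nonneg (a₂ - σ * b₁)]
  · have hρ : 0 < x ^ 2 + y ^ 2 := lt_of_le_of_ne (by positivity) (Ne.symm h0)
    rw [← sub_nonneg]
    refine nonneg_of_mul_nonneg_right ?_ hρ
    have e : (x ^ 2 + y ^ 2) * ((1 + (x ^ 2 + y ^ 2)) ^ 2 * (a₁ ^ 2 + a₂ ^ 2 + b₁ ^ 2 + b₂ ^ 2)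
        - (4 * ((x * b₁ - y * a₁) ^ 2 + (x * b₂ - y * a₂) ^ 2)
          + 2 * σ * ((x ^ 2 + y ^ 2) ^ 2 - 1) * (a₁ * b₂ - a₂ * b₁)))
        = ((1 + (x ^ 2 + y ^ 2)) * (x * a₁ + y * b₁)
            - σ * (x ^ 2 + y ^ 2 - 1) * (x * b₂ - y * a₂)) ^ 2
          + ((1 + (x ^ 2 + y ^ 2)) * (x * a₂ + y * b₂)
            + σ * (x ^ 2 + y ^ 2 - 1) * (x * b₁ - y * a₁)) ^ 2 := by
      linear_combination (-(x ^ 2 + y ^ 2 - 1) ^ 2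
        * ((x * b₁ - y * a₁) ^ 2 + (x * b₂ - y * a₂) ^ 2)) * hσ
    rw [e]
    positivity

theorem angular_add_jacobian_le (u : 𝓢(ℂ, ℂ)) (z : ℂ) {σ : ℝ} (hσ : σ ^ 2 = 1) :
    sphereDensity z * ‖angular u z‖ ^ 2
      + 2 * σ * ((1 - bubble z) * (conj (∂_{(1 : ℂ)} u z) * ∂_{Complex.I} u z).im)
      ≤ 2 * (‖dz u z‖ ^ 2 + ‖dbar u z‖ ^ 2) := by
  rw [norm_dz_sq_add_norm_dbar_sq, angular_eq]
  have h := weighted_gradient_inequality z.re z.im (∂_{(1 : ℂ)} u z).re (∂_{(1 : ℂ)} u z).im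
    (∂_{Complex.I} u z).re (∂_{Complex.I} u z).im σ hσ
  simp only [sphereDensity, bubble, ← Complex.normSq_eq_norm_sq, Complex.normSq_apply]
  have hz : z.re * z.re + z.im * z.im = z.re ^ 2 + z.im ^ 2 := by ring
  rw [hz]
  have hp : 0 < (1 + (z.re ^ 2 + z.im ^ 2)) ^ 2 := by positivity
  refine le_of_mul_le_mul_left (le_trans (le_of_eq ?_) (h.trans (le_of_eq ?_))) hp
  · simp
    field_simp
    ring
  · ring

/-- Let I be the integral and A = ∫ `sphereDensity`·|`angular u`|². Integrating the pointwise
inequality for σ = ±1, with ∫Qω = 0, gives A + 2|I| ≤ 4‖ω‖². The circle inequality gives 2|I| ≤ A,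
hence 4|I| ≤ 4‖ω‖². Density extends this from ω = ∂̄u. -/
theorem abs_integral_bubble_mul_jacobian_le (ω : L2) :
    |∫ z, bubble z * jacobian ω z| ≤ ‖ω‖ ^ 2 := by
  have hc : Continuous fun ω : L2 => ∫ z, bubble z * jacobian ω z :=
    (continuous_integral_mul continuous_bubble.aestronglyMeasurable abs_bubble_le).comp
      continuous_jacobian
  refine denseRange_dbar.induction_on (p := fun ω => |∫ z, bubble z * jacobian ω z| ≤ ‖ω‖ ^ 2) ω
    (isClosed_le hc.abs (by fun_prop)) fun u => ?_
  set η : L2 := (dbar u).toLp 2 with hη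
  have hJ : Integrable (jacobian η) volume := L1.integrable_coeFn _
  have hbJ : Integrable (fun z => bubble z * jacobian η z) volume :=
    hJ.bdd_mul continuous_bubble.aestronglyMeasurable (Eventually.of_forall abs_bubble_le)
  have hA := (integrable_angular_forms u).2
  have hE1 : Integrable (fun z => ‖dz u z‖ ^ 2) volume :=
    (memLp_two_iff_integrable_sq_norm (dz u).continuous.aestronglyMeasurable).1 ((dz u).memLp 2)
  have hE2 : Integrable (fun z => ‖dbar u z‖ ^ 2) volume :=
    (memLp_two_iff_integrable_sq_norm (dbar u).continuous.aestronglyMeasurable).1 ((dbar u).memLp 2)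
  have e2 : ∫ z, ‖dbar u z‖ ^ 2 = ‖η‖ ^ 2 := by
    rw [← integral_norm_sq]
    refine integral_congr_ae ?_
    filter_upwards [(dbar u).coeFn_toLp 2 volume] with z hz
    rw [hη, hz]
  have e1 : ∫ z, ‖dz u z‖ ^ 2 = ‖η‖ ^ 2 := by
    rw [← norm_beurling, ← integral_norm_sq]
    refine integral_congr_ae ?_
    filter_upwards [(dz u).coeFn_toLp 2 volume] with z hz
    rw [hη, beurling_dbar, hz]
  have hbound : ∀ σ : ℝ, σ ^ 2 = 1 → (∫ z, sphereDensity z * ‖angular u z‖ ^ 2)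
      - 2 * σ * ∫ z, bubble z * jacobian η z ≤ 4 * ‖η‖ ^ 2 := by
    intro σ hσ
    have hi : Integrable (fun z => (1 - bubble z) * jacobian η z) volume := by
      refine (hJ.sub hbJ).congr (Eventually.of_forall fun z => ?_)
      simp only [Pi.sub_apply]
      ring
    have h0 : ∫ z, (1 - bubble z) * jacobian η z = -∫ z, bubble z * jacobian η z := by
      simp_rw [sub_mul, one_mul]
      rw [integral_sub hJ hbJ, integral_jacobian, zero_sub]
    calc (∫ z, sphereDensity z * ‖angular u z‖ ^ 2) - 2 * σ * ∫ z, bubble z * jacobian η z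
        = ∫ z, (sphereDensity z * ‖angular u z‖ ^ 2
            + 2 * σ * ((1 - bubble z) * jacobian η z)) := by
          rw [integral_add hA (hi.const_mul _), integral_const_mul, h0]
          ring
      _ ≤ ∫ z, 2 * (‖dz u z‖ ^ 2 + ‖dbar u z‖ ^ 2) := by
          refine integral_mono_ae (hA.add (hi.const_mul _)) ((hE1.add hE2).const_mul 2) ?_
          filter_upwards [jacobian_dbar_ae u] with z hz
          rw [hz]
          exact angular_add_jacobian_le u z hσ
      _ = 4 * ‖η‖ ^ 2 := by
          rw [integral_const_mul, integral_add hE1 hE2, e1, e2]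
          ring
  have hang := abs_integral_angular_le u
  rw [← two_mul_integral_bubble_mul_jacobian, ← hη] at hang
  have h1 := hbound 1 (by norm_num)
  have h2 := hbound (-1) (by norm_num)
  rw [abs_le] at hang ⊢
  constructor <;> linarith [hang.1, hang.2]

/-! ### An extremal function -/

theorem memLp_of_norm_le_bubble {g : ℂ → ℂ} (hg : Continuous g) (h : ∀ z, ‖g z‖ ≤ bubble z) :
    MemLp g 2 volume := by
  rw [memLp_two_iff_integrable_sq_norm hg.aestronglyMeasurable]
  refine (integrable_inv_one_add_norm_sq_sq.const_mul 4).mono'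
    (hg.norm.pow 2).aestronglyMeasurable (Eventually.of_forall fun z => ?_)
  rw [Real.norm_of_nonneg (by positivity)]
  refine (pow_le_pow_left₀ (norm_nonneg _) (h z) 2).trans (le_of_eq ?_)
  rw [bubble, mul_pow, inv_pow]
  norm_num

/-- The derivative `∂/∂z̄` of `z / (1 + |z|²)`. -/
def extremalFun (z : ℂ) : ℂ := -z ^ 2 * ((((1 + ‖z‖ ^ 2) ^ 2)⁻¹ : ℝ) : ℂ)

/-- The derivative `∂/∂z` of `z / (1 + |z|²)`. -/
def extremalFun' (z : ℂ) : ℂ := ((((1 + ‖z‖ ^ 2) ^ 2)⁻¹ : ℝ) : ℂ)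

theorem continuous_inv_one_add_norm_sq_sq :
    Continuous fun z : ℂ => ((((1 + ‖z‖ ^ 2) ^ 2)⁻¹ : ℝ) : ℂ) :=
  Complex.continuous_ofReal.comp (Continuous.inv₀ (by fun_prop) fun z => by positivity)

theorem norm_extremalFun (z : ℂ) : ‖extremalFun z‖ = ‖z‖ ^ 2 * ((1 + ‖z‖ ^ 2) ^ 2)⁻¹ := by
  rw [extremalFun, norm_mul, norm_neg, norm_pow, Complex.norm_real, Real.norm_of_nonneg]
  positivity

theorem norm_extremalFun' (z : ℂ) : ‖extremalFun' z‖ = ((1 + ‖z‖ ^ 2) ^ 2)⁻¹ := by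
  rw [extremalFun', Complex.norm_real, Real.norm_of_nonneg]
  positivity

theorem memLp_extremalFun : MemLp extremalFun 2 volume := by
  refine memLp_of_norm_le_bubble ((continuous_pow 2).neg.mul continuous_inv_one_add_norm_sq_sq)
    fun z => ?_
  rw [norm_extremalFun, bubble, ← div_eq_mul_inv, ← div_eq_mul_inv,
    div_le_div_iff₀ (by positivity) (by positivity)]
  nlinarith [sq_nonneg ‖z‖, sq_nonneg (‖z‖ ^ 2)]

theorem memLp_extremalFun' : MemLp extremalFun' 2 volume := by
  refine memLp_of_norm_le_bubble continuous_inv_one_add_norm_sq_sq fun z => ?_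
  rw [norm_extremalFun', bubble, ← one_div, ← div_eq_mul_inv,
    div_le_div_iff₀ (by positivity) (by positivity)]
  nlinarith [sq_nonneg ‖z‖, sq_nonneg (‖z‖ ^ 2)]

/-- The function h = z/(1+|z|²) is not Schwartz, so `beurling_dbar` does not apply to it. The
null-Lagrangian identity against Schwartz u replaces it, since f = 2·conj h and its gradient are
bounded. -/
theorem integral_conj_extremalFun_mul (u : 𝓢(ℂ, ℂ)) :
    ∫ z, dz u z * conj (extremalFun' z) = ∫ z, dbar u z * conj (extremalFun z) := by
  set f : ℂ → ℂ := fun z => bubble z * conj z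
  have hfd : ∀ z, HasFDerivAt f ((bubble z : ℂ) • Complex.conjCLE.toContinuousLinearMap
      + (Complex.ofRealCLM.comp (-(sphereDensity z) • innerSL ℝ z)).smulRight (conj z)) z := by
    intro z
    have h1 : HasFDerivAt (fun z => (bubble z : ℂ))
        (Complex.ofRealCLM.comp (-(sphereDensity z) • innerSL ℝ z)) z :=
      Complex.ofRealCLM.hasFDerivAt.comp z (hasFDerivAt_bubble z)
    exact h1.mul' Complex.conjCLE.toContinuousLinearMap.hasFDerivAt
  have hfv : ∀ z v, fderiv ℝ f z v = bubble z * conj v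
      - sphereDensity z * (z.re * v.re + z.im * v.im) * conj z := by
    intro z v
    rw [(hfd z).fderiv]
    simp [Complex.inner]
    ring
  have hM : ∀ z, ‖f z‖ ≤ 2 := by
    intro z
    rw [norm_mul, Complex.norm_real, RCLike.norm_conj, Real.norm_of_nonneg (bubble_nonneg z),
      bubble, mul_assoc, ← div_eq_inv_mul]
    have : ‖z‖ / (1 + ‖z‖ ^ 2) ≤ 1 := by
      rw [div_le_one (by positivity)]
      nlinarith [sq_nonneg (‖z‖ - 1), sq_nonneg ‖z‖]
    linarith
  have hM' : ∀ z, ‖fderiv ℝ f z‖ ≤ 6 := by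
    intro z
    rw [(hfd z).fderiv]
    refine ContinuousLinearMap.opNorm_le_bound _ (by norm_num) fun v => ?_
    have e1 : ‖(bubble z : ℂ) * conj v‖ ≤ 2 * ‖v‖ := by
      rw [norm_mul, Complex.norm_real, RCLike.norm_conj]
      gcongr
      exact abs_bubble_le z
    have e2 : ‖((-(sphereDensity z) * inner ℝ z v : ℝ) : ℂ) * conj z‖ ≤ 4 * ‖v‖ := by
      rw [norm_mul, Complex.norm_real, RCLike.norm_conj, norm_mul, norm_neg]
      have hs : 0 ≤ sphereDensity z := by unfold sphereDensity; positivity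
      rw [Real.norm_of_nonneg hs]
      have hi := norm_inner_le_norm (𝕜 := ℝ) z v
      calc sphereDensity z * ‖inner ℝ z v‖ * ‖z‖ ≤ sphereDensity z * (‖z‖ * ‖v‖) * ‖z‖ := by gcongr
        _ = (sphereDensity z * ‖z‖ ^ 2) * ‖v‖ := by ring
        _ ≤ 4 * ‖v‖ := by
          gcongr
          unfold sphereDensity
          rw [mul_assoc, ← div_eq_inv_mul]
          have : ‖z‖ ^ 2 / (1 + ‖z‖ ^ 2) ^ 2 ≤ 1 := by
            rw [div_le_one (by positivity)]
            nlinarith [sq_nonneg ‖z‖, sq_nonneg (‖z‖ ^ 2)]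
          linarith
    have e3 : ‖(bubble z : ℂ) * conj v + ((-(sphereDensity z) * inner ℝ z v : ℝ) : ℂ) * conj z‖
        ≤ 6 * ‖v‖ := (norm_add_le _ _).trans (by linarith)
    exact e3
  have hcomm := integral_fderiv_mul_lineDeriv_comm (fun z => (hfd z).differentiableAt) hM hM' u 1
    Complex.I
  have hint : ∀ v w : ℂ, Integrable (fun x => fderiv ℝ f x v * ∂_{w} u x) volume := by
    intro v w
    refine (∂_{w} u).integrable.bdd_mul (c := 6 * ‖v‖)
      (measurable_fderiv_apply_const ℝ f v).aestronglyMeasurable (Eventually.of_forall fun x => ?_)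
    exact (ContinuousLinearMap.le_opNorm _ _).trans (by gcongr; exact hM' x)
  have hi : ∀ (v : 𝓢(ℂ, ℂ)) {g : ℂ → ℂ}, MemLp g 2 volume →
      Integrable (fun z => v z * conj (g z)) volume := fun v g hg =>
    (v.memLp 2).integrable_mul hg.star
  rw [← sub_eq_zero, ← integral_sub (hi _ memLp_extremalFun') (hi _ memLp_extremalFun)]
  rw [← sub_eq_zero, ← integral_sub (hint _ _) (hint _ _)] at hcomm
  -- Passing from Wirtinger to real partial derivatives gives −i/2, and f = 2·conj h gives another
  -- 1/2.
  rw [← mul_zero (-(Complex.I / 4)), ← hcomm, ← integral_const_mul]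
  refine integral_congr_ae (Eventually.of_forall fun z => ?_)
  have hr : (((1 + ‖z‖ ^ 2)⁻¹ : ℝ) : ℂ) * (1 + ((z.re : ℂ) ^ 2 + (z.im : ℂ) ^ 2)) = 1 := by
    have h : (1 + ‖z‖ ^ 2)⁻¹ * (1 + ‖z‖ ^ 2) = 1 := inv_mul_cancel₀ (by positivity)
    rw [← Complex.normSq_eq_norm_sq, Complex.normSq_apply] at h ⊢
    rw [← pow_two, ← pow_two] at h
    rw [← pow_two, ← pow_two]
    exact_mod_cast h
  have hz : z = z.re + z.im * Complex.I := (Complex.re_add_im z).symm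
  have hzc : conj z = z.re - z.im * Complex.I := by
    conv_lhs => rw [hz]
    rw [map_add, map_mul, Complex.conj_ofReal, Complex.conj_ofReal, Complex.conj_I, mul_neg,
      ← sub_eq_add_neg]
  simp only [hfv, extremalFun, extremalFun', bubble, sphereDensity, dz, dbar, map_mul, map_neg,
    map_pow, Complex.conj_ofReal, hzc, ← inv_pow, map_one, Complex.conj_I]
  push_cast at hr ⊢
  set r : ℂ := (1 + (‖z‖ : ℂ) ^ 2)⁻¹
  simp
  linear_combination (-(Complex.I / 2) * (∂_{Complex.I} u z + Complex.I * ∂_{(1 : ℂ)} u z) * r) * hr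
    + (r ^ 2 * (1 / 2 * ∂_{(1 : ℂ)} u z * (1 + z.re ^ 2)
      + 1 / 2 * Complex.I * ∂_{Complex.I} u z * z.im ^ 2)) * Complex.I_sq

/-- The extremal function as an element of `L²`. -/
def extremal : L2 := memLp_extremalFun.toLp extremalFun

/-- It suffices to test against the dense family ∂u = 𝒮(∂̄u), where the isometry property removes 𝒮
from the left side. -/
theorem beurling_extremal : beurling extremal = memLp_extremalFun'.toLp extremalFun' := by
  refine Dense.eq_of_inner_left ℂ denseRange_dz ?_
  rintro _ ⟨u, rfl⟩
  simp only
  rw [← beurling_dbar, inner_beurling, beurling_dbar, L2.inner_def, L2.inner_def]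
  have h1 : ∫ z, inner ℂ (extremal z) (((dbar u).toLp 2 : L2) z) = ∫ z, dbar u z * conj (extremalFun z) := by
    refine integral_congr_ae ?_
    filter_upwards [memLp_extremalFun.coeFn_toLp, (dbar u).coeFn_toLp 2 volume] with z h1 h2
    rw [extremal, h1, h2, RCLike.inner_apply]
  have h2 : ∫ z, inner ℂ (memLp_extremalFun'.toLp extremalFun' z) (((dz u).toLp 2 : L2) z)
      = ∫ z, dz u z * conj (extremalFun' z) := by
    refine integral_congr_ae ?_
    filter_upwards [memLp_extremalFun'.coeFn_toLp, (dz u).coeFn_toLp 2 volume] with z h1 h2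
    rw [h1, h2, RCLike.inner_apply]
  exact h1.trans ((integral_conj_extremalFun_mul u).symm.trans h2.symm)

/-- The integrand is b·Q(ω) − |ω|² for ω = `extremal`, so this is the equality case of the sharp
bound. In polar coordinates its primitive ½((1+y²)⁻¹ − (1+y²)⁻³) vanishes at 0 and at infinity. -/
theorem integral_radial_eq_zero :
    ∫ z : ℂ, (3 * ((1 + ‖z‖ ^ 2) ^ 4)⁻¹ - ((1 + ‖z‖ ^ 2) ^ 2)⁻¹) = 0 := by
  have hi : Integrable (fun z : ℂ => 3 * ((1 + ‖z‖ ^ 2) ^ 4)⁻¹ - ((1 + ‖z‖ ^ 2) ^ 2)⁻¹) volume := by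
    refine (Integrable.mono' (integrable_inv_one_add_norm_sq_sq.const_mul 3) ?_ ?_).sub
      integrable_inv_one_add_norm_sq_sq
    · exact (continuous_const.mul (Continuous.inv₀ (by fun_prop)
        fun z => by positivity)).aestronglyMeasurable
    · refine Eventually.of_forall fun z => ?_
      rw [Real.norm_of_nonneg (by positivity)]
      gcongr 3 * (?_)⁻¹
      exact pow_le_pow_right₀ (by nlinarith [sq_nonneg ‖z‖]) (by norm_num)
  set f : ℝ → ℝ := fun y => 3 * ((1 + y ^ 2) ^ 4)⁻¹ - ((1 + y ^ 2) ^ 2)⁻¹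
  have h1 := integral_fun_norm_addHaar (volume : Measure ℂ) f
  have hi' := (integrable_fun_norm_addHaar (volume : Measure ℂ) (f := f)).1 hi
  rw [Complex.finrank_real_complex] at h1 hi'
  refine h1.trans ?_
  have hF : ∀ x ∈ Set.Ici (0 : ℝ), HasDerivAt
      (fun y : ℝ => 2⁻¹ * ((1 + y ^ 2)⁻¹ - ((1 + y ^ 2) ^ 3)⁻¹)) (x ^ (2 - 1) • f x) x := by
    intro x _
    have hx : 1 + x ^ 2 ≠ 0 := by positivity
    have h : HasDerivAt (fun y : ℝ => 1 + y ^ 2) (2 * x) x := by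
      simpa using (hasDerivAt_pow 2 x).const_add 1
    have h3 : HasDerivAt (fun y : ℝ => (1 + y ^ 2) ^ 3) (3 * (1 + x ^ 2) ^ 2 * (2 * x)) x := by
      exact (h.pow 3).congr_deriv (by simp)
    refine (((h.inv hx).sub (h3.inv (pow_ne_zero 3 hx))).const_mul 2⁻¹).congr_deriv ?_
    simp only [f, smul_eq_mul]
    field_simp
    ring
  have hlim : Tendsto (fun y : ℝ => 2⁻¹ * ((1 + y ^ 2)⁻¹ - ((1 + y ^ 2) ^ 3)⁻¹)) atTop (𝓝 0) := by
    have hT : Tendsto (fun y : ℝ => 1 + y ^ 2) atTop atTop :=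
      tendsto_atTop_add_const_left _ _ (tendsto_pow_atTop two_ne_zero)
    have h2 := (tendsto_inv_atTop_zero.comp hT).sub (tendsto_inv_atTop_zero.comp
      ((tendsto_pow_atTop three_ne_zero).comp hT))
    simpa using h2.const_mul 2⁻¹
  rw [integral_Ioi_of_hasDerivAt_of_tendsto' hF hi' hlim]
  simp

theorem integral_bubble_mul_jacobian_extremal :
    ∫ z, bubble z * jacobian extremal z = ‖extremal‖ ^ 2 := by
  have hJ : Integrable (jacobian extremal) volume := L1.integrable_coeFn _
  have hbJ : Integrable (fun z => bubble z * jacobian extremal z) volume :=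
    hJ.bdd_mul continuous_bubble.aestronglyMeasurable (Eventually.of_forall abs_bubble_le)
  rw [← integral_norm_sq, ← sub_eq_zero, ← integral_sub hbJ (integrable_norm_sq _),
    ← integral_radial_eq_zero]
  refine integral_congr_ae ?_
  filter_upwards [jacobian_ae extremal, memLp_extremalFun.coeFn_toLp,
    memLp_extremalFun'.coeFn_toLp] with z h1 h2 h3
  rw [h1, beurling_extremal, h3, extremal, h2, norm_extremalFun, norm_extremalFun', bubble]
  field_simp
  ring

theorem extremal_ne_zero : extremal ≠ 0 := by
  intro h
  have h1 := beurling_extremal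
  have h2 : beurling extremal = 0 := by rw [← norm_eq_zero, norm_beurling, h, norm_zero]
  rw [h2] at h1
  have h3 : ∀ᵐ z : ℂ, False := by
    filter_upwards [memLp_extremalFun'.coeFn_toLp, Lp.coeFn_zero ℂ 2 (volume : Measure ℂ)]
      with z h4 h5
    rw [← h1, h5] at h4
    have h6 := norm_extremalFun' z
    rw [← h4] at h6
    simp only [Pi.zero_apply, norm_zero] at h6
    have : 0 < ((1 + ‖z‖ ^ 2) ^ 2)⁻¹ := by positivity
    linarith
  exact NeZero.ne (volume : Measure ℂ) (by simpa using h3)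

/-! ### Membership in CMO and the pairing with bounded functions -/

theorem bmoNorm_le_of_abs_le {d : ℂ → ℝ} {δ : ℝ} (hδ : ∀ z, |d z| ≤ δ) :
    bmoNorm d ≤ ENNReal.ofReal (2 * δ) := by
  refine iSup_le fun c => iSup_le fun r => iSup_le fun _ => ?_
  have hδ0 : 0 ≤ δ := (abs_nonneg _).trans (hδ 0)
  have hfin : volume (square c r) < ∞ :=
    (isCompact_Icc.reProdIm isCompact_Icc : IsCompact (square c r)).measure_lt_top
  have havg : |⨍ w in square c r, d w| ≤ δ := by
    rw [setAverage_eq, smul_eq_mul, abs_mul, abs_inv, abs_of_nonneg measureReal_nonneg,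
      inv_mul_eq_div]
    refine div_le_of_le_mul₀ measureReal_nonneg hδ0 ?_
    exact norm_setIntegral_le_of_norm_le_const (f := d) hfin fun z _ => hδ z
  rw [laverage_eq]
  refine ENNReal.div_le_of_le_mul ?_
  rw [← lintegral_const]
  refine lintegral_mono fun z => ?_
  rw [Real.enorm_eq_ofReal_abs]
  refine ENNReal.ofReal_le_ofReal ((abs_sub _ _).trans ?_)
  linarith [hδ z]

/-- The function tends to 0 at infinity, so smooth cutoffs converge to it uniformly, and the BMO
seminorm is at most twice the supremum. Beyond radius √(2/δ) its values are at most δ. -/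
theorem memCMO_bubble : MemCMO bubble := by
  refine ⟨continuous_bubble.locallyIntegrable, fun ε hε => ?_⟩
  obtain ⟨δ, hδ0, hδ⟩ : ∃ δ : ℝ, 0 < δ ∧ ENNReal.ofReal (2 * δ) < ε := by
    obtain ⟨δ, h0, h1⟩ := ENNReal.lt_iff_exists_nnreal_btwn.1 hε
    refine ⟨δ / 2, by exact_mod_cast half_pos (by exact_mod_cast h0 : (0 : ℝ) < δ), ?_⟩
    rwa [mul_div_cancel₀ _ two_ne_zero, ENNReal.ofReal_coe_nnreal]
  have hR : 0 < Real.sqrt (2 / δ) := by positivity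
  let η : ContDiffBump (0 : ℂ) := ⟨Real.sqrt (2 / δ), Real.sqrt (2 / δ) + 1, hR, by linarith⟩
  refine ⟨fun z => η z * bubble z, ⟨η.contDiff.mul contDiff_bubble,
    η.hasCompactSupport.mul_right⟩, (bmoNorm_le_of_abs_le (δ := δ) fun z => ?_).trans_lt hδ⟩
  rw [Pi.sub_apply]
  have hb := bubble_nonneg z
  by_cases hz : z ∈ Metric.closedBall (0 : ℂ) η.rIn
  · rw [η.one_of_mem_closedBall hz, one_mul, sub_self, abs_zero]
    exact hδ0.le
  · have hz1 : Real.sqrt (2 / δ) < ‖z‖ := by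
      rwa [Metric.mem_closedBall, dist_zero_right, not_le] at hz
    have hz2 : 2 / δ ≤ ‖z‖ ^ 2 := by
      rw [← Real.sq_sqrt (by positivity : (0 : ℝ) ≤ 2 / δ)]
      gcongr
    rw [div_le_iff₀ hδ0] at hz2
    have h1 : bubble z ≤ δ := by
      rw [bubble, ← div_eq_mul_inv, div_le_iff₀ (by positivity)]
      nlinarith
    rw [abs_of_nonneg (by nlinarith [η.le_one (x := z)])]
    nlinarith [η.nonneg (x := z)]

theorem pairing_bubble (f : L1) : pairing bubble f = ∫ z, bubble z * f z := by
  refine Tendsto.limUnder_eq (tendsto_const_nhds.congr' ?_)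
  filter_upwards [eventually_ge_atTop 2] with k hk
  have hk' : (2 : ℝ) ≤ k := by exact_mod_cast hk
  congr 1 with z
  rw [min_eq_left ((bubble_le_two z).trans hk'),
    max_eq_right (le_trans (by linarith) (bubble_nonneg z))]

theorem pairing_zero (b : ℂ → ℝ) : pairing b 0 = 0 := by
  refine Tendsto.limUnder_eq (tendsto_const_nhds.congr fun k => ?_)
  rw [← integral_zero ℂ ℝ]
  refine integral_congr_ae ?_
  filter_upwards [Lp.coeFn_zero ℝ 1 (volume : Measure ℂ)] with z hz
  rw [hz, Pi.zero_apply, mul_zero]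

/-! ### The extremal set of the polarized Jacobian is nonempty -/

/-- Polarizing the sharp bound gives ½(‖ω+γ‖² + ‖ω−γ‖²), which is ‖ω‖² + ‖γ‖² by the parallelogram
law. -/
theorem pairing_bubble_jacobianDeriv_le {p : L2Pair} (hp : ‖p‖ = 1) :
    pairing bubble (jacobianDeriv p) ≤ 1 := by
  have hi : ∀ f : L1, Integrable (fun z => bubble z * f z) volume := fun f =>
    (L1.integrable_coeFn f).bdd_mul continuous_bubble.aestronglyMeasurable
      (Eventually.of_forall abs_bubble_le)
  have e : ∫ z, bubble z * jacobianPolar p.fst p.snd z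
      = 2⁻¹ * ((∫ z, bubble z * jacobian (p.fst + p.snd) z)
        - ∫ z, bubble z * jacobian (p.fst - p.snd) z) := by
    rw [← integral_sub (hi _) (hi _), ← integral_const_mul, jacobianPolar_eq_sub,
      neg_one_smul, neg_one_smul, ← sub_eq_add_neg, ← sub_eq_add_neg]
    refine integral_congr_ae ?_
    filter_upwards [Lp.coeFn_smul (2⁻¹ : ℝ) (jacobian (p.fst + p.snd) - jacobian (p.fst - p.snd)),
      Lp.coeFn_sub (jacobian (p.fst + p.snd)) (jacobian (p.fst - p.snd))] with z h1 h2
    rw [h1, Pi.smul_apply, h2, Pi.sub_apply, smul_eq_mul]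
    ring
  have h1 := abs_le.1 (abs_integral_bubble_mul_jacobian_le (p.fst + p.snd))
  have h2 := abs_le.1 (abs_integral_bubble_mul_jacobian_le (p.fst - p.snd))
  have h3 := WithLp.prod_norm_sq_eq_of_L2 p
  have h4 := parallelogram_law_with_norm ℂ p.fst p.snd
  rw [hp] at h3
  rw [pairing_bubble, jacobianDeriv_eq, e]
  nlinarith

theorem exists_pairing_bubble_eq_one :
    ∃ p : L2Pair, ‖p‖ = 1 ∧ pairing bubble (jacobianDeriv p) = 1 := by
  have hn : 0 < ‖extremal‖ := norm_pos_iff.2 extremal_ne_zero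
  -- Equality is attained on the diagonal: both the squared norm of the pair and its pairing with
  -- `bubble` equal 2a²‖`extremal`‖² = 1.
  set a : ℝ := (Real.sqrt 2 * ‖extremal‖)⁻¹
  have ha : a ^ 2 * (2 * ‖extremal‖ ^ 2) = 1 := by
    simp only [a]
    rw [inv_pow, mul_pow, Real.sq_sqrt (by norm_num)]
    exact inv_mul_cancel₀ (by positivity)
  refine ⟨WithLp.toLp 2 (a • extremal, a • extremal), ?_, ?_⟩
  · rw [← sq_eq_sq₀ (norm_nonneg _) zero_le_one, WithLp.prod_norm_sq_eq_of_L2]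
    change ‖a • extremal‖ ^ 2 + ‖a • extremal‖ ^ 2 = 1 ^ 2
    rw [norm_smul, mul_pow, Real.norm_eq_abs, sq_abs]
    linarith
  · rw [pairing_bubble, jacobianDeriv_eq]
    change ∫ z, bubble z * jacobianPolar (a • extremal) (a • extremal) z = 1
    rw [jacobianPolar_smul_left, jacobianPolar_smul_right, jacobianPolar_self, smul_smul, smul_smul]
    calc ∫ z, bubble z * ((a * a * 2) • jacobian extremal : L1) z
        = ∫ z, (a * a * 2) * (bubble z * jacobian extremal z) := by
          refine integral_congr_ae ?_
          filter_upwards [Lp.coeFn_smul (a * a * 2) (jacobian extremal)] with z hz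
          rw [hz, Pi.smul_apply, smul_eq_mul]
          ring
      _ = 1 := by
          rw [integral_const_mul, integral_bubble_mul_jacobian_extremal]
          linarith

theorem normXQ_jacobianDeriv_bubble : normXQ jacobianDeriv bubble = 1 := by
  obtain ⟨p, hp, h⟩ := exists_pairing_bubble_eq_one
  refine le_antisymm (iSup₂_le fun q hq => ?_) (le_iSup₂_of_le p hp (by rw [h]; rfl))
  exact_mod_cast pairing_bubble_jacobianDeriv_le hq

/-- The dual norm of Q̃(p) is at most 1 for every unit p by definition; `bubble` is the competitor
that attains 1. Without a point here the symmetry assumption would hold vacuously. -/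
theorem extremalSet_jacobianDeriv_nonempty : (extremalSet jacobianDeriv).Nonempty := by
  obtain ⟨p, hp, h⟩ := exists_pairing_bubble_eq_one
  refine ⟨p, hp, le_antisymm (iSup₂_le fun b hb => ?_)
    (le_iSup₂_of_le bubble ⟨memCMO_bubble, normXQ_jacobianDeriv_bubble⟩ (by rw [h]; rfl))⟩
  rw [← hb.2]
  exact le_iSup₂ (f := fun (q : L2Pair) (_ : ‖q‖ = 1) =>
    ((pairing b (jacobianDeriv q) : ℝ) : EReal)) p hp

/-! ### The symmetry assumption -/

theorem ne_zero_of_normXQDual_eq_one {H : Type*} [NormedAddCommGroup H] {Q : H → L1} {f : L1}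
    (h : normXQDual Q f = 1) : f ≠ 0 := by
  rintro rfl
  have h0 : normXQDual Q 0 ≤ 0 := iSup₂_le fun b _ => by rw [pairing_zero]; rfl
  rw [h] at h0
  exact absurd h0 (by norm_num)

theorem eq_of_mul_eq_mul_of_sub_eq_sub {A W B G : ℝ} (hA : 0 ≤ A) (hW : 0 ≤ W) (hB : 0 ≤ B)
    (hG : 0 ≤ G) (hmul : A * B = W * G) (hsub : A - W = B - G) : A = W := by
  have h : (A - W) * (A + G) = 0 := by
    linear_combination hmul + A * hsub
  rcases mul_eq_zero.1 h with h | h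
  · linarith
  · linarith

/-- The directions γ and iγ give the real and imaginary parts of 𝒮ω · conj 𝒮γ = ω · conj γ. With A,
W, B, G the squared moduli of 𝒮ω, ω, 𝒮γ, γ, this yields AB = WG. Together with A − W = B − G it
gives (A − W)(A + G) = 0. -/
theorem jacobian_eq_zero_of_jacobianPolar_eq_zero {ω γ : L2} (h1 : jacobianPolar ω γ = 0)
    (hI : jacobianPolar ω (Complex.I • γ) = 0) (h : jacobian ω = jacobian γ) : jacobian ω = 0 := by
  refine Lp.ext ?_
  have e1 := jacobianPolar_ae ω γ
  have e2 := jacobianPolar_ae ω (Complex.I • γ)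
  rw [h1] at e1
  rw [hI, beurling_smul] at e2
  have e3 := jacobian_ae γ
  rw [← h] at e3
  filter_upwards [e1, e2, e3, jacobian_ae ω, Lp.coeFn_zero ℝ 1 (volume : Measure ℂ),
    Lp.coeFn_smul Complex.I γ, Lp.coeFn_smul Complex.I (beurling γ)] with z e1 e2 e3 e4 h0 hs hs'
  rw [h0, Pi.zero_apply] at e1 e2
  rw [h0, Pi.zero_apply, e4]
  rw [hs, hs', Pi.smul_apply, Pi.smul_apply] at e2
  rw [e4] at e3
  have hX : beurling ω z * conj (beurling γ z) = ω z * conj (γ z) := by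
    apply Complex.ext
    · linarith
    · simp at e2 ⊢
      linarith
  have hN := congrArg (fun w => ‖w‖ ^ 2) hX
  simp only [norm_mul, RCLike.norm_conj, mul_pow] at hN
  rw [sub_eq_zero]
  exact eq_of_mul_eq_mul_of_sub_eq_sub (by positivity) (by positivity) (by positivity)
    (by positivity) hN e3

theorem symmetryAssumption_jacobian : SymmetryAssumption jacobian := by
  intro ω hω γ _ h
  by_contra! hc
  refine ne_zero_of_normXQDual_eq_one hω.2 (jacobian_eq_zero_of_jacobianPolar_eq_zero ?_ ?_ h)
  · have h1 := hc 1 (by simp)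
    rwa [one_smul, lineDeriv_jacobian] at h1
  · have h1 := hc Complex.I (by simp)
    rwa [lineDeriv_jacobian] at h1

/-! ### The partner pair and the failure of the assumption for the polarized Jacobian. -/

theorem coeFn_star_L2 (ω : L2) : (star ω : L2) =ᵐ[volume] fun z => conj (ω z) := Lp.coeFn_star ω

/-- Since 𝒮(conj 𝒮ω) = conj ω, both products in the polar form equal conj(c)·ω·𝒮ω and cancel. -/
theorem jacobianPolar_smul_star_beurling (ω : L2) (c : ℂ) :
    jacobianPolar ω (c • star (beurling ω)) = 0 := by
  refine Lp.ext ?_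
  have e := jacobianPolar_ae ω (c • star (beurling ω))
  rw [beurling_smul, beurling_star_beurling] at e
  filter_upwards [e, Lp.coeFn_zero ℝ 1 (volume : Measure ℂ), coeFn_star_L2 (beurling ω),
    coeFn_star_L2 ω, Lp.coeFn_smul c (star (beurling ω)), Lp.coeFn_smul c (star ω)]
    with z e h0 h1 h2 h3 h4
  rw [e, h0, h3, h4, Pi.smul_apply, Pi.smul_apply, h1, h2]
  simp
  ring

theorem partner_fst (p : L2Pair) : (partner p).fst = -star (beurling p.snd) := rfl

theorem partner_snd (p : L2Pair) : (partner p).snd = star (beurling p.fst) := rfl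

/-- Applying 𝒮 to the partner gives (−conj γ, conj ω), so the two terms of the polar form trade
places; the minus sign in the first slot restores their signs. -/
theorem jacobianDeriv_partner (p : L2Pair) : jacobianDeriv (partner p) = jacobianDeriv p := by
  rw [jacobianDeriv_eq, jacobianDeriv_eq]
  refine Lp.ext ?_
  have e := jacobianPolar_ae (partner p).fst (partner p).snd
  have e1 : beurling (partner p).fst = -star p.snd := by
    rw [partner_fst, beurling_neg, beurling_star_beurling]
  have e2 : beurling (partner p).snd = star p.fst := beurling_star_beurling _
  rw [e1, e2] at e
  filter_upwards [e, jacobianPolar_ae p.fst p.snd, Lp.coeFn_neg (star p.snd),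
    Lp.coeFn_neg (star (beurling p.snd)), coeFn_star_L2 p.fst, coeFn_star_L2 p.snd,
    coeFn_star_L2 (beurling p.fst), coeFn_star_L2 (beurling p.snd)] with z e e' h1 h2 h3 h4 h5 h6
  rw [e, e']
  rw [partner_fst, partner_snd, h1, h2, Pi.neg_apply, Pi.neg_apply, h3, h4, h5, h6]
  simp
  ring

theorem norm_partner (p : L2Pair) : ‖partner p‖ = ‖p‖ := by
  rw [← sq_eq_sq₀ (norm_nonneg _) (norm_nonneg _), WithLp.prod_norm_sq_eq_of_L2,
    WithLp.prod_norm_sq_eq_of_L2, partner_fst, partner_snd, norm_neg, norm_star_L2, norm_star_L2, norm_beurling, norm_beurling, add_comm]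

theorem partner_mem_extremalSet {p : L2Pair} (hp : p ∈ extremalSet jacobianDeriv) :
    partner p ∈ extremalSet jacobianDeriv :=
  ⟨(norm_partner p).trans hp.1, by rw [jacobianDeriv_partner]; exact hp.2⟩

/-- The derivative is a sum of two polar forms, pairing ω with a multiple of conj(𝒮ω) and γ with a
multiple of conj(𝒮γ); each vanishes separately. -/
theorem lineDeriv_jacobianDeriv_smul_partner (p : L2Pair) (c : ℂ) :
    lineDeriv ℝ jacobianDeriv p (c • partner p) = 0 := by
  have e1 : (c • partner p).fst = (-c) • star (beurling p.snd) := by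
    simp [partner]
  have e2 : (c • partner p).snd = c • star (beurling p.fst) := rfl
  rw [lineDeriv_jacobianDeriv, e1, e2, jacobianPolar_comm _ p.snd,
    jacobianPolar_smul_star_beurling, jacobianPolar_smul_star_beurling, add_zero]

theorem not_symmetryAssumption_jacobianDeriv : ¬ SymmetryAssumption jacobianDeriv := by
  intro h
  obtain ⟨p, hp⟩ := extremalSet_jacobianDeriv_nonempty
  obtain ⟨c, _, hc⟩ := h p hp (partner p) (partner_mem_extremalSet hp)
    (jacobianDeriv_partner p).symm
  exact hc (lineDeriv_jacobianDeriv_smul_partner p c)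

end PlanarJacobian

end

open PlanarJacobian in
theorem proposition5p4 :
    -- for every admissible `χ`, both operators map into the Hardy space, where they are
    -- Gâteaux differentiable
    (∀ χ : ℂ → ℝ, IsTest χ → (∫ x, χ x) ≠ 0 →
      (∀ ω : L2, MemHardy χ (jacobian ω) ∧
        HasGateauxDerivHardy χ jacobian ω (lineDeriv ℝ jacobian ω)) ∧
      (∀ p : L2Pair, MemHardy χ (jacobianDeriv p) ∧
        HasGateauxDerivHardy χ jacobianDeriv p (lineDeriv ℝ jacobianDeriv p))) ∧
    -- the planar Jacobian satisfies the assumption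
    SymmetryAssumption jacobian ∧
    -- its Gâteaux derivative does not
    ¬ SymmetryAssumption jacobianDeriv ∧
    -- every pair in the extremal set has a partner along which the derivative vanishes
    (∀ p ∈ extremalSet jacobianDeriv,
      partner p ∈ extremalSet jacobianDeriv ∧
      jacobianDeriv (partner p) = jacobianDeriv p ∧
      ∀ c : ℂ, ‖c‖ = 1 → lineDeriv ℝ jacobianDeriv p (c • partner p) = 0) := by
  refine ⟨fun χ hχ _ => ⟨fun ω => ⟨hχ.memHardy_jacobian ω, hχ.hasGateauxDerivHardy_jacobian ω⟩,
    fun p => ⟨hχ.memHardy_jacobianDeriv p, hχ.hasGateauxDerivHardy_jacobianDeriv p⟩⟩,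
    symmetryAssumption_jacobian, not_symmetryAssumption_jacobianDeriv, fun p hp =>
    ⟨partner_mem_extremalSet hp, jacobianDeriv_partner p,
      fun c _ => lineDeriv_jacobianDeriv_smul_partner p c⟩⟩
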